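/- Let $d\ge 0$, write $\cos_{\pi/2}(r)=\cos(\min\{\pi/2,r\})$ and $\mathbf{arctan}(v)=\arctan(|v|)\,v/|v|$ (with value $0$ at $v=0$) for $v\in\mathbb R^d$, and let $B_{\pi/2}(x)$ be the open ball. For $t\in(0,1]$ and $\xi:\mathbb R^d\to[-\tfrac12,+\infty]$ set $$P_t\xi(x)=\inf_{y\in B_{\pi/2}(x)}\frac1{2t}\Big(1-\frac{\cos^2_{\pi/2}(|x-y|)}{1+2t\xi(y)}\Big),\qquad c/0=+\infty,\ c/(+\infty)=0\ (c>0),$$ $P_0\xi=\xi$, and $R_t\eta=-P_t(-\eta)$. Let $\mathsf M_t\xi(x)\subset B_{\pi/2}(x)$ be the set of minimizers in this formula ($t>0$). Let $a,\bar a\in\mathbb R$ with $a\ge-\frac12$ and $\bar a\ge-\frac12$, let $\xi_0:\mathbb R^d\to[a,+\infty]$ be lower semicontinuous and $\bar\xi_1:\mathbb R^d\to[-\infty,-\bar a]$ upper semicontinuous, with $P_1\xi_0\ge\bar\xi_1$. For $t\in[0,1]$ set $\xi_t=P_t\xi_0$, $\bar\xi_t=R_{1-t}\bar\xi_1$, $\Xi_t=\{x:\xi_t(x)=\bar\xi_t(x)\}$,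 and put $\Xi^-=\{\xi_0=-\frac12\}$, $\Xi^+=\{\bar\xi_1=\frac12\}$, $\Lambda_a(t)=\frac1{t(1+2at)}$. For $s\ne t$ let $\mathsf M_{s\to t}(x)=\mathsf M_{s-t}\xi_t(x)$ if $t<s$ and $\mathsf M_{s\to t}(x)=\mathsf M_{t-s}(-\bar\xi_t)(x)$ if $s<t$. Then the following holds. (1) $\xi_t\ge\bar\xi_t$ on $\mathbb R^d$ for every $t\in[0,1]$. For $t\in(0,1)$ the functions $\xi_t,\bar\xi_t$ are finite and $\Xi_t$ is closed. Every $x\in\overline{\Xi_1}$ such that $|x-y|\ne\frac\pi2$ for all $y\in\Xi^-$ belongs to $\Xi_1$, and every $x\in\overline{\Xi_0}$ such that $|x-y|\neq\frac\pi2$ for all $y\in\Xi^+$ belongs to $\Xi_0$; in particular $\Xi_1$ is closed if $\Xi^-=\emptyset$ and $\Xi_0$ is closed if $\Xi^+=\emptyset$. (2) For every $t\in(0,1)$ and $x\in\Xi_t$ there is a unique $p=g_t(x)\in\mathbb R^d$ such that for all $y\in\mathbb R^d$ $$\xi_t(y)-\xi_t(x)-\tfrac12\Lambda_a(t)|x-y|^2\le\langle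 p,y-x\rangle\le\bar\xi_t(y)-\xi_t(x)+\tfrac12\Lambda_{\bar a}(1-t)|x-y|^2 ,$$ and $\xi_t$, $\bar\xi_t$ are both differentiable at $x$ with gradient $g_t(x)$. (3) For $t\in(0,1)$ the map $g_t$ is bounded on $\Xi_t$ and Lipschitz there with a constant $C(t)\le2(\Lambda_a(t)+\Lambda_{\bar a}(1-t))\le\frac4{t(1-t)}$. Moreover $\Xi^-=\{x\in\Xi_t:\xi_t(x)=-\frac1{2(1-t)}\}$ for $t\in[0,1)$, $\Xi^+=\{x\in\Xi_t:\bar\xi_t(x)=\frac1{2t}\}$ for $t\in(0,1]$, $\Xi^-\cup\Xi^+\subset\Xi_t$ for all $t\in[0,1]$, and $g_t=0$ on $\Xi^-\cup\Xi^+$ for $t\in(0,1)$. (4) Let $s\in(0,1)$, $t\in[0,1]$, $\tau=t-s\ne0$. For every $x\in\Xi_s$ with $1+2\tau\xi_s(x)>0$ the set $\mathsf M_{s\to t}(x)$ has exactly one element $T_{s\to t}(x)$; it lies in $\Xi_t$, $\xi_t$ is finite there, $x\in\mathsf M_{t\to s}(T_{s\to t}(x))$, and $$T_{s\to t}(x)=x+\mathbf{arctan}\Big(\frac{\tau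 g_s(x)}{1+2\tau\xi_s(x)}\Big),\qquad \big(1-2\tau\xi_t(T_{s\to t}(x))\big)\big(1+2\tau\xi_s(x)\big)=\cos_{\pi/2}^2(|x-T_{s\to t}(x)|).$$ (5) Whenever $T_{s\to t}(x)$ is defined by (4) and $x\in\Xi^-\cup\Xi^+$, one has $T_{s\to t}(x)=x$; in the remaining cases (namely $t=s$; or $t=0$ and $x\in\Xi^+$; or $t=1$ and $x\in\Xi^-$) set $T_{s\to t}(x)=x$. Then for $s\in(0,1)$ and $x\in\Xi_s$ the map $t\mapsto T_{s\to t}(x)$ is analytic in $[0,1]$. For $s,t\in(0,1)$ the map $T_{s\to t}$ is Lipschitz on $\Xi_s$; $T_{s\to0}$ is locally Lipschitz on $\Xi_s\setminus\Xi^+$ and $T_{s\to1}$ is locally Lipschitz on $\Xi_s\setminus\Xi^-$. (6) For $s\in(0,1)$, $t\in[0,1]$, $\tau=t-s$ and $x\in\Xi_s$ one has $1-2\tau\xi_t(T_{s\to t}(x))\in(0,+\infty]$, and the function $q_{s\to t}(x)\ge0$ given by $$q_{s\to t}^2(x)=\frac{1+2\tau\xi_s(x)}{1-2\tau\xi_t(T_{s\to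 t}(x))}=(1+2\tau\xi_s(x))^2+\tau^2|g_s(x)|^2\qquad(0/(+\infty)=0)$$ is well defined (the two expressions agree). The map $t\mapsto q_{s\to t}(x)$ is analytic in $[0,1]$; $q_{s\to t}$ is bounded and Lipschitz on $\Xi_s$; $q_{s\to t}(x)>0$ if $t\in(0,1)$, or $t=0$ and $x\notin\Xi^+$, or $t=1$ and $x\notin\Xi^-$; and $q_{s\to t}(x)=1+2\tau\xi_s(x)$ for $x\in\Xi^-\cup\Xi^+$. (7) For all $t_0,t_1\in(0,1)$, $t_2\in[0,1]$ and $x\in\Xi_{t_0}$ one has $T_{t_0\to t_1}(x)\in\Xi_{t_1}$ and $$T_{t_1\to t_2}(T_{t_0\to t_1}(x))=T_{t_0\to t_2}(x),\qquad q_{t_1\to t_2}(T_{t_0\to t_1}(x))\,q_{t_0\to t_1}(x)=q_{t_0\to t_2}(x).$$ Here a function of $t$ is analytic in $[0,1]$ if near every point of $[0,1]$ it coincides on $[0,1]$ with a convergent power series. -/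

import Mathlib

open Set Metric

namespace HKFlow

/-- The truncated cosine `cos_{π/2}(r) = cos (min {π/2, r})`. -/
noncomputable def cosTrunc (r : ℝ) : ℝ := Real.cos (min (Real.pi / 2) r)

/-- The vector-valued arctangent: `arctan(‖v‖) v / ‖v‖`, and `0` at `v = 0`. -/
noncomputable def arctanVec {d : ℕ} (v : EuclideanSpace ℝ (Fin d)) : EuclideanSpace ℝ (Fin d) :=
  (Real.arctan ‖v‖ / ‖v‖) • v

/-- The function minimised in the generalized Hopf-Lax formula,
`(1 / (2t)) (1 - cos²_{π/2}(|x - y|) / (1 + 2 t ξ(y)))`, for `t > 0` and `1 + 2 t ξ ≥ 0`.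
The quotient is taken in `[0, ∞]`, where `c / 0 = ∞` and `c / ∞ = 0` for `0 < c < ∞`. -/
noncomputable def hopfLaxCost {d : ℕ} (t : ℝ) (ξ : EuclideanSpace ℝ (Fin d) → EReal)
    (x y : EuclideanSpace ℝ (Fin d)) : EReal :=
  ((1 / (2 * t) : ℝ) : EReal) *
    (1 - ((ENNReal.ofReal (cosTrunc (dist x y) ^ 2) /
      (1 + ((2 * t : ℝ) : EReal) * ξ y).toENNReal : ENNReal) : EReal))

/-- The generalized Hopf-Lax operator `P_t`, with `P_0 ξ = ξ`; for `t > 0` the infimum is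
restricted to the points `y` with `|x - y| < π/2`. -/
noncomputable def hopfLax {d : ℕ} (t : ℝ) (ξ : EuclideanSpace ℝ (Fin d) → EReal)
    (x : EuclideanSpace ℝ (Fin d)) : EReal :=
  if t = 0 then ξ x else ⨅ y ∈ ball x (Real.pi / 2), hopfLaxCost t ξ x y

/-- The backward operator `R_t ξ = - P_t (- ξ)`. -/
noncomputable def hopfLaxBack {d : ℕ} (t : ℝ) (ξ : EuclideanSpace ℝ (Fin d) → EReal)
    (x : EuclideanSpace ℝ (Fin d)) : EReal :=
  - hopfLax t (fun y => - ξ y) x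

/-- The set `M_t ξ (x)` of minimisers in the Hopf-Lax formula for `P_t ξ (x)`, with
`M_0 ξ (x) = {x}`. -/
def minimizers {d : ℕ} (t : ℝ) (ξ : EuclideanSpace ℝ (Fin d) → EReal)
    (x : EuclideanSpace ℝ (Fin d)) : Set (EuclideanSpace ℝ (Fin d)) :=
  {y | (t = 0 ∧ y = x) ∨
    (t ≠ 0 ∧ y ∈ ball x (Real.pi / 2) ∧ IsMinOn (hopfLaxCost t ξ x) (ball x (Real.pi / 2)) y)}

/-- The forward solution `ξ_t = P_t ξ_0`. -/
noncomputable def fwd {d : ℕ} (ξ₀ : EuclideanSpace ℝ (Fin d) → EReal) (t : ℝ) :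
    EuclideanSpace ℝ (Fin d) → EReal := hopfLax t ξ₀

/-- The backward solution `ξ̄_t = R_{1-t} ξ̄_1`. -/
noncomputable def bwd {d : ℕ} (η₁ : EuclideanSpace ℝ (Fin d) → EReal) (t : ℝ) :
    EuclideanSpace ℝ (Fin d) → EReal := hopfLaxBack (1 - t) η₁

/-- The contact set `Ξ_t = {ξ̄_t = ξ_t}`. -/
def contactSet {d : ℕ} (ξ₀ η₁ : EuclideanSpace ℝ (Fin d) → EReal) (t : ℝ) :
    Set (EuclideanSpace ℝ (Fin d)) := {x | bwd η₁ t x = fwd ξ₀ t x}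

/-- The optimal points at time `t` for the point `x` at time `s`. For `t < s` these are the
minimisers for `ξ_s(x) = P_{s-t} ξ_t (x)`, and for `s < t` the optimal points for
`ξ̄_s(x) = R_{t-s} ξ̄_t (x)`, that is the minimisers for `P_{t-s} (-ξ̄_t) (x)`. -/
def optPoints {d : ℕ} (ξ₀ η₁ : EuclideanSpace ℝ (Fin d) → EReal) (s t : ℝ)
    (x : EuclideanSpace ℝ (Fin d)) : Set (EuclideanSpace ℝ (Fin d)) :=
  {y | (t ≤ s ∧ y ∈ minimizers (s - t) (fwd ξ₀ t) x) ∨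
    (s < t ∧ y ∈ minimizers (t - s) (fun z => - bwd η₁ t z) x)}

/-- The constant `Λ_a(t) = 1 / (t (1 + 2 a t))`. -/
noncomputable def Lam (a t : ℝ) : ℝ := 1 / (t * (1 + 2 * a * t))

end HKFlow

/-! The cost is best read as a product: if 1+2τu > 0 and |x-y| < π/2, a real v lies below the cost
exactly when cos²|x-y| ≤ (1+2τu)(1-2τv). This relation is invariant under (u,v) ↦ (-v,-u), so
reversing time exchanges forward and backward solutions (`OrderedPair.swap`), and most facts are
proved in one time direction only.

Comparison. By `three_point`, a product inequality between two times forces the backward value at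
any intermediate time to stay below the forward one. With v = η₁ this orders the two solutions; with
v = ξ_s(x) it gives one half of the semigroup law, namely that ξ_s is at most the cost built from
ξ_t (`toReal_fwd_le_cost`). The other half is needed only at contact points, where `exists_optimal`
exhibits the optimal intermediate point explicitly.

Regularity. Since cos² r + r² is convex, ξ_t is semiconcave and the backward solution is semiconvex.
At a contact point these ordered functions are squeezed between two paraboloids, so they share a
gradient g, which is Lipschitz on the contact set.

Transport. The cost frozen at an optimal y touches ξ_s from above at x, so its gradient there is
g_s(x). Solving for y gives the arctangent formula, and with it uniqueness.

The algebra is that of one complex number ζ_s = 2ξ_s(x) + i|g_s(x)|. With τ = t-s one has q =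
|1+τζ_s|, the signed displacement along g_s/|g_s| is arg(1+τζ_s), and ζ_t = ζ_s/(1+τζ_s) at the
image point. Concatenation is the identity 1+(r-s)ζ_s = (1+(r-t)ζ_t)(1+(t-s)ζ_s), read in argument
and modulus. The real part 1+2τξ_s is nonnegative on [0,1]; on the contact set it vanishes only at t
= 0 on Ξ⁺ or t = 1 on Ξ⁻, where g = 0. This gives analyticity up to the end points. -/

namespace HKFlow

/-! ### Truncated cosine, its semiconvexity, and the three-point inequality. -/

section Trigonometry

lemma cosTrunc_of_le {r : ℝ} (h : r ≤ Real.pi / 2) : cosTrunc r = Real.cos r := by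
  rw [cosTrunc, min_eq_right h]

lemma cosTrunc_of_ge {r : ℝ} (h : Real.pi / 2 ≤ r) : cosTrunc r = 0 := by
  rw [cosTrunc, min_eq_left h, Real.cos_pi_div_two]

lemma cosTrunc_pos {r : ℝ} (h0 : 0 ≤ r) (h : r < Real.pi / 2) : 0 < cosTrunc r := by
  rw [cosTrunc_of_le h.le]
  exact Real.cos_pos_of_mem_Ioo ⟨by linarith [Real.pi_pos], h⟩

@[simp] lemma cosTrunc_zero : cosTrunc 0 = 1 := by
  rw [cosTrunc_of_le (by positivity), Real.cos_zero]

lemma cosTrunc_sq_le_one (r : ℝ) : cosTrunc r ^ 2 ≤ 1 := Real.cos_sq_le_one _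

lemma cosTrunc_eq_one {r : ℝ} (h0 : 0 ≤ r) (h : 1 ≤ cosTrunc r ^ 2) : r = 0 := by
  rcases lt_or_ge r (Real.pi / 2) with hr | hr
  · rw [cosTrunc_of_le hr.le] at h
    have hs := Real.sin_sq_add_cos_sq r
    have : Real.sin r = 0 := by nlinarith [sq_nonneg (Real.sin r)]
    exact (Real.sin_eq_zero_iff_of_lt_of_lt (by linarith [Real.pi_pos])
      (by linarith [Real.pi_pos])).1 this
  · rw [cosTrunc_of_ge hr] at h
    norm_num at h

@[fun_prop] lemma continuous_cosTrunc : Continuous cosTrunc := by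
  unfold cosTrunc
  fun_prop

lemma abs_cosTrunc_sq_sub_le (r s : ℝ) : |cosTrunc r ^ 2 - cosTrunc s ^ 2| ≤ 2 * |r - s| := by
  have h1 : |cosTrunc r - cosTrunc s| ≤ |r - s| := by
    refine (Real.abs_cos_sub_cos_le _ _).trans ?_
    have := abs_min_sub_min_le_max (Real.pi / 2) r (Real.pi / 2) s
    simpa using this
  have h2 : |cosTrunc r + cosTrunc s| ≤ 2 := by
    refine (abs_add_le _ _).trans ?_
    have h3 := Real.abs_cos_le_one (min (Real.pi / 2) r)
    have h4 := Real.abs_cos_le_one (min (Real.pi / 2) s)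
    unfold cosTrunc
    linarith
  calc |cosTrunc r ^ 2 - cosTrunc s ^ 2|
      = |cosTrunc r + cosTrunc s| * |cosTrunc r - cosTrunc s| := by rw [← abs_mul]; ring_nf
    _ ≤ 2 * |r - s| := mul_le_mul h2 h1 (abs_nonneg _) (by norm_num)

lemma cos_add_le_cosTrunc {α β : ℝ} (h0 : 0 ≤ α + β) (h1 : α + β ≤ Real.pi) :
    Real.cos (α + β) ≤ cosTrunc (α + β) :=
  Real.cos_le_cos_of_nonneg_of_le_pi (le_min (by positivity) h0) h1 (min_le_right _ _)

lemma cosTrunc_antitone {r s : ℝ} (h0 : 0 ≤ r) (h : r ≤ s) : cosTrunc s ≤ cosTrunc r :=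
  Real.cos_le_cos_of_nonneg_of_le_pi (le_min (by positivity) h0)
    ((min_le_left _ _).trans (by linarith [Real.pi_pos])) (min_le_min_left _ h)

/-- Tangent line inequality for the convex function `cos² + id²`. -/
lemma cos_sq_tangent_le (r s : ℝ) :
    Real.cos r ^ 2 - Real.sin (2 * r) * (s - r) - (s - r) ^ 2 ≤ Real.cos s ^ 2 := by
  have hd : ∀ x : ℝ, HasDerivAt (fun x => Real.cos x ^ 2 + x ^ 2) (2 * x - Real.sin (2 * x)) x := by
    intro x
    have := ((Real.hasDerivAt_cos x).pow 2).add (hasDerivAt_pow 2 x)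
    refine this.congr_deriv ?_
    rw [Real.sin_two_mul]
    simp
    ring
  have hmono : Monotone (fun x : ℝ => 2 * x - Real.sin (2 * x)) := by
    intro x y hxy
    have h := Real.abs_sin_sub_sin_le (2 * y) (2 * x)
    rw [abs_of_nonneg (by linarith : (0 : ℝ) ≤ 2 * y - 2 * x)] at h
    have := (abs_le.1 h).2
    simp only
    linarith
  have hconv : ConvexOn ℝ univ (fun x : ℝ => Real.cos x ^ 2 + x ^ 2) := by
    refine MonotoneOn.convexOn_of_deriv convex_univ
      (fun x _ => (hd x).continuousAt.continuousWithinAt)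
      (fun x _ => (hd x).differentiableAt.differentiableWithinAt) ?_
    have : deriv (fun x : ℝ => Real.cos x ^ 2 + x ^ 2) = fun x => 2 * x - Real.sin (2 * x) :=
      funext fun x => (hd x).deriv
    rw [this]
    exact hmono.monotoneOn _
  rcases lt_trichotomy r s with h | h | h
  · have := hconv.le_slope_of_hasDerivAt (mem_univ r) (mem_univ s) h (hd r)
    rw [slope_def_field, le_div_iff₀ (by linarith)] at this
    nlinarith
  · subst h; simp
  · have := hconv.slope_le_of_hasDerivAt (mem_univ s) (mem_univ r) h (hd r)
    rw [slope_def_field, div_le_iff₀ (by linarith)] at this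
    nlinarith

/-- For s beyond π/2 the truncated value is 0. The untruncated inequality at π/2 already makes the
left side nonpositive there, and the left side keeps decreasing in s because sin(2r) ≥ 0. -/
lemma cosTrunc_sq_tangent_le {r s : ℝ} (h0 : 0 ≤ r) (hr : r < Real.pi / 2) :
    cosTrunc r ^ 2 - Real.sin (2 * r) * (s - r) - (s - r) ^ 2 ≤ cosTrunc s ^ 2 := by
  rw [cosTrunc_of_le hr.le]
  rcases le_or_gt s (Real.pi / 2) with h | h
  · rw [cosTrunc_of_le h]
    exact cos_sq_tangent_le r s
  · rw [cosTrunc_of_ge h.le]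
    have h1 := cos_sq_tangent_le r (Real.pi / 2)
    rw [Real.cos_pi_div_two] at h1
    have hs : 0 ≤ Real.sin (2 * r) :=
      Real.sin_nonneg_of_nonneg_of_le_pi (by linarith) (by linarith)
    nlinarith [mul_nonneg hs (by linarith : 0 ≤ s - Real.pi / 2)]

/-- The three-point inequality behind the comparison of forward and backward solutions. -/
lemma three_point {α β γ σ τ u v : ℝ} (hα : 0 ≤ α) (hβ : 0 ≤ β) (hγ0 : 0 ≤ γ) (hγ : γ ≤ α + β)
    (hσ : 0 < σ) (hτ : 0 < τ) (hu : 0 ≤ 1 + 2 * (σ + τ) * u) (hv : 0 ≤ 1 - 2 * (σ + τ) * v)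
    (h : cosTrunc γ ^ 2 ≤ (1 + 2 * (σ + τ) * u) * (1 - 2 * (σ + τ) * v)) :
    (cosTrunc β ^ 2 * (1 - 2 * τ * v)⁻¹ - 1) / (2 * τ) ≤
      (1 - cosTrunc α ^ 2 * (1 + 2 * σ * u)⁻¹) / (2 * σ) := by
  set A := 1 + 2 * (σ + τ) * u with hA
  set B := 1 - 2 * (σ + τ) * v with hB
  have hp : 0 < 1 + 2 * σ * u := by nlinarith
  have hq : 0 < 1 - 2 * τ * v := by nlinarith
  -- The weight is affine in time, so the intermediate weights are convex combinations of 1 with A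
  -- and of 1 with B.
  have hP : 1 + 2 * σ * u = (τ + σ * A) / (σ + τ) := by rw [hA]; field_simp; ring
  have hQ : 1 - 2 * τ * v = (σ + τ * B) / (σ + τ) := by rw [hB]; field_simp; ring
  have hP' : 0 < τ + σ * A := by positivity
  have hQ' : 0 < σ + τ * B := by positivity
  suffices hmain : (σ + τ * B) * τ * cosTrunc α ^ 2 + (τ + σ * A) * σ * cosTrunc β ^ 2 ≤
      (τ + σ * A) * (σ + τ * B) by
    rw [hP, hQ, div_le_div_iff₀ (by positivity) (by positivity)]
    have : (1 - cosTrunc α ^ 2 * ((τ + σ * A) / (σ + τ))⁻¹) * (2 * τ) -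
        (cosTrunc β ^ 2 * ((σ + τ * B) / (σ + τ))⁻¹ - 1) * (2 * σ) =
        2 * (σ + τ) * ((τ + σ * A) * (σ + τ * B) - ((σ + τ * B) * τ * cosTrunc α ^ 2 +
          (τ + σ * A) * σ * cosTrunc β ^ 2)) / ((τ + σ * A) * (σ + τ * B)) := by
      field_simp
      ring
    have h2 : 0 ≤ 2 * (σ + τ) * ((τ + σ * A) * (σ + τ * B) - ((σ + τ * B) * τ * cosTrunc α ^ 2 +
          (τ + σ * A) * σ * cosTrunc β ^ 2)) / ((τ + σ * A) * (σ + τ * B)) :=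
      div_nonneg (mul_nonneg (by positivity) (by linarith)) (by positivity)
    linarith
  -- With sin standing for √(1 - cosTrunc²), right minus left in `hmain` equals (τ√B sin α - σ√A sin
  -- β)² plus στ times the expression below.
  have key : 0 ≤ A * B + 1 - cosTrunc α ^ 2 - cosTrunc β ^ 2 +
      2 * (√A * √B) * (√(1 - cosTrunc α ^ 2) * √(1 - cosTrunc β ^ 2)) := by
    have hAB := mul_nonneg hu hv
    have hs : 0 ≤ 2 * (√A * √B) * (√(1 - cosTrunc α ^ 2) * √(1 - cosTrunc β ^ 2)) := by positivity
    rcases le_or_gt (Real.pi / 2) α with h1 | h1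
    · have := cosTrunc_sq_le_one β
      rw [cosTrunc_of_ge h1] at hs ⊢
      linarith
    rcases le_or_gt (Real.pi / 2) β with h2 | h2
    · have := cosTrunc_sq_le_one α
      rw [cosTrunc_of_ge h2] at hs ⊢
      linarith
    have hsin : ∀ {r : ℝ}, 0 ≤ r → r < Real.pi / 2 → √(1 - cosTrunc r ^ 2) = Real.sin r := by
      intro r h0 hr
      rw [cosTrunc_of_le hr.le, ← Real.sin_sq,
        Real.sqrt_sq (Real.sin_nonneg_of_nonneg_of_le_pi h0 (by linarith))]
    have hsα := Real.sin_nonneg_of_nonneg_of_le_pi hα (by linarith)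
    have hsβ := Real.sin_nonneg_of_nonneg_of_le_pi hβ (by linarith)
    have hk0 : 0 ≤ √A * √B := by positivity
    -- The triangle inequality enters here. Passing through `cosTrunc` discards the sign of
    -- cos(α+β), so that the squared hypothesis suffices.
    have hk : Real.cos (α + β) ≤ √A * √B := by
      refine (cos_add_le_cosTrunc (by linarith) (by linarith)).trans
        ((cosTrunc_antitone hγ0 hγ).trans ?_)
      rw [← Real.sqrt_mul hu]
      exact Real.le_sqrt_of_sq_le h
    rw [Real.cos_add] at hk
    have hcα := cosTrunc_pos hα h1
    have hcβ := cosTrunc_pos hβ h2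
    rw [hsin hα h1, hsin hβ h2]
    rw [cosTrunc_of_le h1.le] at hcα ⊢
    rw [cosTrunc_of_le h2.le] at hcβ ⊢
    have e : (√A * √B) ^ 2 = A * B := by rw [mul_pow, Real.sq_sqrt hu, Real.sq_sqrt hv]
    have e1 := Real.sin_sq_add_cos_sq α
    have e2 := Real.sin_sq_add_cos_sq β
    -- Squaring cos α cos β ≤ √A√B + sin α sin β and inserting `h4` yields exactly `key`.
    have h3 : (Real.cos α * Real.cos β) ^ 2 ≤ (√A * √B + Real.sin α * Real.sin β) ^ 2 :=
      pow_le_pow_left₀ (by positivity) (by linarith) 2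
    have h4 : (Real.sin α * Real.sin β) ^ 2 =
        1 - Real.cos α ^ 2 - Real.cos β ^ 2 + (Real.cos α * Real.cos β) ^ 2 := by
      rw [mul_pow, Real.sin_sq, Real.sin_sq]
      ring
    nlinarith
  have h5 := sq_nonneg (τ * √B * √(1 - cosTrunc α ^ 2) - σ * √A * √(1 - cosTrunc β ^ 2))
  have hA2 := Real.sq_sqrt hu
  have hB2 := Real.sq_sqrt hv
  have hα2 := Real.sq_sqrt (sub_nonneg.2 (cosTrunc_sq_le_one α))
  have hβ2 := Real.sq_sqrt (sub_nonneg.2 (cosTrunc_sq_le_one β))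
  have h6 := mul_nonneg (mul_pos hσ hτ).le key
  have h7 : (τ * √B * √(1 - cosTrunc α ^ 2) - σ * √A * √(1 - cosTrunc β ^ 2)) ^ 2 =
      τ ^ 2 * B * (1 - cosTrunc α ^ 2) + σ ^ 2 * A * (1 - cosTrunc β ^ 2) -
      2 * (σ * τ) * ((√A * √B) * (√(1 - cosTrunc α ^ 2) * √(1 - cosTrunc β ^ 2))) := by
    linear_combination (τ ^ 2 * √(1 - cosTrunc α ^ 2) ^ 2) * hB2 + τ ^ 2 * B * hα2 +
      (σ ^ 2 * √(1 - cosTrunc β ^ 2) ^ 2) * hA2 + σ ^ 2 * A * hβ2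
  nlinarith

end Trigonometry

/-! ### Quadratic estimates in an inner product space. -/

section Vector

variable {E : Type*} [NormedAddCommGroup E] [InnerProductSpace ℝ E]

/-- The squared truncated cosine of the norm is semiconvex, with the sharp constant. -/
lemma cosTrunc_norm_sq_tangent_le (z w : E) (hz : ‖z‖ < Real.pi / 2) :
    cosTrunc ‖z‖ ^ 2 - inner ℝ ((Real.sin (2 * ‖z‖) / ‖z‖) • z) w - ‖w‖ ^ 2 ≤
      cosTrunc ‖z + w‖ ^ 2 := by
  refine le_trans ?_ (cosTrunc_sq_tangent_le (s := ‖z + w‖) (norm_nonneg z) hz)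
  have hexp := norm_add_sq_real z w
  have htri : (‖z + w‖ - ‖z‖) ^ 2 ≤ ‖w‖ ^ 2 := by
    rw [← sq_abs (‖z + w‖ - ‖z‖)]
    refine pow_le_pow_left₀ (abs_nonneg _) ?_ 2
    simpa using abs_norm_sub_norm_le (z + w) z
  rw [real_inner_smul_left]
  rcases eq_or_ne z 0 with rfl | hz0
  · simp
  have hr : 0 < ‖z‖ := norm_pos_iff.2 hz0
  have hsin : Real.sin (2 * ‖z‖) ≤ 2 * ‖z‖ := Real.sin_le (by positivity)
  set l := Real.sin (2 * ‖z‖) / ‖z‖ with hl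
  have hl1 : Real.sin (2 * ‖z‖) = l * ‖z‖ := by rw [hl]; field_simp
  have hl2 : l ≤ 2 := by rw [hl, div_le_iff₀ hr]; exact hsin
  rw [hl1]
  -- The two sides differ by (1 - l/2)(‖w‖² - (‖z+w‖ - ‖z‖)²), after expressing ⟨z,w⟩ through the
  -- norms.
  nlinarith [mul_nonneg (sub_nonneg.2 hl2) (sub_nonneg.2 htri)]

lemma norm_sin_smul_le (z : E) : ‖(Real.sin (2 * ‖z‖) / ‖z‖) • z‖ ≤ 1 := by
  rcases eq_or_ne z 0 with rfl | hz0
  · simp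
  have hr : 0 < ‖z‖ := norm_pos_iff.2 hz0
  rw [norm_smul, norm_div, norm_norm, div_mul_cancel₀ _ hr.ne']
  exact Real.abs_sin_le_one _

/-- A linear functional with quadratic upper bound vanishes. -/
lemma eq_zero_of_inner_le_sq {p : E} {C : ℝ} (h : ∀ w : E, inner ℝ p w ≤ C * ‖w‖ ^ 2) : p = 0 := by
  by_contra hp
  have hp' : 0 < ‖p‖ := norm_pos_iff.2 hp
  have h1 := h ((1 / (|C| + 1)) • p)
  rw [real_inner_smul_right, real_inner_self_eq_norm_sq, norm_smul, mul_pow, Real.norm_eq_abs,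
    sq_abs] at h1
  have hC := le_abs_self C
  have h2 : 1 / (|C| + 1) * ‖p‖ ^ 2 = (|C| + 1) * ((1 / (|C| + 1)) ^ 2 * ‖p‖ ^ 2) := by
    field_simp
  rw [h2] at h1
  have h3 : 0 < (1 / (|C| + 1)) ^ 2 * ‖p‖ ^ 2 := by positivity
  nlinarith

lemma eq_of_inner_le_inner_add_sq {p q : E} {C : ℝ}
    (h : ∀ w : E, inner ℝ p w ≤ inner ℝ q w + C * ‖w‖ ^ 2) : p = q := by
  refine sub_eq_zero.1 (eq_zero_of_inner_le_sq (C := C) fun w => ?_)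
  rw [inner_sub_left]
  linarith [h w]

lemma hasGradientAt_of_quadratic_bounds [CompleteSpace E] {f : E → ℝ} {p x : E} {C C' : ℝ}
    (h1 : ∀ y, f y ≤ f x + inner ℝ p (y - x) + C * ‖x - y‖ ^ 2)
    (h2 : ∀ y, f x + inner ℝ p (y - x) - C' * ‖x - y‖ ^ 2 ≤ f y) : HasGradientAt f p x := by
  rw [hasGradientAt_iff_isLittleO]
  refine Asymptotics.IsBigO.trans_isLittleO (g := fun y => ‖y - x‖ ^ 2) ?_ ?_
  · refine Asymptotics.IsBigO.of_bound (|C| + |C'|) (Filter.Eventually.of_forall fun y => ?_)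
    have e1 := h1 y
    have e2 := h2 y
    rw [norm_sub_rev x y] at e1 e2
    have i1 := mul_le_mul_of_nonneg_right (le_abs_self C) (sq_nonneg ‖y - x‖)
    have i2 := mul_le_mul_of_nonneg_right (le_abs_self C') (sq_nonneg ‖y - x‖)
    have i3 : 0 ≤ |C| * ‖y - x‖ ^ 2 := by positivity
    have i4 : 0 ≤ |C'| * ‖y - x‖ ^ 2 := by positivity
    rw [Real.norm_eq_abs, Real.norm_eq_abs, abs_of_nonneg (sq_nonneg ‖y - x‖), abs_le]
    constructor <;> linarith
  · exact Asymptotics.isLittleO_pow_sub_sub x (by norm_num)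

end Vector

/-! ### The vector arctangent: injective, 3-Lipschitz, inverse to the vector tangent. -/

section ArctanVec

variable {d : ℕ}

@[simp] lemma arctanVec_zero : arctanVec (0 : EuclideanSpace ℝ (Fin d)) = 0 := by
  simp [arctanVec]

lemma arctanVec_smul (c : ℝ) (v : EuclideanSpace ℝ (Fin d)) :
    arctanVec (c • v) = (Real.arctan (c * ‖v‖) / ‖v‖) • v := by
  rcases eq_or_ne v 0 with rfl | hv
  · simp
  have hr : 0 < ‖v‖ := norm_pos_iff.2 hv
  rcases lt_trichotomy c 0 with h | rfl | h
  · rw [arctanVec, norm_smul, Real.norm_eq_abs, abs_of_neg h, smul_smul, neg_mul, Real.arctan_neg]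
    congr 1
    have := h.ne
    field_simp
  · simp
  · rw [arctanVec, norm_smul, Real.norm_eq_abs, abs_of_pos h, smul_smul]
    congr 1
    field_simp

lemma norm_arctanVec (v : EuclideanSpace ℝ (Fin d)) : ‖arctanVec v‖ = Real.arctan ‖v‖ := by
  rcases eq_or_ne v 0 with rfl | hv
  · simp
  have hr : 0 < ‖v‖ := norm_pos_iff.2 hv
  rw [arctanVec, norm_smul, norm_div, norm_norm, div_mul_cancel₀ _ hr.ne', Real.norm_eq_abs,
    abs_of_nonneg (Real.arctan_nonneg.2 hr.le)]

lemma arctanVec_neg (v : EuclideanSpace ℝ (Fin d)) : arctanVec (-v) = -arctanVec v := by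
  simp [arctanVec]

lemma cosTrunc_arctan_sq (r : ℝ) : cosTrunc (Real.arctan r) ^ 2 = (1 + r ^ 2)⁻¹ := by
  rw [cosTrunc_of_le (Real.arctan_lt_pi_div_two r).le, Real.cos_sq_arctan, one_div]

/-- The inverse of `arctanVec` on the open ball of radius `π / 2`. -/
lemma arctanVec_tan {z : EuclideanSpace ℝ (Fin d)} (hz : ‖z‖ < Real.pi / 2) :
    arctanVec ((Real.tan ‖z‖ / ‖z‖) • z) = z := by
  rcases eq_or_ne z 0 with rfl | hz0
  · simp
  have hr : 0 < ‖z‖ := norm_pos_iff.2 hz0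
  rw [arctanVec_smul, div_mul_cancel₀ _ hr.ne',
    Real.arctan_tan (by linarith [Real.pi_pos]) hz, div_self hr.ne', one_smul]

lemma arctanVec_injective : Function.Injective (arctanVec (d := d)) := by
  intro v w h
  have hn : ‖v‖ = ‖w‖ := by
    have := congrArg norm h
    rwa [norm_arctanVec, norm_arctanVec, Real.arctan_inj] at this
  rcases eq_or_ne v 0 with rfl | hv
  · rw [norm_zero] at hn
    exact (norm_eq_zero.1 hn.symm).symm
  have hr : 0 < ‖v‖ := norm_pos_iff.2 hv
  have ha : 0 < Real.arctan ‖v‖ := Real.arctan_pos.2 hr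
  rw [arctanVec, arctanVec, ← hn] at h
  exact smul_right_injective _ (div_pos ha hr).ne' h

lemma abs_arctan_sub_arctan_le (r s : ℝ) : |Real.arctan r - Real.arctan s| ≤ |r - s| := by
  have := Convex.norm_image_sub_le_of_norm_deriv_le (f := Real.arctan) (C := 1) (s := univ)
    (x := s) (y := r) (fun x _ => Real.differentiableAt_arctan x) (fun x _ => by
      rw [(Real.hasDerivAt_arctan x).deriv, Real.norm_eq_abs, abs_of_pos (by positivity),
        div_le_one (by positivity)]
      nlinarith [sq_nonneg x]) convex_univ (mem_univ _) (mem_univ _)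
  simpa using this

lemma norm_arctanVec_sub_le (v w : EuclideanSpace ℝ (Fin d)) :
    ‖arctanVec v - arctanVec w‖ ≤ 3 * ‖v - w‖ := by
  rcases eq_or_ne v 0 with rfl | hv
  · rw [arctanVec_zero, zero_sub, zero_sub, norm_neg, norm_neg, norm_arctanVec]
    have := abs_arctan_sub_arctan_le ‖w‖ 0
    simp only [Real.arctan_zero, sub_zero, abs_norm] at this
    linarith [le_abs_self (Real.arctan ‖w‖), norm_nonneg w]
  rcases eq_or_ne w 0 with rfl | hw
  · rw [arctanVec_zero, sub_zero, sub_zero, norm_arctanVec]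
    have := abs_arctan_sub_arctan_le ‖v‖ 0
    simp only [Real.arctan_zero, sub_zero, abs_norm] at this
    linarith [le_abs_self (Real.arctan ‖v‖), norm_nonneg v]
  have hr : 0 < ‖v‖ := norm_pos_iff.2 hv
  have hs : 0 < ‖w‖ := norm_pos_iff.2 hw
  have hd : |‖v‖ - ‖w‖| ≤ ‖v - w‖ := abs_norm_sub_norm_le v w
  have ha : |Real.arctan ‖w‖| ≤ ‖w‖ := by
    have := abs_arctan_sub_arctan_le ‖w‖ 0
    simpa using this
  -- Split into the change of the radial profile, of size at most ‖v-w‖, and the change of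
  -- direction, of size at most 2‖v-w‖. Their sum is the constant 3.
  have e : arctanVec v - arctanVec w = ((Real.arctan ‖v‖ - Real.arctan ‖w‖) / ‖v‖) • v +
      (Real.arctan ‖w‖ / ‖w‖) • ((v - w) - ((‖v‖ - ‖w‖) / ‖v‖) • v) := by
    rw [arctanVec, arctanVec]
    match_scalars
    · field_simp
      ring
    · field_simp
  have b1 : ‖((Real.arctan ‖v‖ - Real.arctan ‖w‖) / ‖v‖) • v‖ ≤ ‖v - w‖ := by
    rw [norm_smul, norm_div, norm_norm, div_mul_cancel₀ _ hr.ne']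
    exact (abs_arctan_sub_arctan_le _ _).trans hd
  have b2 : ‖((‖v‖ - ‖w‖) / ‖v‖) • v‖ ≤ ‖v - w‖ := by
    rw [norm_smul, norm_div, norm_norm, div_mul_cancel₀ _ hr.ne']
    exact hd
  have b3 : ‖Real.arctan ‖w‖ / ‖w‖‖ ≤ 1 := by
    rw [norm_div, norm_norm, div_le_one hs]
    exact ha
  rw [e]
  refine (norm_add_le _ _).trans ?_
  rw [norm_smul (Real.arctan ‖w‖ / ‖w‖)]
  have b4 := norm_sub_le (v - w) (((‖v‖ - ‖w‖) / ‖v‖) • v)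
  nlinarith [norm_nonneg ((v - w) - ((‖v‖ - ‖w‖) / ‖v‖) • v),
    norm_nonneg (Real.arctan ‖w‖ / ‖w‖)]

end ArctanVec

/-! ### The Hopf-Lax cost as a real expression, and existence of minimizers. -/

section HopfLax

variable {d : ℕ}

/-- The real number `1 / (1 + 2 τ ξ(y))`, with value `0` where `ξ(y) = +∞`. -/
noncomputable def invWeight (τ : ℝ) (ξ : EuclideanSpace ℝ (Fin d) → EReal)
    (y : EuclideanSpace ℝ (Fin d)) : ℝ :=
  ((1 + ((2 * τ : ℝ) : EReal) * ξ y).toENNReal)⁻¹.toReal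

variable {τ a : ℝ} {ξ : EuclideanSpace ℝ (Fin d) → EReal} {x y : EuclideanSpace ℝ (Fin d)}

lemma one_add_mul_coe (τ u : ℝ) :
    1 + ((2 * τ : ℝ) : EReal) * (u : EReal) = ((1 + 2 * τ * u : ℝ) : EReal) := by
  push_cast
  rfl

lemma one_add_mul_top (hτ : 0 < τ) : 1 + ((2 * τ : ℝ) : EReal) * ⊤ = ⊤ := by
  rw [EReal.coe_mul_top_of_pos (by positivity)]
  exact EReal.coe_add_top 1

lemma invWeight_of_coe {u : ℝ} (hu : ξ y = (u : EReal)) (h : 0 ≤ 1 + 2 * τ * u) :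
    invWeight τ ξ y = (1 + 2 * τ * u)⁻¹ := by
  rw [invWeight, hu, one_add_mul_coe, EReal.toENNReal_of_ne_top (EReal.coe_ne_top _),
    EReal.toReal_coe, ENNReal.toReal_inv, ENNReal.toReal_ofReal h]

lemma invWeight_of_top (hτ : 0 < τ) (h : ξ y = ⊤) : invWeight τ ξ y = 0 := by
  rw [invWeight, h, one_add_mul_top hτ]
  simp

lemma eq_top_or_eq_coe (h : (a : EReal) ≤ ξ y) : ξ y = ⊤ ∨ ∃ u : ℝ, ξ y = (u : EReal) ∧ a ≤ u := by
  induction hy : ξ y with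
  | bot => rw [hy] at h; exact absurd h (by simp)
  | top => exact Or.inl rfl
  | coe u => exact Or.inr ⟨u, rfl, by rw [hy] at h; exact_mod_cast h⟩

lemma invWeight_nonneg : 0 ≤ invWeight τ ξ y := ENNReal.toReal_nonneg

lemma invWeight_le (hτ : 0 < τ) (hm : 0 < 1 + 2 * τ * a) (h : (a : EReal) ≤ ξ y) :
    invWeight τ ξ y ≤ (1 + 2 * τ * a)⁻¹ := by
  rcases eq_top_or_eq_coe h with h | ⟨u, hu, hau⟩
  · rw [invWeight_of_top hτ h]; positivity
  · have : 1 + 2 * τ * a ≤ 1 + 2 * τ * u := by nlinarith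
    rw [invWeight_of_coe hu (by linarith)]
    exact inv_anti₀ hm this

/-- Weights with positive `invWeight` are finite. -/
lemma exists_coe_of_invWeight_pos (hτ : 0 < τ) (hm : 0 < 1 + 2 * τ * a) (h : (a : EReal) ≤ ξ y)
    (hk : 0 < invWeight τ ξ y) :
    ∃ u : ℝ, ξ y = (u : EReal) ∧ a ≤ u ∧ 0 < 1 + 2 * τ * u ∧
      invWeight τ ξ y = (1 + 2 * τ * u)⁻¹ := by
  rcases eq_top_or_eq_coe h with h | ⟨u, hu, hau⟩
  · rw [invWeight_of_top hτ h] at hk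
    exact absurd hk (lt_irrefl _)
  · have : 1 + 2 * τ * a ≤ 1 + 2 * τ * u := by nlinarith
    exact ⟨u, hu, hau, by linarith, invWeight_of_coe hu (by linarith)⟩

lemma hopfLaxCost_of_coe {u : ℝ} (hu : ξ y = (u : EReal)) (h : 0 < 1 + 2 * τ * u) :
    hopfLaxCost τ ξ x y =
      (((1 - cosTrunc (dist x y) ^ 2 * (1 + 2 * τ * u)⁻¹) / (2 * τ) : ℝ) : EReal) := by
  rw [hopfLaxCost, hu, one_add_mul_coe, EReal.toENNReal_of_ne_top (EReal.coe_ne_top _),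
    EReal.toReal_coe, ← ENNReal.ofReal_div_of_pos h, EReal.coe_ennreal_ofReal,
    max_eq_left (by positivity), ← EReal.coe_one, ← EReal.coe_sub, ← EReal.coe_mul]
  congr 1
  ring

lemma hopfLaxCost_of_top (hτ : 0 < τ) (h : ξ y = ⊤) :
    hopfLaxCost τ ξ x y = ((1 / (2 * τ) : ℝ) : EReal) := by
  rw [hopfLaxCost, h, one_add_mul_top hτ]
  simp

/-- The strictly positive lower bound on the weight is essential: at weight zero `invWeight` takes
the value 0, whereas the cost is -∞ inside the ball. -/
lemma hopfLaxCost_eq (hτ : 0 < τ) (hm : 0 < 1 + 2 * τ * a) (h : (a : EReal) ≤ ξ y) :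
    hopfLaxCost τ ξ x y =
      (((1 - cosTrunc (dist x y) ^ 2 * invWeight τ ξ y) / (2 * τ) : ℝ) : EReal) := by
  rcases eq_top_or_eq_coe h with h | ⟨u, hu, hau⟩
  · rw [hopfLaxCost_of_top hτ h, invWeight_of_top hτ h]
    simp
  · have : 1 + 2 * τ * a ≤ 1 + 2 * τ * u := by nlinarith
    rw [hopfLaxCost_of_coe hu (by linarith), invWeight_of_coe hu (by linarith)]

lemma hopfLax_le_cost (hτ : 0 < τ) (hy : dist x y < Real.pi / 2) :
    hopfLax τ ξ x ≤ hopfLaxCost τ ξ x y := by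
  rw [hopfLax, if_neg hτ.ne']
  exact iInf₂_le y (by rwa [mem_ball, dist_comm])

lemma le_hopfLax {v : EReal} (hτ : 0 < τ)
    (h : ∀ y, dist x y < Real.pi / 2 → v ≤ hopfLaxCost τ ξ x y) : v ≤ hopfLax τ ξ x := by
  rw [hopfLax, if_neg hτ.ne']
  exact le_iInf₂ fun y hy => h y (by rwa [mem_ball, dist_comm] at hy)

lemma hopfLaxCost_le (hτ : 0 < τ) (x y : EuclideanSpace ℝ (Fin d)) :
    hopfLaxCost τ ξ x y ≤ ((1 / (2 * τ) : ℝ) : EReal) := by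
  have h0 : (0 : EReal) ≤ ((1 / (2 * τ) : ℝ) : EReal) := by
    exact_mod_cast (by positivity : (0 : ℝ) ≤ 1 / (2 * τ))
  rw [hopfLaxCost]
  refine (mul_le_mul_of_nonneg_left (b := _) (c := 1) ?_ h0).trans_eq (mul_one _)
  rw [sub_eq_add_neg]
  refine (add_le_add_right (EReal.neg_le_zero.2 (EReal.coe_ennreal_nonneg _)) 1).trans_eq ?_
  simp

lemma hopfLax_le (hτ : 0 < τ) (x : EuclideanSpace ℝ (Fin d)) :
    hopfLax τ ξ x ≤ ((1 / (2 * τ) : ℝ) : EReal) :=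
  (hopfLax_le_cost hτ (y := x) (by rw [dist_self]; positivity)).trans (hopfLaxCost_le hτ x x)

lemma upperSemicontinuous_invWeight (hτ : 0 < τ) (hm : 0 < 1 + 2 * τ * a)
    (h : ∀ y, (a : EReal) ≤ ξ y) (hξ : LowerSemicontinuous ξ) :
    UpperSemicontinuous (invWeight τ ξ) := by
  intro y r hr
  obtain ⟨s, hs1, hs2⟩ := exists_between hr
  have hs0 : 0 < s := invWeight_nonneg.trans_lt hs1
  -- The level (s⁻¹ - 1)/(2τ) is the value of ξ at which the inverse weight equals s.
  have hms : 1 + 2 * τ * ((s⁻¹ - 1) / (2 * τ)) = s⁻¹ := by field_simp; ring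
  have hlt : (((s⁻¹ - 1) / (2 * τ) : ℝ) : EReal) < ξ y := by
    rcases eq_top_or_eq_coe (h y) with ht | ⟨u, hu, hau⟩
    · rw [ht]; exact EReal.coe_lt_top _
    · rw [hu, EReal.coe_lt_coe_iff, div_lt_iff₀ (by positivity)]
      have h1 : 1 + 2 * τ * a ≤ 1 + 2 * τ * u := by nlinarith
      rw [invWeight_of_coe hu (by linarith)] at hs1
      have := inv_lt_of_inv_lt₀ (by linarith) hs1
      linarith
  filter_upwards [hξ y _ hlt] with y' hy'
  have := invWeight_le (τ := τ) hτ (by rw [hms]; positivity) hy'.le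
  rw [hms, inv_inv] at this
  exact this.trans_lt hs2

lemma upperSemicontinuous_mul_of_nonneg {X : Type*} [TopologicalSpace X] {c k : X → ℝ}
    (hc : Continuous c) (hk : UpperSemicontinuous k) (hc0 : ∀ x, 0 ≤ c x) (hk0 : ∀ x, 0 ≤ k x) :
    UpperSemicontinuous fun x => c x * k x := by
  intro x r hr
  have hcont : Filter.Tendsto (fun ε : ℝ => (c x + ε) * (k x + ε)) (nhds 0)
      (nhds (c x * k x)) := by
    have : Continuous fun ε : ℝ => (c x + ε) * (k x + ε) := by fun_prop
    exact this.tendsto' 0 _ (by simp)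
  have hev : ∀ᶠ ε in nhdsWithin (0 : ℝ) (Ioi 0), (c x + ε) * (k x + ε) < r :=
    (hcont.mono_left nhdsWithin_le_nhds).eventually_lt_const hr
  obtain ⟨ε, hε, hε0⟩ := (hev.and self_mem_nhdsWithin).exists
  have hε0 : 0 < ε := hε0
  filter_upwards [hc.continuousAt.eventually_lt_const (lt_add_of_pos_right (c x) hε0),
    hk x _ (lt_add_of_pos_right (k x) hε0)] with z h1 h2
  exact (mul_le_mul h1.le h2.le (hk0 z) (by linarith [hc0 x])).trans_lt hε

/-- The infimum in the Hopf-Lax formula is a minimum when `1 + 2 τ ξ` is bounded away from zero. -/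
lemma exists_hopfLax_eq (hτ : 0 < τ) (hm : 0 < 1 + 2 * τ * a)
    (h : ∀ y, (a : EReal) ≤ ξ y) (hξ : LowerSemicontinuous ξ) (x : EuclideanSpace ℝ (Fin d)) :
    ∃ y, dist x y < Real.pi / 2 ∧
      hopfLax τ ξ x =
        (((1 - cosTrunc (dist x y) ^ 2 * invWeight τ ξ y) / (2 * τ) : ℝ) : EReal) := by
  suffices hs : ∃ y, dist x y < Real.pi / 2 ∧ ∀ y', cosTrunc (dist x y') ^ 2 * invWeight τ ξ y' ≤
      cosTrunc (dist x y) ^ 2 * invWeight τ ξ y by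
    obtain ⟨y, hy, hmax⟩ := hs
    refine ⟨y, hy, le_antisymm ?_ (le_hopfLax hτ fun y' _ => ?_)⟩
    · rw [← hopfLaxCost_eq hτ hm (h y)]
      exact hopfLax_le_cost hτ hy
    · rw [hopfLaxCost_eq hτ hm (h y'), EReal.coe_le_coe_iff]
      have := hmax y'
      gcongr
  have husc : UpperSemicontinuous fun y => cosTrunc (dist x y) ^ 2 * invWeight τ ξ y :=
    upperSemicontinuous_mul_of_nonneg (by fun_prop)
      (upperSemicontinuous_invWeight hτ hm h hξ) (fun _ => sq_nonneg _) fun _ => invWeight_nonneg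
  obtain ⟨y, -, hmax⟩ := (husc.upperSemicontinuousOn _).exists_isMaxOn
    (⟨x, mem_closedBall_self (by positivity)⟩ : (closedBall x (Real.pi / 2)).Nonempty)
    (isCompact_closedBall x (Real.pi / 2))
  have hmax' : ∀ y', cosTrunc (dist x y') ^ 2 * invWeight τ ξ y' ≤
      cosTrunc (dist x y) ^ 2 * invWeight τ ξ y := by
    intro y'
    rcases le_or_gt (dist x y') (Real.pi / 2) with h1 | h1
    · exact hmax (by rwa [mem_closedBall, dist_comm])
    · rw [cosTrunc_of_ge h1.le]
      simpa using mul_nonneg (sq_nonneg (cosTrunc (dist x y))) (invWeight_nonneg (τ := τ))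
  rcases lt_or_ge (dist x y) (Real.pi / 2) with h1 | h1
  · exact ⟨y, h1, hmax'⟩
  -- A maximizer on the boundary sphere has value 0, so every competitor has value at most 0 and the
  -- centre is a maximizer in the open ball.
  · refine ⟨x, by rw [dist_self]; positivity, fun y' => (hmax' y').trans ?_⟩
    rw [cosTrunc_of_ge h1]
    simpa using invWeight_nonneg

/-- A function touching the Hopf-Lax solution from above is semiconcave. -/
lemma cost_le_tangent {k : ℝ} (hτ : 0 < τ) (hk : 0 ≤ k) (hy : dist x y < Real.pi / 2)
    (x' : EuclideanSpace ℝ (Fin d)) :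
    (1 - cosTrunc (dist x' y) ^ 2 * k) / (2 * τ) ≤ (1 - cosTrunc (dist x y) ^ 2 * k) / (2 * τ) +
      inner ℝ ((k / (2 * τ)) • ((Real.sin (2 * ‖x - y‖) / ‖x - y‖) • (x - y))) (x' - x) +
      k / (2 * τ) * ‖x - x'‖ ^ 2 := by
  have h := cosTrunc_norm_sq_tangent_le (x - y) (x' - x) (by rwa [← dist_eq_norm])
  rw [show x - y + (x' - x) = x' - y by abel, ← dist_eq_norm x' y] at h
  rw [real_inner_smul_left, norm_sub_rev x x', dist_eq_norm x y]
  have h2 := mul_le_mul_of_nonneg_left h (by positivity : 0 ≤ k / (2 * τ))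
  have e1 : (1 - cosTrunc (dist x' y) ^ 2 * k) / (2 * τ) =
    1 / (2 * τ) - k / (2 * τ) * cosTrunc (dist x' y) ^ 2 := by ring
  have e2 : (1 - cosTrunc ‖x - y‖ ^ 2 * k) / (2 * τ) =
    1 / (2 * τ) - k / (2 * τ) * cosTrunc ‖x - y‖ ^ 2 := by ring
  rw [e1, e2]
  linarith

end HopfLax

/-- Standing assumptions under which `P_τ ξ` is real valued: `ξ` is lower semicontinuous, bounded
below by `a`, and `1 + 2 τ a > 0`. -/
structure Regular {d : ℕ} (a τ : ℝ) (ξ : EuclideanSpace ℝ (Fin d) → EReal) : Prop where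
  pos : 0 < τ
  weight_pos : 0 < 1 + 2 * τ * a
  le : ∀ y, (a : EReal) ≤ ξ y
  lsc : LowerSemicontinuous ξ

/-! ### Bounds, Lipschitz continuity and semiconcavity of real-valued Hopf-Lax solutions. -/

namespace Regular

variable {d : ℕ} {a τ : ℝ} {ξ : EuclideanSpace ℝ (Fin d) → EReal}

lemma coe_toReal (H : Regular a τ ξ) (x : EuclideanSpace ℝ (Fin d)) :
    ((hopfLax τ ξ x).toReal : EReal) = hopfLax τ ξ x := by
  obtain ⟨y, -, h⟩ := exists_hopfLax_eq H.pos H.weight_pos H.le H.lsc x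
  rw [h, EReal.toReal_coe]

lemma exists_toReal_eq (H : Regular a τ ξ) (x : EuclideanSpace ℝ (Fin d)) :
    ∃ y, dist x y < Real.pi / 2 ∧ (hopfLax τ ξ x).toReal =
      (1 - cosTrunc (dist x y) ^ 2 * invWeight τ ξ y) / (2 * τ) := by
  obtain ⟨y, hy, h⟩ := exists_hopfLax_eq H.pos H.weight_pos H.le H.lsc x
  exact ⟨y, hy, by rw [h, EReal.toReal_coe]⟩

lemma toReal_le_one_div (H : Regular a τ ξ) (x : EuclideanSpace ℝ (Fin d)) :
    (hopfLax τ ξ x).toReal ≤ 1 / (2 * τ) := by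
  have := hopfLax_le H.pos (ξ := ξ) x
  rw [← H.coe_toReal x] at this
  exact_mod_cast this

/-- Beyond distance π/2 the right side is the universal upper bound 1/(2τ), so the restriction to
the ball disappears. This allows y to be frozen while x moves over the whole space. -/
lemma toReal_le (H : Regular a τ ξ) (x y : EuclideanSpace ℝ (Fin d)) :
    (hopfLax τ ξ x).toReal ≤ (1 - cosTrunc (dist x y) ^ 2 * invWeight τ ξ y) / (2 * τ) := by
  rcases lt_or_ge (dist x y) (Real.pi / 2) with hy | hy
  · have := hopfLax_le_cost H.pos (ξ := ξ) hy
    rw [← H.coe_toReal x, hopfLaxCost_eq H.pos H.weight_pos (H.le y)] at this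
    exact_mod_cast this
  · rw [cosTrunc_of_ge hy]
    simpa using H.toReal_le_one_div x

/-- The bound is the evolution of the constant a, obtained with cos² = 1 and the largest possible
inverse weight. -/
lemma le_toReal (H : Regular a τ ξ) (x : EuclideanSpace ℝ (Fin d)) :
    a / (1 + 2 * τ * a) ≤ (hopfLax τ ξ x).toReal := by
  obtain ⟨y, hy, h⟩ := H.exists_toReal_eq x
  have h0 := H.pos
  have h1 := H.weight_pos
  have e : a / (1 + 2 * τ * a) = (1 - 1 * (1 + 2 * τ * a)⁻¹) / (2 * τ) := by
    rw [eq_div_iff (by positivity), div_eq_mul_inv]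
    linear_combination mul_inv_cancel₀ h1.ne'
  rw [h, e]
  have h2 := mul_le_mul (cosTrunc_sq_le_one (dist x y)) (invWeight_le h0 h1 (H.le y))
    invWeight_nonneg zero_le_one
  gcongr

lemma toReal_sub_le (H : Regular a τ ξ) (x x' : EuclideanSpace ℝ (Fin d)) :
    (hopfLax τ ξ x').toReal - (hopfLax τ ξ x).toReal ≤ 1 / (τ * (1 + 2 * τ * a)) * dist x x' := by
  obtain ⟨y, hy, h⟩ := H.exists_toReal_eq x
  have h' := H.toReal_le x' y
  have h0 := H.pos
  have h1 := H.weight_pos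
  have hk := invWeight_le h0 h1 (H.le y)
  have hk0 := invWeight_nonneg (τ := τ) (ξ := ξ) (y := y)
  have hc := (le_abs_self _).trans (abs_cosTrunc_sq_sub_le (dist x y) (dist x' y))
  have hd := abs_dist_sub_le x x' y
  have h2 : (cosTrunc (dist x y) ^ 2 - cosTrunc (dist x' y) ^ 2) * invWeight τ ξ y ≤
      2 * dist x x' * (1 + 2 * τ * a)⁻¹ := by
    refine (mul_le_mul_of_nonneg_right (hc.trans
      (mul_le_mul_of_nonneg_left hd zero_le_two)) hk0).trans ?_
    exact mul_le_mul_of_nonneg_left hk (by positivity)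
  rw [h]
  calc _ ≤ (1 - cosTrunc (dist x' y) ^ 2 * invWeight τ ξ y) / (2 * τ) -
        (1 - cosTrunc (dist x y) ^ 2 * invWeight τ ξ y) / (2 * τ) := sub_le_sub_right h' _
    _ = ((cosTrunc (dist x y) ^ 2 - cosTrunc (dist x' y) ^ 2) * invWeight τ ξ y) / (2 * τ) := by
      ring
    _ ≤ 2 * dist x x' * (1 + 2 * τ * a)⁻¹ / (2 * τ) := by gcongr
    _ = _ := by field_simp

lemma abs_toReal_sub_le (H : Regular a τ ξ) (x x' : EuclideanSpace ℝ (Fin d)) :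
    |(hopfLax τ ξ x).toReal - (hopfLax τ ξ x').toReal| ≤
      1 / (τ * (1 + 2 * τ * a)) * dist x x' := by
  rw [abs_le]
  have h1 := H.toReal_sub_le x x'
  have h2 := H.toReal_sub_le x' x
  rw [dist_comm x' x] at h2
  constructor <;> linarith

lemma continuous_toReal (H : Regular a τ ξ) :
    Continuous fun x => (hopfLax τ ξ x).toReal := by
  have h0 := H.pos
  have h1 := H.weight_pos
  refine (LipschitzWith.of_dist_le_mul (K := ⟨1 / (τ * (1 + 2 * τ * a)), by positivity⟩)
    fun x x' => ?_).continuous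
  rw [Real.dist_eq]
  exact H.abs_toReal_sub_le x x'

/-- Existence of a bounded supergradient up to the quadratic term `Λ_a`. -/
lemma exists_supergradient (H : Regular a τ ξ) (x : EuclideanSpace ℝ (Fin d)) :
    ∃ p : EuclideanSpace ℝ (Fin d), ‖p‖ ≤ Lam a τ ∧ ∀ x',
      (hopfLax τ ξ x').toReal ≤ (hopfLax τ ξ x).toReal + inner ℝ p (x' - x) +
        1 / 2 * Lam a τ * ‖x - x'‖ ^ 2 := by
  obtain ⟨y, hy, h⟩ := H.exists_toReal_eq x
  have h0 := H.pos
  have h1 := H.weight_pos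
  have hk := invWeight_le h0 h1 (H.le y)
  have hk0 := invWeight_nonneg (τ := τ) (ξ := ξ) (y := y)
  have hL : 1 / 2 * Lam a τ = (1 + 2 * τ * a)⁻¹ / (2 * τ) := by
    rw [Lam, show 2 * a * τ = 2 * τ * a by ring]
    field_simp
  have hkL : invWeight τ ξ y / (2 * τ) ≤ 1 / 2 * Lam a τ := by
    rw [hL]
    gcongr
  have hk2 : 0 ≤ invWeight τ ξ y / (2 * τ) := by positivity
  refine ⟨(invWeight τ ξ y / (2 * τ)) • ((Real.sin (2 * ‖x - y‖) / ‖x - y‖) • (x - y)),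
    ?_, fun x' => ?_⟩
  · rw [norm_smul, Real.norm_eq_abs, abs_of_nonneg hk2]
    have := norm_sin_smul_le (x - y)
    nlinarith [norm_nonneg ((Real.sin (2 * ‖x - y‖) / ‖x - y‖) • (x - y))]
  · refine (H.toReal_le x' y).trans ((cost_le_tangent h0 hk0 hy x').trans ?_)
    rw [h]
    gcongr

end Regular

/-- Data of a forward and a backward solution that are ordered at time `1`. -/
structure OrderedPair {d : ℕ} (a b : ℝ) (ξ₀ η₁ : EuclideanSpace ℝ (Fin d) → EReal) : Prop where
  neg_half_le : -1 / 2 ≤ a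
  neg_half_le' : -1 / 2 ≤ b
  lsc : LowerSemicontinuous ξ₀
  le_fwd : ∀ x, (a : EReal) ≤ ξ₀ x
  usc : UpperSemicontinuous η₁
  le_bwd : ∀ x, η₁ x ≤ ((-b : ℝ) : EReal)
  le_hopfLax : ∀ x, η₁ x ≤ hopfLax 1 ξ₀ x

/-! ### Product form of the cost and comparison with earlier times. -/

section Comparison

variable {d : ℕ} {a b : ℝ} {ξ ξ₀ η₁ : EuclideanSpace ℝ (Fin d) → EReal}

lemma hopfLaxCost_of_eq_zero {τ u : ℝ} {x y : EuclideanSpace ℝ (Fin d)} (hτ : 0 < τ)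
    (hu : ξ y = (u : EReal)) (h : 1 + 2 * τ * u = 0) (hy : dist x y < Real.pi / 2) :
    hopfLaxCost τ ξ x y = ⊥ := by
  have hc : ENNReal.ofReal (cosTrunc (dist x y) ^ 2) ≠ 0 := by
    have := cosTrunc_pos dist_nonneg hy
    simpa using this.ne'
  rw [hopfLaxCost, hu, one_add_mul_coe, h, EReal.coe_zero, EReal.toENNReal_zero,
    ENNReal.div_zero hc, EReal.coe_ennreal_top, EReal.sub_top,
    EReal.coe_mul_bot_of_pos (by positivity)]

/-- A real lower bound of the Hopf-Lax cost at a finite point, as an inequality of products. -/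
lemma cosTrunc_sq_le_of_le_cost {τ u v : ℝ} {x y : EuclideanSpace ℝ (Fin d)} (hτ : 0 < τ)
    (hu : ξ y = (u : EReal)) (hu0 : 0 ≤ 1 + 2 * τ * u) (hy : dist x y < Real.pi / 2)
    (hv : (v : EReal) ≤ hopfLaxCost τ ξ x y) :
    0 < 1 + 2 * τ * u ∧ cosTrunc (dist x y) ^ 2 ≤ (1 + 2 * τ * u) * (1 - 2 * τ * v) := by
  rcases hu0.eq_or_lt with h0 | h0
  · rw [hopfLaxCost_of_eq_zero hτ hu h0.symm hy] at hv
    exact absurd hv (by simp)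
  · refine ⟨h0, ?_⟩
    rw [hopfLaxCost_of_coe hu h0, EReal.coe_le_coe_iff, le_div_iff₀ (by positivity)] at hv
    have h1 : cosTrunc (dist x y) ^ 2 * (1 + 2 * τ * u)⁻¹ ≤ 1 - 2 * τ * v := by linarith
    rw [← div_eq_mul_inv, div_le_iff₀ h0] at h1
    linarith

lemma regular_of_lt_one (ha : -1 / 2 ≤ a) (h : ∀ x, (a : EReal) ≤ ξ x)
    (hξ : LowerSemicontinuous ξ) {t : ℝ} (ht : t ∈ Ioo (0 : ℝ) 1) : Regular a t ξ :=
  ⟨ht.1, by nlinarith [ht.1, ht.2], h, hξ⟩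

/-- Comparison of the backward evolution of a lower bound at time `s` with the forward solution at
an earlier time `t`. -/
lemma back_le_toReal_hopfLax (ha : -1 / 2 ≤ a) (h : ∀ x, (a : EReal) ≤ ξ x)
    (hξ : LowerSemicontinuous ξ) {s t v : ℝ} (ht : 0 < t) (hts : t < s) (hs : s ≤ 1)
    {x : EuclideanSpace ℝ (Fin d)} (hv : (v : EReal) ≤ hopfLax s ξ x)
    (z : EuclideanSpace ℝ (Fin d)) :
    0 < 1 - 2 * (s - t) * v ∧
    (cosTrunc (dist x z) ^ 2 * (1 - 2 * (s - t) * v)⁻¹ - 1) / (2 * (s - t)) ≤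
      (hopfLax t ξ z).toReal := by
  have hs0 : 0 < s := ht.trans hts
  obtain ⟨τ, rfl⟩ : ∃ τ, s = t + τ := ⟨s - t, by ring⟩
  have hτ : 0 < τ := by linarith
  rw [add_sub_cancel_left]
  have hv1 : 0 ≤ 1 - 2 * (t + τ) * v := by
    have := hv.trans (hopfLax_le hs0 x)
    rw [EReal.coe_le_coe_iff, le_div_iff₀ (by positivity)] at this
    linarith
  have hv2 : 0 < 1 - 2 * τ * v := by nlinarith
  refine ⟨hv2, ?_⟩
  have R := regular_of_lt_one ha h hξ ⟨ht, hts.trans_le hs⟩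
  obtain ⟨y, hy, e⟩ := R.exists_toReal_eq z
  rw [e]
  rcases eq_top_or_eq_coe (h y) with hy' | ⟨u, hu, hau⟩
  -- At ξ(y) = +∞ the forward cost is 1/(2t). The backward cost stays below it because v ≤ 1/(2s).
  · rw [invWeight_of_top ht hy', mul_zero, sub_zero, div_le_div_iff₀ (by positivity) (by positivity)]
    have h1 : cosTrunc (dist x z) ^ 2 * (1 - 2 * τ * v)⁻¹ ≤ 1 * (1 - 2 * τ * v)⁻¹ :=
      mul_le_mul_of_nonneg_right (cosTrunc_sq_le_one _) (by positivity)
    have h2 : (1 - 2 * τ * v)⁻¹ ≤ (t + τ) / t := by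
      rw [inv_le_comm₀ hv2 (by positivity), inv_div, div_le_iff₀ hs0]
      nlinarith
    rw [le_div_iff₀ ht] at h2
    nlinarith
  · have hu0 : 0 ≤ 1 + 2 * (t + τ) * u := by nlinarith
    rw [invWeight_of_coe hu (by nlinarith)]
    refine three_point dist_nonneg dist_nonneg dist_nonneg ?_ ht hτ hu0 hv1 ?_ (γ := dist x y)
    · rw [add_comm]
      exact dist_triangle x z y
    · rcases lt_or_ge (dist x y) (Real.pi / 2) with h1 | h1
      · exact (cosTrunc_sq_le_of_le_cost hs0 hu hu0 h1 (hv.trans (hopfLax_le_cost hs0 h1))).2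
      · rw [cosTrunc_of_ge h1]
        simpa using mul_nonneg hu0 hv1

end Comparison

namespace OrderedPair

variable {d : ℕ} {a b : ℝ} {ξ₀ η₁ : EuclideanSpace ℝ (Fin d) → EReal}

/-- Time reversal. -/
lemma swap (H : OrderedPair a b ξ₀ η₁) :
    OrderedPair b a (fun y => -η₁ y) (fun y => -ξ₀ y) where
  neg_half_le := H.neg_half_le'
  neg_half_le' := H.neg_half_le
  lsc := continuous_neg.comp_upperSemicontinuous_antitone H.usc fun _ _ h => EReal.neg_le_neg_iff.2 h
  le_fwd x := by
    have := EReal.neg_le_neg_iff.2 (H.le_bwd x)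
    simpa using this
  usc := continuous_neg.comp_lowerSemicontinuous_antitone H.lsc fun _ _ h => EReal.neg_le_neg_iff.2 h
  le_bwd x := by
    have := EReal.neg_le_neg_iff.2 (H.le_fwd x)
    simpa using this
  le_hopfLax x := by
    have ha := H.neg_half_le
    have hb := H.neg_half_le'
    refine HKFlow.le_hopfLax one_pos fun y hy => ?_
    rw [dist_comm] at hy
    -- For finite values, both the hypothesis and the goal say cos²|x-y| ≤ (1+2ξ₀(x))(1-2η₁(y)), a
    -- relation symmetric under the reversal.
    have h1 := (H.le_hopfLax y).trans (hopfLax_le_cost one_pos hy)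
    have h2 : (b : EReal) ≤ -η₁ y := by
      have := EReal.neg_le_neg_iff.2 (H.le_bwd y)
      simpa using this
    rcases eq_top_or_eq_coe (H.le_fwd x) with hx | ⟨u, hu, hau⟩
    · simp [hx]
    rcases eq_top_or_eq_coe (ξ := fun y => -η₁ y) h2 with hy' | ⟨w, hw, hbw⟩
    · rw [hopfLaxCost_of_top one_pos hy', hu, ← EReal.coe_neg, EReal.coe_le_coe_iff]
      linarith
    · have hw' : η₁ y = ((-w : ℝ) : EReal) := by
        rw [EReal.coe_neg, ← hw, neg_neg]
      rw [hw'] at h1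
      obtain ⟨h3, h4⟩ := cosTrunc_sq_le_of_le_cost one_pos hu (by linarith) hy h1
      have hc : 0 < cosTrunc (dist y x) ^ 2 := pow_pos (cosTrunc_pos dist_nonneg hy) 2
      have h5 : 0 < 1 + 2 * 1 * w := by
        have := (pos_iff_pos_of_mul_pos (hc.trans_le h4)).1 h3
        linarith
      rw [hopfLaxCost_of_coe (ξ := fun y => -η₁ y) hw h5, hu, ← EReal.coe_neg,
        EReal.coe_le_coe_iff, le_div_iff₀ (by positivity), dist_comm x y, ← div_eq_mul_inv]
      have h6 : cosTrunc (dist y x) ^ 2 / (1 + 2 * 1 * w) ≤ 1 + 2 * 1 * u := by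
        rw [div_le_iff₀ h5]
        linarith
      linarith

end OrderedPair

/-! ### Dictionary for time reversal. -/

section Swap

variable {d : ℕ} (ξ₀ η₁ : EuclideanSpace ℝ (Fin d) → EReal)

lemma fwd_neg (t : ℝ) (x : EuclideanSpace ℝ (Fin d)) :
    fwd (fun y => -η₁ y) t x = -bwd η₁ (1 - t) x := by
  rw [fwd, bwd, hopfLaxBack, neg_neg, sub_sub_cancel]

lemma bwd_neg (t : ℝ) (x : EuclideanSpace ℝ (Fin d)) :
    bwd (fun y => -ξ₀ y) t x = -fwd ξ₀ (1 - t) x := by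
  simp only [fwd, bwd, hopfLaxBack, neg_neg]

/-- Together with `OrderedPair.swap`, this transfers every estimate on forward solutions to backward
ones. -/
lemma bwd_eq_neg (t : ℝ) (x : EuclideanSpace ℝ (Fin d)) :
    bwd η₁ t x = -fwd (fun y => -η₁ y) (1 - t) x := rfl

lemma contactSet_swap (t : ℝ) :
    contactSet (fun y => -η₁ y) (fun y => -ξ₀ y) t = contactSet ξ₀ η₁ (1 - t) := by
  ext x
  simp only [contactSet, mem_ofPred_eq, fwd_neg, bwd_neg, neg_inj]
  exact eq_comm

lemma toReal_fwd_neg (t : ℝ) (x : EuclideanSpace ℝ (Fin d)) :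
    (fwd (fun y => -η₁ y) t x).toReal = -(bwd η₁ (1 - t) x).toReal := by
  rw [fwd_neg, EReal.toReal_neg_eq]

@[simp] lemma fwd_zero (x : EuclideanSpace ℝ (Fin d)) : fwd ξ₀ 0 x = ξ₀ x := by
  simp [fwd, hopfLax]

@[simp] lemma bwd_one (x : EuclideanSpace ℝ (Fin d)) : bwd η₁ 1 x = η₁ x := by
  simp [bwd, hopfLaxBack, hopfLax]

end Swap

lemma one_sub_mem_Ioo {t : ℝ} (ht : t ∈ Ioo (0 : ℝ) 1) : 1 - t ∈ Ioo (0 : ℝ) 1 :=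
  ⟨by linarith [ht.2], by linarith [ht.1]⟩

/-! ### Finiteness, ordering and continuity at intermediate times. -/

namespace OrderedPair

variable {d : ℕ} {a b : ℝ} {ξ₀ η₁ : EuclideanSpace ℝ (Fin d) → EReal} {t : ℝ}
  {x : EuclideanSpace ℝ (Fin d)}

lemma regular (H : OrderedPair a b ξ₀ η₁) (ht : t ∈ Ioo (0 : ℝ) 1) : Regular a t ξ₀ :=
  regular_of_lt_one H.neg_half_le H.le_fwd H.lsc ht

lemma coe_fwd (H : OrderedPair a b ξ₀ η₁) (ht : t ∈ Ioo (0 : ℝ) 1)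
    (x : EuclideanSpace ℝ (Fin d)) : ((fwd ξ₀ t x).toReal : EReal) = fwd ξ₀ t x :=
  (H.regular ht).coe_toReal x

lemma coe_bwd (H : OrderedPair a b ξ₀ η₁) (ht : t ∈ Ioo (0 : ℝ) 1)
    (x : EuclideanSpace ℝ (Fin d)) : ((bwd η₁ t x).toReal : EReal) = bwd η₁ t x := by
  rw [bwd_eq_neg, EReal.toReal_neg_eq, EReal.coe_neg, H.swap.coe_fwd (one_sub_mem_Ioo ht)]

lemma fwd_le (ξ₀ : EuclideanSpace ℝ (Fin d) → EReal) (ht : 0 < t)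
    (x : EuclideanSpace ℝ (Fin d)) : fwd ξ₀ t x ≤ ((1 / (2 * t) : ℝ) : EReal) :=
  hopfLax_le ht x

lemma le_bwd_of_lt_one (η₁ : EuclideanSpace ℝ (Fin d) → EReal) (ht : t < 1)
    (x : EuclideanSpace ℝ (Fin d)) : ((-1 / (2 * (1 - t)) : ℝ) : EReal) ≤ bwd η₁ t x := by
  rw [bwd_eq_neg, EReal.le_neg, ← EReal.coe_neg]
  refine (fwd_le _ (sub_pos.2 ht) x).trans_eq ?_
  congr 1
  ring

lemma toReal_fwd_le (H : OrderedPair a b ξ₀ η₁) (ht : t ∈ Ioo (0 : ℝ) 1)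
    (x : EuclideanSpace ℝ (Fin d)) : (fwd ξ₀ t x).toReal ≤ 1 / (2 * t) :=
  (H.regular ht).toReal_le_one_div x

lemma neg_one_div_le {t : ℝ} (ht : t ∈ Ioo (0 : ℝ) 1) (ha : -1 / 2 ≤ a) :
    -1 / (2 * (1 - t)) ≤ a / (1 + 2 * t * a) := by
  have h1 : 0 < 1 - t := sub_pos.2 ht.2
  have h2 : 0 < 1 + 2 * t * a := by nlinarith [ht.1, ht.2]
  rw [div_le_div_iff₀ (by positivity) h2]
  nlinarith [ht.1]

lemma le_toReal_fwd (H : OrderedPair a b ξ₀ η₁) (ht : t ∈ Ioo (0 : ℝ) 1)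
    (x : EuclideanSpace ℝ (Fin d)) : -1 / (2 * (1 - t)) ≤ (fwd ξ₀ t x).toReal :=
  (neg_one_div_le ht H.neg_half_le).trans ((H.regular ht).le_toReal x)

/-- Only a minimizer z of the backward problem matters: the bound η₁(z) ≤ P₁ξ₀(z) is pulled back
from time 1 to time t by `back_le_toReal_hopfLax`. -/
lemma toReal_bwd_le_toReal_fwd (H : OrderedPair a b ξ₀ η₁) (ht : t ∈ Ioo (0 : ℝ) 1)
    (x : EuclideanSpace ℝ (Fin d)) : (bwd η₁ t x).toReal ≤ (fwd ξ₀ t x).toReal := by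
  have ht' := one_sub_mem_Ioo ht
  obtain ⟨z, hz, e⟩ := (H.swap.regular ht').exists_toReal_eq x
  rw [bwd_eq_neg, EReal.toReal_neg_eq, fwd, e]
  rcases eq_top_or_eq_coe (ξ := fun y => -η₁ y) (H.swap.le_fwd z) with h | ⟨w, hw, -⟩
  · rw [invWeight_of_top ht'.1 h]
    refine le_trans (le_of_eq ?_) (H.le_toReal_fwd ht x)
    ring
  · have hw' : ((-w : ℝ) : EReal) ≤ hopfLax 1 ξ₀ z := by
      rw [EReal.coe_neg, ← hw, neg_neg]
      exact H.le_hopfLax z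
    obtain ⟨h1, h2⟩ := back_le_toReal_hopfLax H.neg_half_le H.le_fwd H.lsc ht.1 ht.2 le_rfl hw' x
    rw [mul_neg, sub_neg_eq_add] at h1 h2
    rw [invWeight_of_coe (ξ := fun y => -η₁ y) hw h1.le, dist_comm]
    refine le_trans (le_of_eq ?_) h2
    ring

lemma bwd_le_fwd (H : OrderedPair a b ξ₀ η₁) (ht : t ∈ Icc (0 : ℝ) 1)
    (x : EuclideanSpace ℝ (Fin d)) : bwd η₁ t x ≤ fwd ξ₀ t x := by
  rcases ht.1.eq_or_lt with rfl | h0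
  · have := H.swap.le_hopfLax x
    rw [fwd_zero, bwd_eq_neg, sub_zero, EReal.neg_le]
    exact this
  rcases ht.2.eq_or_lt with rfl | h1
  · rw [bwd_one]
    exact H.le_hopfLax x
  · rw [← H.coe_fwd ⟨h0, h1⟩, ← H.coe_bwd ⟨h0, h1⟩, EReal.coe_le_coe_iff]
    exact H.toReal_bwd_le_toReal_fwd ⟨h0, h1⟩ x

lemma mem_contactSet_iff (H : OrderedPair a b ξ₀ η₁) (ht : t ∈ Ioo (0 : ℝ) 1) :
    x ∈ contactSet ξ₀ η₁ t ↔ (bwd η₁ t x).toReal = (fwd ξ₀ t x).toReal := by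
  rw [contactSet, mem_ofPred_eq, ← H.coe_fwd ht, ← H.coe_bwd ht, EReal.coe_eq_coe_iff,
    EReal.toReal_coe, EReal.toReal_coe]

lemma continuous_toReal_fwd (H : OrderedPair a b ξ₀ η₁) (ht : t ∈ Ioo (0 : ℝ) 1) :
    Continuous fun x => (fwd ξ₀ t x).toReal := (H.regular ht).continuous_toReal

lemma continuous_toReal_bwd (H : OrderedPair a b ξ₀ η₁) (ht : t ∈ Ioo (0 : ℝ) 1) :
    Continuous fun x => (bwd η₁ t x).toReal := by
  simp only [bwd_eq_neg, EReal.toReal_neg_eq]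
  exact (H.swap.continuous_toReal_fwd (one_sub_mem_Ioo ht)).neg

lemma isClosed_contactSet (H : OrderedPair a b ξ₀ η₁) (ht : t ∈ Ioo (0 : ℝ) 1) :
    IsClosed (contactSet ξ₀ η₁ t) := by
  have : contactSet ξ₀ η₁ t = {x | (bwd η₁ t x).toReal = (fwd ξ₀ t x).toReal} :=
    ext fun x => H.mem_contactSet_iff ht
  rw [this]
  exact isClosed_eq (H.continuous_toReal_bwd ht) (H.continuous_toReal_fwd ht)

/-! ### Common slope of both solutions on the contact set -/

lemma exists_slope (H : OrderedPair a b ξ₀ η₁) (ht : t ∈ Ioo (0 : ℝ) 1)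
    (hx : x ∈ contactSet ξ₀ η₁ t) :
    ∃ p : EuclideanSpace ℝ (Fin d), ‖p‖ ≤ Lam a t ∧ ∀ y,
      (fwd ξ₀ t y).toReal ≤ (fwd ξ₀ t x).toReal + inner ℝ p (y - x) +
        1 / 2 * Lam a t * ‖x - y‖ ^ 2 ∧
      (fwd ξ₀ t x).toReal + inner ℝ p (y - x) - 1 / 2 * Lam b (1 - t) * ‖x - y‖ ^ 2 ≤
        (bwd η₁ t y).toReal := by
  obtain ⟨p, hp, h1⟩ := (H.regular ht).exists_supergradient x
  obtain ⟨p', -, h2⟩ := (H.swap.regular (one_sub_mem_Ioo ht)).exists_supergradient x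
  have hx' := (H.mem_contactSet_iff ht).1 hx
  have h2' : ∀ y, (fwd ξ₀ t x).toReal + inner ℝ (-p') (y - x) -
      1 / 2 * Lam b (1 - t) * ‖x - y‖ ^ 2 ≤ (bwd η₁ t y).toReal := by
    intro y
    have := h2 y
    have e : ∀ z, (hopfLax (1 - t) (fun y => -η₁ y) z).toReal = -(bwd η₁ t z).toReal := fun z => by
      rw [bwd_eq_neg, EReal.toReal_neg_eq, neg_neg, fwd]
    rw [e, e, hx'] at this
    rw [inner_neg_left]
    linarith
  -- A paraboloid below the backward solution and one above the forward solution meet at x. Since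
  -- the solutions are ordered, the two slopes agree.
  have hpp : -p' = p := by
    refine eq_of_inner_le_inner_add_sq (C := 1 / 2 * Lam a t + 1 / 2 * Lam b (1 - t)) fun w => ?_
    have e1 := h1 (x + w)
    have e2 := h2' (x + w)
    have e3 := H.toReal_bwd_le_toReal_fwd ht (x + w)
    rw [show x - (x + w) = -w by abel, norm_neg, add_sub_cancel_left] at e1 e2
    rw [fwd] at e3 e2
    linarith
  rw [hpp] at h2'
  exact ⟨p, hp, fun y => ⟨h1 y, h2' y⟩⟩

end OrderedPair

/-- The gradient of the forward solution. -/
noncomputable def fwdGradient {d : ℕ} (ξ₀ : EuclideanSpace ℝ (Fin d) → EReal) (t : ℝ)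
    (x : EuclideanSpace ℝ (Fin d)) : EuclideanSpace ℝ (Fin d) :=
  gradient (fun y => (fwd ξ₀ t y).toReal) x

/-! ### Characterization, reversal and Lipschitz bound of the gradient on contact sets. -/

namespace OrderedPair

variable {d : ℕ} {a b : ℝ} {ξ₀ η₁ : EuclideanSpace ℝ (Fin d) → EReal} {t : ℝ}
  {x y : EuclideanSpace ℝ (Fin d)}

lemma fwdGradient_spec (H : OrderedPair a b ξ₀ η₁) (ht : t ∈ Ioo (0 : ℝ) 1)
    (hx : x ∈ contactSet ξ₀ η₁ t) :
    HasGradientAt (fun y => (fwd ξ₀ t y).toReal) (fwdGradient ξ₀ t x) x ∧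
    HasGradientAt (fun y => (bwd η₁ t y).toReal) (fwdGradient ξ₀ t x) x ∧
    ‖fwdGradient ξ₀ t x‖ ≤ Lam a t ∧ ∀ y,
      (fwd ξ₀ t y).toReal ≤ (fwd ξ₀ t x).toReal + inner ℝ (fwdGradient ξ₀ t x) (y - x) +
        1 / 2 * Lam a t * ‖x - y‖ ^ 2 ∧
      (fwd ξ₀ t x).toReal + inner ℝ (fwdGradient ξ₀ t x) (y - x) -
        1 / 2 * Lam b (1 - t) * ‖x - y‖ ^ 2 ≤ (bwd η₁ t y).toReal := by
  obtain ⟨p, hp, h⟩ := H.exists_slope ht hx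
  have hx' := (H.mem_contactSet_iff ht).1 hx
  have hle := H.toReal_bwd_le_toReal_fwd ht
  have h1 : HasGradientAt (fun y => (fwd ξ₀ t y).toReal) p x :=
    hasGradientAt_of_quadratic_bounds (fun y => (h y).1) (fun y => (h y).2.trans (hle y))
  have h2 : HasGradientAt (fun y => (bwd η₁ t y).toReal) p x := by
    refine hasGradientAt_of_quadratic_bounds (fun y => (hle y).trans ?_) (fun y => ?_)
      (C := 1 / 2 * Lam a t) (C' := 1 / 2 * Lam b (1 - t))
    · rw [hx']; exact (h y).1
    · rw [hx']; exact (h y).2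
  have e : fwdGradient ξ₀ t x = p := h1.gradient
  rw [e]
  exact ⟨h1, h2, hp, h⟩

lemma eq_fwdGradient_iff (H : OrderedPair a b ξ₀ η₁) (ht : t ∈ Ioo (0 : ℝ) 1)
    (hx : x ∈ contactSet ξ₀ η₁ t) (p : EuclideanSpace ℝ (Fin d)) :
    p = fwdGradient ξ₀ t x ↔ ∀ y,
      (fwd ξ₀ t y).toReal - (fwd ξ₀ t x).toReal - 1 / 2 * Lam a t * ‖x - y‖ ^ 2 ≤
        inner ℝ p (y - x) ∧
      inner ℝ p (y - x) ≤ (bwd η₁ t y).toReal - (fwd ξ₀ t x).toReal +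
        1 / 2 * Lam b (1 - t) * ‖x - y‖ ^ 2 := by
  obtain ⟨-, -, -, h⟩ := H.fwdGradient_spec ht hx
  constructor
  · rintro rfl y
    exact ⟨by linarith [(h y).1], by linarith [(h y).2]⟩
  · intro hp
    refine eq_of_inner_le_inner_add_sq (C := 1 / 2 * Lam a t + 1 / 2 * Lam b (1 - t)) fun w => ?_
    have e1 := (hp (x + w)).2
    have e2 := (h (x + w)).1
    have e3 := H.toReal_bwd_le_toReal_fwd ht (x + w)
    rw [show x - (x + w) = -w by abel, norm_neg, add_sub_cancel_left] at e1 e2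
    linarith

/-- A quadratic upper bound of the forward solution determines its gradient on contact points. -/
lemma eq_fwdGradient_of_le (H : OrderedPair a b ξ₀ η₁) (ht : t ∈ Ioo (0 : ℝ) 1)
    (hx : x ∈ contactSet ξ₀ η₁ t) {p : EuclideanSpace ℝ (Fin d)} {C : ℝ}
    (hp : ∀ y, (fwd ξ₀ t y).toReal ≤ (fwd ξ₀ t x).toReal + inner ℝ p (y - x) + C * ‖x - y‖ ^ 2) :
    fwdGradient ξ₀ t x = p := by
  obtain ⟨-, -, -, h⟩ := H.fwdGradient_spec ht hx
  refine eq_of_inner_le_inner_add_sq (C := C + 1 / 2 * Lam b (1 - t)) fun w => ?_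
  have e1 := hp (x + w)
  have e2 := (h (x + w)).2
  have e3 := H.toReal_bwd_le_toReal_fwd ht (x + w)
  rw [show x - (x + w) = -w by abel, norm_neg, add_sub_cancel_left] at e1 e2
  linarith

lemma fwdGradient_swap (H : OrderedPair a b ξ₀ η₁) (ht : t ∈ Ioo (0 : ℝ) 1)
    (hx : x ∈ contactSet ξ₀ η₁ t) :
    fwdGradient (fun y => -η₁ y) (1 - t) x = -fwdGradient ξ₀ t x := by
  obtain ⟨-, -, -, h⟩ := H.fwdGradient_spec ht hx
  refine H.swap.eq_fwdGradient_of_le (one_sub_mem_Ioo ht)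
    (by rwa [contactSet_swap, sub_sub_cancel]) (C := 1 / 2 * Lam b (1 - t)) fun y => ?_
  have hx' := (H.mem_contactSet_iff ht).1 hx
  have := (h y).2
  rw [toReal_fwd_neg, toReal_fwd_neg, sub_sub_cancel, hx', inner_neg_left]
  linarith

lemma Lam_nonneg (ht : t ∈ Ioo (0 : ℝ) 1) (ha : -1 / 2 ≤ a) : 0 ≤ Lam a t := by
  have : 0 ≤ 1 + 2 * a * t := by nlinarith [ht.1, ht.2]
  have := ht.1
  rw [Lam]
  positivity

lemma Lam_le (ht : t ∈ Ioo (0 : ℝ) 1) (ha : -1 / 2 ≤ a) : Lam a t ≤ 1 / (t * (1 - t)) := by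
  have h1 := ht.1
  have h2 : 0 < 1 - t := sub_pos.2 ht.2
  rw [Lam]
  gcongr
  nlinarith

lemma Lam_add_Lam_le (H : OrderedPair a b ξ₀ η₁) (ht : t ∈ Ioo (0 : ℝ) 1) :
    2 * (Lam a t + Lam b (1 - t)) ≤ 4 / (t * (1 - t)) := by
  have h1 := Lam_le ht H.neg_half_le
  have h2 := Lam_le (one_sub_mem_Ioo ht) H.neg_half_le'
  rw [sub_sub_cancel, mul_comm (1 - t) t] at h2
  have e : 4 / (t * (1 - t)) = 2 * (1 / (t * (1 - t)) + 1 / (t * (1 - t))) := by ring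
  rw [e]
  gcongr

lemma norm_fwdGradient_sub_le (H : OrderedPair a b ξ₀ η₁) (ht : t ∈ Ioo (0 : ℝ) 1)
    (hx : x ∈ contactSet ξ₀ η₁ t) (hy : y ∈ contactSet ξ₀ η₁ t) :
    ‖fwdGradient ξ₀ t x - fwdGradient ξ₀ t y‖ ≤ 2 * (Lam a t + Lam b (1 - t)) * ‖x - y‖ := by
  obtain ⟨-, -, -, h⟩ := H.fwdGradient_spec ht hx
  obtain ⟨-, -, -, h'⟩ := H.fwdGradient_spec ht hy
  set g := fwdGradient ξ₀ t x
  set g' := fwdGradient ξ₀ t y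
  have hA := Lam_nonneg ht H.neg_half_le
  have hB := Lam_nonneg (one_sub_mem_Ioo ht) H.neg_half_le'
  set A := Lam a t
  set B := Lam b (1 - t)
  have key : ∀ w : EuclideanSpace ℝ (Fin d),
      inner ℝ (g - g') w ≤ 1 / 2 * B * (‖w‖ ^ 2 + ‖x - y‖ ^ 2) +
        1 / 2 * A * (‖x - y‖ + ‖w‖) ^ 2 := by
    intro w
    have e1 := (h (x + w)).2
    have e2 := (h' (x + w)).1
    have e3 := H.toReal_bwd_le_toReal_fwd ht (x + w)
    have e4 := (h' x).2
    have e5 := H.toReal_bwd_le_toReal_fwd ht x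
    rw [show x - (x + w) = -w by abel, norm_neg, add_sub_cancel_left] at e1
    rw [show x + w - y = (x - y) + w by abel, inner_add_right,
      show y - (x + w) = -((x - y) + w) by abel, norm_neg] at e2
    rw [norm_sub_rev y x] at e4
    have e6 : ‖(x - y) + w‖ ^ 2 ≤ (‖x - y‖ + ‖w‖) ^ 2 :=
      pow_le_pow_left₀ (norm_nonneg _) (norm_add_le _ _) 2
    rw [inner_sub_left]
    nlinarith [mul_le_mul_of_nonneg_left e6 hA]
  rcases eq_or_ne g g' with e | hne
  · rw [e, sub_self, norm_zero]
    positivity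
  have hn : 0 < ‖g - g'‖ := norm_pos_iff.2 (sub_ne_zero.2 hne)
  -- The test vector points along g - g' and has length ‖x-y‖. The estimate then gives the factor B
  -- + 2A, which is at most 2(A+B).
  have h1 := key ((‖x - y‖ / ‖g - g'‖) • (g - g'))
  rw [real_inner_smul_right, real_inner_self_eq_norm_sq, norm_smul, norm_div, norm_norm, norm_norm,
    div_mul_cancel₀ _ hn.ne'] at h1
  have e : ‖x - y‖ / ‖g - g'‖ * ‖g - g'‖ ^ 2 = ‖x - y‖ * ‖g - g'‖ := by
    field_simp
  rw [e] at h1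
  rcases eq_or_ne x y with rfl | hxy
  · exact absurd rfl hne
  have hd : 0 < ‖x - y‖ := norm_pos_iff.2 (sub_ne_zero.2 hxy)
  have h2 : ‖x - y‖ * ‖g - g'‖ ≤ ‖x - y‖ * (2 * (A + B) * ‖x - y‖) := by
    nlinarith [mul_nonneg hB (sq_nonneg ‖x - y‖)]
  exact le_of_mul_le_mul_left h2 hd

end OrderedPair

/-- Serves to compute the distance between two points displaced from x by different amounts along
the same direction. -/
lemma cos_arctan_sub_sq (r s : ℝ) : Real.cos (Real.arctan r - Real.arctan s) ^ 2 =
    (1 + r * s) ^ 2 * ((1 + r ^ 2)⁻¹ * (1 + s ^ 2)⁻¹) := by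
  have h1 : 0 < 1 + r ^ 2 := by positivity
  have h2 : 0 < 1 + s ^ 2 := by positivity
  rw [Real.cos_sub, Real.cos_arctan, Real.cos_arctan, Real.sin_arctan, Real.sin_arctan]
  have e : 1 / √(1 + r ^ 2) * (1 / √(1 + s ^ 2)) + r / √(1 + r ^ 2) * (s / √(1 + s ^ 2)) =
      (1 + r * s) * (1 / √(1 + r ^ 2) * (1 / √(1 + s ^ 2))) := by ring
  rw [e, mul_pow, mul_pow, div_pow, div_pow, Real.sq_sqrt h1.le, Real.sq_sqrt h2.le]
  simp

namespace OrderedPair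

variable {d : ℕ} {a b : ℝ} {ξ₀ η₁ : EuclideanSpace ℝ (Fin d) → EReal} {s t : ℝ}
  {x y : EuclideanSpace ℝ (Fin d)}

/-! ### Stationary points -/

lemma fwd_of_neg_half (H : OrderedPair a b ξ₀ η₁) (ht : t ∈ Ico (0 : ℝ) 1)
    (hx : ξ₀ x = ((-1 / 2 : ℝ) : EReal)) :
    fwd ξ₀ t x = ((-1 / (2 * (1 - t)) : ℝ) : EReal) := by
  rcases ht.1.eq_or_lt with rfl | h0
  · rw [fwd_zero, hx]
    norm_num
  have ht' : t ∈ Ioo (0 : ℝ) 1 := ⟨h0, ht.2⟩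
  rw [← H.coe_fwd ht']
  congr 1
  refine le_antisymm ?_ (H.le_toReal_fwd ht' x)
  have h1 : 0 < 1 - t := sub_pos.2 ht.2
  have e1 : 1 + 2 * t * (-1 / 2) = 1 - t := by ring
  refine ((H.regular ht').toReal_le x x).trans (le_of_eq ?_)
  rw [invWeight_of_coe hx (by rw [e1]; exact h1.le), e1, dist_self, cosTrunc_zero]
  field_simp
  ring

lemma fwd_one_of_neg_half (hx : ξ₀ x = ((-1 / 2 : ℝ) : EReal)) :
    fwd ξ₀ 1 x = ⊥ := by
  refine le_bot_iff.1 ?_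
  have hd : dist x x < Real.pi / 2 := by rw [dist_self]; positivity
  rw [← hopfLaxCost_of_eq_zero one_pos hx (by norm_num) hd]
  exact hopfLax_le_cost one_pos hd

lemma mem_contactSet_of_neg_half (H : OrderedPair a b ξ₀ η₁) (ht : t ∈ Icc (0 : ℝ) 1)
    (hx : ξ₀ x = ((-1 / 2 : ℝ) : EReal)) : x ∈ contactSet ξ₀ η₁ t := by
  refine le_antisymm (H.bwd_le_fwd ht x) ?_
  rcases ht.2.eq_or_lt with rfl | h1
  · rw [fwd_one_of_neg_half hx]
    exact bot_le
  · rw [H.fwd_of_neg_half ⟨ht.1, h1⟩ hx]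
    exact le_bwd_of_lt_one η₁ h1 x

/-- For t > 0, equality in the lower bound gives an optimal y with cos²·(1-t) = 1+2tξ₀(y) ≥ 1-t.
Hence cos² = 1, so y = x, and ξ₀(y) = -1/2. -/
lemma neg_half_of_fwd_eq (H : OrderedPair a b ξ₀ η₁) (ht : t ∈ Ico (0 : ℝ) 1)
    (hx : fwd ξ₀ t x = ((-1 / (2 * (1 - t)) : ℝ) : EReal)) : ξ₀ x = ((-1 / 2 : ℝ) : EReal) := by
  rcases ht.1.eq_or_lt with rfl | h0
  · rw [fwd_zero] at hx
    rw [hx]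
    norm_num
  have ht' : t ∈ Ioo (0 : ℝ) 1 := ⟨h0, ht.2⟩
  have h1 : 0 < 1 - t := sub_pos.2 ht.2
  have R := H.regular ht'
  obtain ⟨y, hy, e⟩ := R.exists_toReal_eq x
  have e' : (hopfLax t ξ₀ x).toReal = -1 / (2 * (1 - t)) := by
    have : hopfLax t ξ₀ x = ((-1 / (2 * (1 - t)) : ℝ) : EReal) := hx
    rw [this, EReal.toReal_coe]
  have hk : cosTrunc (dist x y) ^ 2 * invWeight t ξ₀ y = (1 - t)⁻¹ := by
    rw [e', eq_div_iff (by positivity)] at e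
    have : cosTrunc (dist x y) ^ 2 * invWeight t ξ₀ y = 1 + 1 / (2 * (1 - t)) * (2 * t) := by
      linear_combination e
    rw [this]
    field_simp
    ring
  have hkpos : 0 < invWeight t ξ₀ y :=
    pos_of_mul_pos_right (by rw [hk]; positivity) (sq_nonneg _)
  obtain ⟨u, hu, hau, hu0, ek⟩ := exists_coe_of_invWeight_pos h0 R.weight_pos (R.le y) hkpos
  have hu1 : -1 / 2 ≤ u := H.neg_half_le.trans hau
  rw [ek, ← div_eq_mul_inv, div_eq_iff hu0.ne', inv_mul_eq_div, eq_div_iff h1.ne'] at hk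
  have hc : 1 ≤ cosTrunc (dist x y) ^ 2 := by
    by_contra! hlt
    nlinarith
  have hd := cosTrunc_eq_one dist_nonneg hc
  rw [hd, cosTrunc_zero] at hk
  have hu2 : u = -1 / 2 := by nlinarith
  rw [dist_eq_zero.1 hd, hu, hu2]

lemma neg_half_swap_iff : (fun y => -η₁ y) x = ((-1 / 2 : ℝ) : EReal) ↔
    η₁ x = ((1 / 2 : ℝ) : EReal) := by
  rw [show (-1 / 2 : ℝ) = -(1 / 2) by norm_num, EReal.coe_neg]
  exact neg_inj

lemma half_swap_iff : (fun y => -ξ₀ y) x = ((1 / 2 : ℝ) : EReal) ↔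
    ξ₀ x = ((-1 / 2 : ℝ) : EReal) := by
  rw [show (-1 / 2 : ℝ) = -(1 / 2) by norm_num, EReal.coe_neg]
  exact neg_eq_iff_eq_neg

lemma bwd_of_half (H : OrderedPair a b ξ₀ η₁) (ht : t ∈ Ioc (0 : ℝ) 1)
    (hx : η₁ x = ((1 / 2 : ℝ) : EReal)) : bwd η₁ t x = ((1 / (2 * t) : ℝ) : EReal) := by
  rw [bwd_eq_neg, H.swap.fwd_of_neg_half ⟨by linarith [ht.2], by linarith [ht.1]⟩
    (neg_half_swap_iff.2 hx), ← EReal.coe_neg]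
  congr 1
  ring

lemma mem_contactSet_of_half (H : OrderedPair a b ξ₀ η₁) (ht : t ∈ Icc (0 : ℝ) 1)
    (hx : η₁ x = ((1 / 2 : ℝ) : EReal)) : x ∈ contactSet ξ₀ η₁ t := by
  have := H.swap.mem_contactSet_of_neg_half (t := 1 - t) ⟨by linarith [ht.2], by linarith [ht.1]⟩
    (neg_half_swap_iff.2 hx)
  rwa [contactSet_swap, sub_sub_cancel] at this

lemma half_of_bwd_eq (H : OrderedPair a b ξ₀ η₁) (ht : t ∈ Ioc (0 : ℝ) 1)
    (hx : bwd η₁ t x = ((1 / (2 * t) : ℝ) : EReal)) : η₁ x = ((1 / 2 : ℝ) : EReal) := by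
  refine neg_half_swap_iff.1 (H.swap.neg_half_of_fwd_eq (t := 1 - t)
    ⟨by linarith [ht.2], by linarith [ht.1]⟩ ?_)
  rw [fwd_neg, sub_sub_cancel, hx, ← EReal.coe_neg]
  congr 1
  ring

lemma setOf_neg_half_eq (H : OrderedPair a b ξ₀ η₁) (ht : t ∈ Ico (0 : ℝ) 1) :
    {x | ξ₀ x = ((-1 / 2 : ℝ) : EReal)} =
      {x ∈ contactSet ξ₀ η₁ t | fwd ξ₀ t x = ((-1 / (2 * (1 - t)) : ℝ) : EReal)} :=
  ext fun _ => ⟨fun hx => ⟨H.mem_contactSet_of_neg_half ⟨ht.1, ht.2.le⟩ hx,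
    H.fwd_of_neg_half ht hx⟩, fun hx => H.neg_half_of_fwd_eq ht hx.2⟩

lemma setOf_half_eq (H : OrderedPair a b ξ₀ η₁) (ht : t ∈ Ioc (0 : ℝ) 1) :
    {x | η₁ x = ((1 / 2 : ℝ) : EReal)} =
      {x ∈ contactSet ξ₀ η₁ t | bwd η₁ t x = ((1 / (2 * t) : ℝ) : EReal)} :=
  ext fun _ => ⟨fun hx => ⟨H.mem_contactSet_of_half ⟨ht.1.le, ht.2⟩ hx,
    H.bwd_of_half ht hx⟩, fun hx => H.half_of_bwd_eq ht hx.2⟩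

/-- On Ξ⁺ the forward solution attains its universal upper bound 1/(2t), so the point is a global
maximum. -/
lemma fwdGradient_of_half (H : OrderedPair a b ξ₀ η₁) (ht : t ∈ Ioo (0 : ℝ) 1)
    (hx : η₁ x = ((1 / 2 : ℝ) : EReal)) : fwdGradient ξ₀ t x = 0 := by
  have hc := H.mem_contactSet_of_half ⟨ht.1.le, ht.2.le⟩ hx
  refine H.eq_fwdGradient_of_le ht hc (C := 0) fun y => ?_
  have e := (H.mem_contactSet_iff ht).1 hc
  rw [H.bwd_of_half ⟨ht.1, ht.2.le⟩ hx, EReal.toReal_coe] at e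
  rw [← e, inner_zero_left]
  simpa using H.toReal_fwd_le ht y

lemma fwdGradient_of_stationary (H : OrderedPair a b ξ₀ η₁) (ht : t ∈ Ioo (0 : ℝ) 1)
    (hx : ξ₀ x = ((-1 / 2 : ℝ) : EReal) ∨ η₁ x = ((1 / 2 : ℝ) : EReal)) :
    fwdGradient ξ₀ t x = 0 := by
  rcases hx with hx | hx
  · have h1 := H.swap.fwdGradient_of_half (one_sub_mem_Ioo ht) (half_swap_iff.2 hx)
    rw [H.fwdGradient_swap ht (H.mem_contactSet_of_neg_half ⟨ht.1.le, ht.2.le⟩ hx)] at h1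
    exact neg_eq_zero.1 h1
  · exact H.fwdGradient_of_half ht hx

/-! ### Optimal points at earlier times -/

/-- The bound is the evolution a/(1+2ta) of the constant a. Its weight over the remaining time is
(1+2sa)/(1+2ta), still positive. -/
lemma exists_lower_bound_fwd (H : OrderedPair a b ξ₀ η₁) (hs : s ∈ Ioo (0 : ℝ) 1) (ht : 0 ≤ t)
    (hts : t < s) :
    ∃ a' : ℝ, 0 < 1 + 2 * (s - t) * a' ∧ ∀ y, (a' : EReal) ≤ fwd ξ₀ t y := by
  have hw := (H.regular hs).weight_pos
  rcases ht.eq_or_lt with rfl | h0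
  · exact ⟨a, by rwa [sub_zero], fun y => by rw [fwd_zero]; exact H.le_fwd y⟩
  · have ht' : t ∈ Ioo (0 : ℝ) 1 := ⟨h0, hts.trans hs.2⟩
    have R := H.regular ht'
    have hw' := R.weight_pos
    refine ⟨a / (1 + 2 * t * a), ?_, fun y => ?_⟩
    · have : 1 + 2 * (s - t) * (a / (1 + 2 * t * a)) = (1 + 2 * s * a) / (1 + 2 * t * a) := by
        rw [eq_div_iff hw'.ne']
        linear_combination 2 * (s - t) * div_mul_cancel₀ a hw'.ne'
      rw [this]
      positivity
    · rw [← H.coe_fwd ht', EReal.coe_le_coe_iff]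
      exact R.le_toReal y

lemma fwd_eq_coe_pos (H : OrderedPair a b ξ₀ η₁) (hs : s ∈ Ioo (0 : ℝ) 1) (ht : 0 < t)
    (hts : t < s) (y : EuclideanSpace ℝ (Fin d)) :
    0 < 1 + 2 * (s - t) * (fwd ξ₀ t y).toReal := by
  obtain ⟨a', h1, h2⟩ := H.exists_lower_bound_fwd hs ht.le hts
  have h3 := h2 y
  rw [← H.coe_fwd ⟨ht, hts.trans hs.2⟩, EReal.coe_le_coe_iff] at h3
  nlinarith

/-- One half of the semigroup law. For t > 0, comparison with v = ξ_s(x) gives a product inequality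
between x and y, which is then solved for ξ_s(x) instead of ξ_t(y). -/
lemma toReal_fwd_le_cost (H : OrderedPair a b ξ₀ η₁) (hs : s ∈ Ioo (0 : ℝ) 1) (ht : 0 ≤ t)
    (hts : t < s) (x y : EuclideanSpace ℝ (Fin d)) :
    (fwd ξ₀ s x).toReal ≤
      (1 - cosTrunc (dist x y) ^ 2 * invWeight (s - t) (fwd ξ₀ t) y) / (2 * (s - t)) := by
  rcases ht.eq_or_lt with rfl | h0
  · have e : fwd ξ₀ 0 = ξ₀ := funext fun y => fwd_zero ξ₀ y
    rw [e, sub_zero]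
    exact (H.regular hs).toReal_le x y
  have hτ : 0 < s - t := sub_pos.2 hts
  obtain ⟨h1, h2⟩ := back_le_toReal_hopfLax H.neg_half_le H.le_fwd H.lsc h0 hts hs.2.le
    (x := x) (v := (fwd ξ₀ s x).toReal) (H.coe_fwd hs x).le y
  have h3 := H.fwd_eq_coe_pos hs h0 hts y
  rw [invWeight_of_coe (H.coe_fwd ⟨h0, hts.trans hs.2⟩ y).symm h3.le]
  rw [div_le_iff₀ (by positivity), ← div_eq_mul_inv] at h2
  have h4 : cosTrunc (dist x y) ^ 2 / (1 - 2 * (s - t) * (fwd ξ₀ s x).toReal) ≤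
      1 + 2 * (s - t) * (fwd ξ₀ t y).toReal := by
    change _ ≤ (fwd ξ₀ t y).toReal * _ at h2
    linarith
  rw [div_le_iff₀ h1] at h4
  rw [le_div_iff₀ (by positivity), ← div_eq_mul_inv]
  have h5 : cosTrunc (dist x y) ^ 2 / (1 + 2 * (s - t) * (fwd ξ₀ t y).toReal) ≤
      1 - 2 * (s - t) * (fwd ξ₀ s x).toReal := by
    rw [div_le_iff₀ h3]; linarith
  linarith

/-- The displacement formula for optimal points. -/
lemma eq_add_arctanVec (H : OrderedPair a b ξ₀ η₁) (hs : s ∈ Ioo (0 : ℝ) 1) (ht : 0 ≤ t)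
    (hts : t < s) (hx : x ∈ contactSet ξ₀ η₁ s) (hy : dist x y < Real.pi / 2)
    (hpos : 0 < 1 - 2 * (s - t) * (fwd ξ₀ s x).toReal)
    (e : (fwd ξ₀ s x).toReal =
      (1 - cosTrunc (dist x y) ^ 2 * invWeight (s - t) (fwd ξ₀ t) y) / (2 * (s - t))) :
    y = x + arctanVec (-((s - t) / (1 - 2 * (s - t) * (fwd ξ₀ s x).toReal)) •
      fwdGradient ξ₀ s x) := by
  have hτ : 0 < s - t := sub_pos.2 hts
  set τ := s - t
  set k := invWeight τ (fwd ξ₀ t) y with hk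
  have hk0 : 0 ≤ k := invWeight_nonneg
  have hc : 0 < cosTrunc (dist x y) := cosTrunc_pos dist_nonneg hy
  have hX : 1 - 2 * τ * (fwd ξ₀ s x).toReal = cosTrunc (dist x y) ^ 2 * k := by
    rw [e]; field_simp; ring
  rw [hX] at hpos ⊢
  have hk1 : 0 < k := pos_of_mul_pos_right hpos (sq_nonneg _)
  -- The cost frozen at y lies above ξ_s everywhere and touches it at x.
  have hg : fwdGradient ξ₀ s x =
      (k / (2 * τ)) • ((Real.sin (2 * ‖x - y‖) / ‖x - y‖) • (x - y)) := by
    refine H.eq_fwdGradient_of_le hs hx (C := k / (2 * τ)) fun x' => ?_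
    refine (H.toReal_fwd_le_cost hs ht hts x' y).trans ?_
    rw [e]
    exact cost_le_tangent hτ hk0 hy x'
  -- As the weight equals k·cos² and sin 2r = 2 sin r cos r, dividing leaves tan r, which the
  -- arctangent inverts.
  have hv : -(τ / (cosTrunc (dist x y) ^ 2 * k)) • fwdGradient ξ₀ s x =
      (Real.tan ‖y - x‖ / ‖y - x‖) • (y - x) := by
    rw [dist_eq_norm] at hc hy hpos ⊢
    rw [cosTrunc_of_le hy.le] at hc ⊢
    rw [hg, norm_sub_rev y x, Real.sin_two_mul, Real.tan_eq_sin_div_cos, ← neg_sub x y]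
    rcases eq_or_ne x y with rfl | hxy
    · simp
    have hr : 0 < ‖x - y‖ := norm_pos_iff.2 (sub_ne_zero.2 hxy)
    match_scalars <;> field_simp
  rw [hv, arctanVec_tan (by rwa [← dist_eq_norm, dist_comm])]
  abel

lemma half_of_fwd_eq (H : OrderedPair a b ξ₀ η₁) (hs : s ∈ Ioo (0 : ℝ) 1)
    (hx : x ∈ contactSet ξ₀ η₁ s) (h : 1 - 2 * s * (fwd ξ₀ s x).toReal ≤ 0) :
    η₁ x = ((1 / 2 : ℝ) : EReal) := by
  refine H.half_of_bwd_eq ⟨hs.1, hs.2.le⟩ ?_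
  rw [← H.coe_bwd hs, (H.mem_contactSet_iff hs).1 hx]
  congr 1
  have h1 := H.toReal_fwd_le hs x
  refine le_antisymm h1 ?_
  rw [div_le_iff₀ (by linarith [hs.1])]
  linarith

/-- Equality in the semigroup inequality, at contact points only. For t > 0 off Ξ⁺, an optimal y at
time 0 is known in closed form. The intermediate point z is given by the same formula with s-t in
place of s, and testing ξ_t(z) with y shows that z is optimal. -/
lemma exists_optimal (H : OrderedPair a b ξ₀ η₁) (hs : s ∈ Ioo (0 : ℝ) 1) (ht : 0 ≤ t)
    (hts : t < s) (hx : x ∈ contactSet ξ₀ η₁ s) :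
    ∃ y, dist x y < Real.pi / 2 ∧ (fwd ξ₀ s x).toReal =
      (1 - cosTrunc (dist x y) ^ 2 * invWeight (s - t) (fwd ξ₀ t) y) / (2 * (s - t)) := by
  have e0 : fwd ξ₀ 0 = ξ₀ := funext fun y => fwd_zero ξ₀ y
  rcases ht.eq_or_lt with rfl | h0
  · rw [e0, sub_zero]
    exact (H.regular hs).exists_toReal_eq x
  have ht' : t ∈ Ioo (0 : ℝ) 1 := ⟨h0, hts.trans hs.2⟩
  have hs0 := hs.1
  have hτ : 0 < s - t := sub_pos.2 hts
  rcases le_or_gt (1 - 2 * s * (fwd ξ₀ s x).toReal) 0 with hX | hX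
  -- The weight towards time 0 vanishes only on Ξ⁺, where both values are explicit and x itself is
  -- optimal.
  · have hη := H.half_of_fwd_eq hs hx hX
    have h1 : fwd ξ₀ t x = ((1 / (2 * t) : ℝ) : EReal) := by
      rw [← H.bwd_of_half ⟨h0, ht'.2.le⟩ hη]
      exact (H.mem_contactSet_of_half ⟨ht, ht'.2.le⟩ hη).symm
    have h2 : fwd ξ₀ s x = ((1 / (2 * s) : ℝ) : EReal) := by
      rw [← H.bwd_of_half ⟨hs.1, hs.2.le⟩ hη]
      exact hx.symm
    have h3 : 1 + 2 * (s - t) * (1 / (2 * t)) = s / t := by field_simp; ring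
    refine ⟨x, by rw [dist_self]; positivity, ?_⟩
    rw [invWeight_of_coe h1 (by rw [h3]; positivity), h3, h2, EReal.toReal_coe, dist_self,
      cosTrunc_zero, inv_div]
    field_simp
  -- the optimal point at time zero, and the intermediate point on the segment
  obtain ⟨y, hy, e⟩ := (H.regular hs).exists_toReal_eq x
  have hyform := H.eq_add_arctanVec hs le_rfl hs0 hx hy (by rwa [sub_zero])
    (by rwa [e0, sub_zero])
  rw [sub_zero] at hyform
  set h := (fwd ξ₀ s x).toReal with hh
  set g := fwdGradient ξ₀ s x
  have hle := H.toReal_fwd_le hs x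
  rw [le_div_iff₀ (by positivity)] at hle
  have hY : 0 < 1 - 2 * (s - t) * h := by nlinarith
  set X := 1 - 2 * s * h with hXdef
  set Y := 1 - 2 * (s - t) * h with hYdef
  set G := ‖g‖ with hG
  have hG0 : 0 ≤ G := norm_nonneg g
  set α := s / X * G with hα
  set β := (s - t) / Y * G with hβ
  have hα0 : 0 ≤ α := by positivity
  have hβ0 : 0 ≤ β := by positivity
  have hβα : β ≤ α := by
    refine mul_le_mul_of_nonneg_right ?_ hG0
    rw [div_le_div_iff₀ hY hX, hXdef, hYdef]
    nlinarith
  set z := x + arctanVec (-((s - t) / Y) • g) with hz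
  have hdxy : dist x y = Real.arctan α := by
    rw [hyform, dist_self_add_right, norm_arctanVec, norm_smul, norm_neg, Real.norm_eq_abs,
      abs_of_nonneg (by positivity)]
  have hdxz : dist x z = Real.arctan β := by
    rw [hz, dist_self_add_right, norm_arctanVec, norm_smul, norm_neg, Real.norm_eq_abs,
      abs_of_nonneg (by positivity)]
  have hmono : Real.arctan β ≤ Real.arctan α := Real.arctan_mono hβα
  have hdzy : dist z y = Real.arctan α - Real.arctan β := by
    rw [hyform, hz, dist_add_left, dist_eq_norm, arctanVec_smul, arctanVec_smul, ← sub_smul,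
      neg_mul, neg_mul, Real.arctan_neg, Real.arctan_neg, ← hα, ← hβ, norm_smul, Real.norm_eq_abs]
    rcases eq_or_ne G 0 with h0 | h0
    · rw [← hG, h0, hα, hβ, h0]; simp
    · have hGp : 0 < G := lt_of_le_of_ne hG0 h0.symm
      rw [← hG, ← sub_div, abs_div, abs_of_pos hGp, div_mul_cancel₀ _ h0, abs_of_nonneg] <;>
        linarith
  have hlt : Real.arctan α < Real.pi / 2 := Real.arctan_lt_pi_div_two α
  have hβn : 0 ≤ Real.arctan β := Real.arctan_nonneg.2 hβ0
  have hcxy : cosTrunc (dist x y) ^ 2 = (1 + α ^ 2)⁻¹ := by rw [hdxy, cosTrunc_arctan_sq]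
  have hcxz : cosTrunc (dist x z) ^ 2 = (1 + β ^ 2)⁻¹ := by rw [hdxz, cosTrunc_arctan_sq]
  have hczy : cosTrunc (dist z y) ^ 2 = (1 + α * β) ^ 2 * ((1 + α ^ 2)⁻¹ * (1 + β ^ 2)⁻¹) := by
    rw [hdzy, cosTrunc_of_le (by linarith), cos_arctan_sub_sq]
  have hXk : X = (1 + α ^ 2)⁻¹ * invWeight s ξ₀ y := by
    rw [← hcxy, hXdef, hh, fwd, e]
    field_simp
    ring
  have hkpos : 0 < invWeight s ξ₀ y :=
    pos_of_mul_pos_right (by rw [← hXk]; exact hX) (by positivity : 0 ≤ (1 + α ^ 2)⁻¹)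
  obtain ⟨u, hu, -, hu0, ek⟩ :=
    exists_coe_of_invWeight_pos hs0 (H.regular hs).weight_pos (H.le_fwd y) hkpos
  -- With ζ = 2h + iG, N and M are the squared moduli of 1-sζ and 1-(s-t)ζ, and XY + s(s-t)G² is the
  -- real part of one times the conjugate of the other.
  set N := X ^ 2 + s ^ 2 * G ^ 2 with hN
  set M := Y ^ 2 + (s - t) ^ 2 * G ^ 2 with hM
  have hNp : 0 < N := by positivity
  have hMp : 0 < M := by positivity
  have eα : 1 + α ^ 2 = N / X ^ 2 := by rw [hα, hN]; field_simp
  have eβ : 1 + β ^ 2 = M / Y ^ 2 := by rw [hβ, hM]; field_simp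
  have eαβ : 1 + α * β = (X * Y + s * (s - t) * G ^ 2) / (X * Y) := by
    rw [hα, hβ]; field_simp
  have hP : 0 < X * Y + s * (s - t) * G ^ 2 := by positivity
  have eu : 1 + 2 * s * u = X / N := by
    rw [ek, eα, ← mul_inv] at hXk
    have : (N / X ^ 2) * (1 + 2 * s * u) = X⁻¹ := inv_eq_iff_eq_inv.1 hXk.symm
    field_simp at this ⊢
    linarith
  have eu2 : 1 + 2 * t * u = (X * Y + s * (s - t) * G ^ 2) / N := by
    have h1 : u = (X / N - 1) / (2 * s) := by rw [← eu]; field_simp; ring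
    have h2 : 1 + 2 * t * u = ((s - t) * N + t * X) / (s * N) := by
      rw [h1]; field_simp; ring
    have h3 : (s - t) * N + t * X = s * (X * Y + s * (s - t) * G ^ 2) := by
      rw [hN, hXdef, hYdef]; ring
    rw [h2, h3]
    field_simp
  -- The competitor y bounds ξ_t(z) by the value for which the cost from z to x equals h, so the
  -- reverse inequality of `toReal_fwd_le_cost` follows.
  have hw : (fwd ξ₀ t z).toReal ≤ (Y / M - 1) / (2 * (s - t)) := by
    refine ((H.regular ht').toReal_le z y).trans (le_of_eq ?_)
    have h3 : s * M - t * Y = (s - t) * (X * Y + s * (s - t) * G ^ 2) := by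
      rw [hM, hXdef, hYdef]; ring
    rw [invWeight_of_coe hu (by rw [eu2]; positivity), eu2, hczy, eα, eβ, eαβ]
    have h4 : ((X * Y + s * (s - t) * G ^ 2) / (X * Y)) ^ 2 *
        ((N / X ^ 2)⁻¹ * (M / Y ^ 2)⁻¹) * ((X * Y + s * (s - t) * G ^ 2) / N)⁻¹ =
        (X * Y + s * (s - t) * G ^ 2) / M := by
      field_simp
    rw [h4]
    have h5 : X * Y + s * (s - t) * G ^ 2 = (s * M - t * Y) / (s - t) := by
      rw [h3]; field_simp
    rw [h5]
    field_simp
    ring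
  have hzlt : dist x z < Real.pi / 2 := by rw [hdxz]; linarith
  refine ⟨z, hzlt, le_antisymm (H.toReal_fwd_le_cost hs ht hts x z) ?_⟩
  have hpos := H.fwd_eq_coe_pos hs h0 hts z
  rw [invWeight_of_coe (H.coe_fwd ht' z).symm hpos.le, hcxz, eβ]
  have h6 : 1 + 2 * (s - t) * (fwd ξ₀ t z).toReal ≤ Y / M := by
    rw [le_div_iff₀ (by positivity)] at hw
    linarith
  have h7 : Y ≤ (M / Y ^ 2)⁻¹ * (1 + 2 * (s - t) * (fwd ξ₀ t z).toReal)⁻¹ := by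
    have h8 : (Y / M)⁻¹ ≤ (1 + 2 * (s - t) * (fwd ξ₀ t z).toReal)⁻¹ := inv_anti₀ hpos h6
    calc Y = (M / Y ^ 2)⁻¹ * (Y / M)⁻¹ := by field_simp
      _ ≤ _ := mul_le_mul_of_nonneg_left h8 (by positivity)
  rw [div_le_iff₀ (by positivity)]
  linarith

end OrderedPair

/-! ### Minimizers and optimal points, with their time reversal. -/

section OptPoints

variable {d : ℕ} {s t τ : ℝ} {ξ ξ₀ η₁ : EuclideanSpace ℝ (Fin d) → EReal}
  {x y : EuclideanSpace ℝ (Fin d)}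

lemma mem_minimizers_iff (hτ : τ ≠ 0) : y ∈ minimizers τ ξ x ↔ dist x y < Real.pi / 2 ∧
    ∀ y', dist x y' < Real.pi / 2 → hopfLaxCost τ ξ x y ≤ hopfLaxCost τ ξ x y' := by
  simp only [minimizers, mem_ofPred_eq, hτ, false_and, false_or, ne_eq, not_false_eq_true,
    true_and, mem_ball, isMinOn_iff, dist_comm _ x]

lemma optPoints_of_lt (h : t < s) :
    optPoints ξ₀ η₁ s t x = minimizers (s - t) (fwd ξ₀ t) x := by
  ext y
  simp only [optPoints, mem_ofPred_eq, h.le, true_and, not_lt.2 h.le, false_and, or_false]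

lemma optPoints_of_gt (h : s < t) :
    optPoints ξ₀ η₁ s t x = minimizers (t - s) (fun z => -bwd η₁ t z) x := by
  ext y
  simp only [optPoints, mem_ofPred_eq, h, true_and, not_le.2 h, false_and, false_or]

lemma optPoints_swap (hst : s ≠ t) :
    optPoints (fun y => -η₁ y) (fun y => -ξ₀ y) (1 - s) (1 - t) x = optPoints ξ₀ η₁ s t x := by
  rcases hst.lt_or_gt with h | h
  · rw [optPoints_of_gt h, optPoints_of_lt (by linarith), sub_sub_sub_cancel_left]
    congr 1
    funext z
    rw [fwd_neg, sub_sub_cancel]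
  · rw [optPoints_of_lt h, optPoints_of_gt (by linarith), sub_sub_sub_cancel_left]
    congr 1
    funext z
    rw [bwd_neg, neg_neg, sub_sub_cancel]

end OptPoints

/-- The transport map between the contact sets at times `s` and `t`. -/
noncomputable def transport {d : ℕ} (ξ₀ : EuclideanSpace ℝ (Fin d) → EReal) (s t : ℝ)
    (x : EuclideanSpace ℝ (Fin d)) : EuclideanSpace ℝ (Fin d) :=
  x + arctanVec (((t - s) / (1 + 2 * (t - s) * (fwd ξ₀ s x).toReal)) • fwdGradient ξ₀ s x)

/-- The square of the growth factor along the transport. -/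
noncomputable def growthSq {d : ℕ} (ξ₀ : EuclideanSpace ℝ (Fin d) → EReal) (s t : ℝ)
    (x : EuclideanSpace ℝ (Fin d)) : ℝ :=
  (1 + 2 * (t - s) * (fwd ξ₀ s x).toReal) ^ 2 + (t - s) ^ 2 * ‖fwdGradient ξ₀ s x‖ ^ 2

/-! ### Transport between contact sets. -/

namespace OrderedPair

variable {d : ℕ} {a b : ℝ} {ξ₀ η₁ : EuclideanSpace ℝ (Fin d) → EReal} {s t : ℝ}
  {x y : EuclideanSpace ℝ (Fin d)}

/-- The point of the contact set at an earlier time that is optimal for a contact point. -/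
lemma transport_spec_of_lt (H : OrderedPair a b ξ₀ η₁) (hs : s ∈ Ioo (0 : ℝ) 1) (ht : 0 ≤ t)
    (hts : t < s) (hx : x ∈ contactSet ξ₀ η₁ s)
    (hpos : 0 < 1 + 2 * (t - s) * (fwd ξ₀ s x).toReal) :
    optPoints ξ₀ η₁ s t x = {transport ξ₀ s t x} ∧
    transport ξ₀ s t x ∈ contactSet ξ₀ η₁ t ∧
    x ∈ optPoints ξ₀ η₁ t s (transport ξ₀ s t x) ∧
    fwd ξ₀ t (transport ξ₀ s t x) ≠ ⊥ ∧ fwd ξ₀ t (transport ξ₀ s t x) ≠ ⊤ ∧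
    (1 - 2 * (t - s) * (fwd ξ₀ t (transport ξ₀ s t x)).toReal) *
        (1 + 2 * (t - s) * (fwd ξ₀ s x).toReal) =
      cosTrunc ‖x - transport ξ₀ s t x‖ ^ 2 := by
  have hτ : 0 < s - t := sub_pos.2 hts
  have hsign : 1 + 2 * (t - s) * (fwd ξ₀ s x).toReal = 1 - 2 * (s - t) * (fwd ξ₀ s x).toReal := by
    ring
  obtain ⟨a', hm, ha'⟩ := H.exists_lower_bound_fwd hs ht hts
  obtain ⟨y, hy, e⟩ := H.exists_optimal hs ht hts hx
  have hform : ∀ w, dist x w < Real.pi / 2 → (fwd ξ₀ s x).toReal =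
      (1 - cosTrunc (dist x w) ^ 2 * invWeight (s - t) (fwd ξ₀ t) w) / (2 * (s - t)) →
      w = transport ξ₀ s t x := by
    intro w hw ew
    rw [H.eq_add_arctanVec hs ht hts hx hw (by rwa [← hsign]) ew, transport, hsign, ← neg_div,
      neg_sub]
  rw [← hform y hy e]
  rw [hsign] at hpos
  have hcost : ∀ w, hopfLaxCost (s - t) (fwd ξ₀ t) x w =
      (((1 - cosTrunc (dist x w) ^ 2 * invWeight (s - t) (fwd ξ₀ t) w) / (2 * (s - t)) : ℝ) :
        EReal) := fun w => hopfLaxCost_eq hτ hm (ha' w)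
  have hU := H.toReal_fwd_le_cost hs ht hts
  have hk : 1 - 2 * (s - t) * (fwd ξ₀ s x).toReal =
      cosTrunc (dist x y) ^ 2 * invWeight (s - t) (fwd ξ₀ t) y := by
    rw [e]; field_simp; ring
  have hkpos : 0 < invWeight (s - t) (fwd ξ₀ t) y :=
    pos_of_mul_pos_right (by rw [← hk]; exact hpos) (sq_nonneg _)
  obtain ⟨u, hu, -, hu0, ek⟩ := exists_coe_of_invWeight_pos hτ hm (ha' y) hkpos
  have hprod : (1 + 2 * (s - t) * u) * (1 - 2 * (s - t) * (fwd ξ₀ s x).toReal) =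
      cosTrunc (dist x y) ^ 2 := by
    rw [hk, ek]; field_simp
  have hopt : optPoints ξ₀ η₁ s t x = {y} := by
    rw [optPoints_of_lt hts]
    ext w
    rw [mem_minimizers_iff hτ.ne', mem_singleton_iff]
    constructor
    · rintro ⟨hw, hmin⟩
      have := hmin y hy
      rw [hcost, hcost, ← e, EReal.coe_le_coe_iff] at this
      rw [hform w hw (le_antisymm (hU x w) this), ← hform y hy e]
    · rintro rfl
      refine ⟨hy, fun y' _ => ?_⟩
      rw [hcost, hcost, ← e, EReal.coe_le_coe_iff]
      exact hU x y'
  have hcontact : y ∈ contactSet ξ₀ η₁ t := by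
    have ht1 : t < 1 := hts.trans hs.2
    refine le_antisymm (H.bwd_le_fwd ⟨ht, ht1.le⟩ y) (not_lt.1 fun hlt => ?_)
    -- A gap at y leaves room for a real w strictly below u. Comparison in reversed time then gives
    -- the product inequality with w instead of u, contradicting the equality `hprod`.
    obtain ⟨w, hw1, hw2⟩ := EReal.lt_iff_exists_real_btwn.1 hlt
    rw [hu, EReal.coe_lt_coe_iff] at hw2
    have hv : ((-w : ℝ) : EReal) ≤ hopfLax (1 - t) (fun y => -η₁ y) y := by
      have := EReal.neg_le_neg_iff.2 hw1.le
      rwa [← EReal.coe_neg, bwd_eq_neg, neg_neg] at this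
    obtain ⟨h1, h2⟩ := back_le_toReal_hopfLax H.swap.neg_half_le H.swap.le_fwd H.swap.lsc
      (sub_pos.2 hs.2) (by linarith) (by linarith) hv x
    have h3 : (hopfLax (1 - s) (fun y => -η₁ y) x).toReal = -(fwd ξ₀ s x).toReal := by
      have := toReal_fwd_neg η₁ (1 - s) x
      rw [sub_sub_cancel, (H.mem_contactSet_iff hs).1 hx] at this
      exact this
    rw [sub_sub_sub_cancel_left, mul_neg, sub_neg_eq_add] at h1 h2
    rw [h3, div_le_iff₀ (by positivity), ← div_eq_mul_inv, dist_comm y x] at h2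
    have h4 : cosTrunc (dist x y) ^ 2 / (1 + 2 * (s - t) * w) ≤
        1 - 2 * (s - t) * (fwd ξ₀ s x).toReal := by linarith
    rw [div_le_iff₀ h1, ← hprod, mul_comm (1 + 2 * (s - t) * u)] at h4
    have := le_of_mul_le_mul_left h4 hpos
    nlinarith
  have hback : x ∈ optPoints ξ₀ η₁ t s y := by
    rw [optPoints_of_gt hts, mem_minimizers_iff hτ.ne']
    refine ⟨by rwa [dist_comm], fun x' hx' => ?_⟩
    have hcoe : ∀ z, -bwd η₁ s z = ((-(bwd η₁ s z).toReal : ℝ) : EReal) := fun z => by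
      rw [EReal.coe_neg, H.coe_bwd hs]
    -- The product inequality for the backward value at every z follows from the one for the larger
    -- forward value. It is an equality at the contact point x, which is therefore a minimizer.
    have hge : ∀ z, cosTrunc (dist z y) ^ 2 ≤
        (1 + 2 * (s - t) * u) * (1 + 2 * (s - t) * -(bwd η₁ s z).toReal) := by
      intro z
      have h1 := hU z y
      rw [ek, le_div_iff₀ (by positivity), ← div_eq_mul_inv] at h1
      have h2 : cosTrunc (dist z y) ^ 2 / (1 + 2 * (s - t) * u) ≤
          1 - 2 * (s - t) * (fwd ξ₀ s z).toReal := by linarith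
      rw [div_le_iff₀ hu0] at h2
      have h3 := H.toReal_bwd_le_toReal_fwd hs z
      nlinarith [mul_le_mul_of_nonneg_left h3 (mul_pos hu0 hτ).le]
    have hpos' : ∀ z, dist y z < Real.pi / 2 →
        0 < 1 + 2 * (s - t) * -(bwd η₁ s z).toReal := by
      intro z hz
      rw [dist_comm] at hz
      exact (pos_iff_pos_of_mul_pos ((pow_pos (cosTrunc_pos dist_nonneg hz) 2).trans_le
        (hge z))).1 hu0
    rw [hopfLaxCost_of_coe (ξ := fun z => -bwd η₁ s z) (hcoe x)
      (hpos' x (by rwa [dist_comm])), hopfLaxCost_of_coe (ξ := fun z => -bwd η₁ s z) (hcoe x')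
      (hpos' x' hx'), EReal.coe_le_coe_iff]
    have e1 : cosTrunc (dist y x) ^ 2 * (1 + 2 * (s - t) * -(bwd η₁ s x).toReal)⁻¹ =
        1 + 2 * (s - t) * u := by
      rw [(H.mem_contactSet_iff hs).1 hx, mul_neg, ← sub_eq_add_neg, dist_comm, ← hprod,
        mul_inv_cancel_right₀ hpos.ne']
    have e2 : cosTrunc (dist y x') ^ 2 * (1 + 2 * (s - t) * -(bwd η₁ s x').toReal)⁻¹ ≤
        1 + 2 * (s - t) * u := by
      rw [← div_eq_mul_inv, div_le_iff₀ (hpos' x' hx'), dist_comm]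
      exact hge x'
    rw [e1]
    gcongr
  refine ⟨hopt, hcontact, hback, ?_, ?_, ?_⟩
  · rw [hu]; exact EReal.coe_ne_bot u
  · rw [hu]; exact EReal.coe_ne_top u
  · rw [hu, EReal.toReal_coe, hsign, ← dist_eq_norm, ← hprod]
    ring

lemma transport_swap (H : OrderedPair a b ξ₀ η₁) (hs : s ∈ Ioo (0 : ℝ) 1)
    (hx : x ∈ contactSet ξ₀ η₁ s) :
    transport (fun y => -η₁ y) (1 - s) (1 - t) x = transport ξ₀ s t x := by
  rw [transport, transport, H.fwdGradient_swap hs hx, toReal_fwd_neg, sub_sub_cancel,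
    (H.mem_contactSet_iff hs).1 hx, sub_sub_sub_cancel_left, smul_neg, ← neg_smul, ← neg_div,
    neg_sub]
  congr 4
  ring

/-- Unique optimal points for contact points. -/
lemma transport_spec (H : OrderedPair a b ξ₀ η₁) (hs : s ∈ Ioo (0 : ℝ) 1)
    (ht : t ∈ Icc (0 : ℝ) 1) (hts : t ≠ s) (hx : x ∈ contactSet ξ₀ η₁ s)
    (hpos : 0 < 1 + 2 * (t - s) * (fwd ξ₀ s x).toReal) :
    optPoints ξ₀ η₁ s t x = {transport ξ₀ s t x} ∧
    transport ξ₀ s t x ∈ contactSet ξ₀ η₁ t ∧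
    x ∈ optPoints ξ₀ η₁ t s (transport ξ₀ s t x) ∧
    fwd ξ₀ t (transport ξ₀ s t x) ≠ ⊥ ∧ fwd ξ₀ t (transport ξ₀ s t x) ≠ ⊤ ∧
    (1 - 2 * (t - s) * (fwd ξ₀ t (transport ξ₀ s t x)).toReal) *
        (1 + 2 * (t - s) * (fwd ξ₀ s x).toReal) =
      cosTrunc ‖x - transport ξ₀ s t x‖ ^ 2 := by
  rcases hts.lt_or_gt with h | h
  · exact H.transport_spec_of_lt hs ht.1 h hx hpos
  have hx' : x ∈ contactSet (fun y => -η₁ y) (fun y => -ξ₀ y) (1 - s) := by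
    rwa [contactSet_swap, sub_sub_cancel]
  have hval : (fwd (fun y => -η₁ y) (1 - s) x).toReal = -(fwd ξ₀ s x).toReal := by
    rw [toReal_fwd_neg, sub_sub_cancel, (H.mem_contactSet_iff hs).1 hx]
  -- A later target time is an earlier one for the reversed pair. Since the image is a contact
  -- point, the backward values returned there can be replaced by forward ones.
  have key := H.swap.transport_spec_of_lt (t := 1 - t) (one_sub_mem_Ioo hs) (sub_nonneg.2 ht.2)
    (by linarith) hx' (by rw [hval]; linarith)
  rw [optPoints_swap h.ne, optPoints_swap h.ne', contactSet_swap, H.transport_swap hs hx, hval,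
    toReal_fwd_neg, fwd_neg, sub_sub_cancel] at key
  obtain ⟨h1, h2, h3, h4, h5, h6⟩ := key
  have h2' : bwd η₁ t (transport ξ₀ s t x) = fwd ξ₀ t (transport ξ₀ s t x) := h2
  rw [h2'] at h4 h5 h6
  refine ⟨h1, h2, h3, ?_, ?_, ?_⟩
  · intro h; rw [h] at h5; exact h5 rfl
  · intro h; rw [h] at h4; exact h4 rfl
  · rw [← h6]; ring

lemma transport_self (ξ₀ : EuclideanSpace ℝ (Fin d) → EReal) (s : ℝ)
    (x : EuclideanSpace ℝ (Fin d)) : transport ξ₀ s s x = x := by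
  simp [transport]

/-- Also covers the end-point convention: where the weight vanishes on the contact set the gradient
is zero, so division by zero in `transport` has no effect. -/
lemma transport_of_gradient_eq_zero (t : ℝ) (h : fwdGradient ξ₀ s x = 0) :
    transport ξ₀ s t x = x := by
  simp [transport, h]

/-! ### Positivity of the weights -/

/-- The weight is affine in ξ_s(x), and at the extreme values 1/(2s) and -1/(2(1-s)) it equals t/s
and (1-t)/(1-s). -/
lemma min_le_weight (H : OrderedPair a b ξ₀ η₁) (hs : s ∈ Ioo (0 : ℝ) 1) (t : ℝ)
    (x : EuclideanSpace ℝ (Fin d)) :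
    min (t / s) ((1 - t) / (1 - s)) ≤ 1 + 2 * (t - s) * (fwd ξ₀ s x).toReal := by
  have h1 := H.toReal_fwd_le hs x
  have h2 := H.le_toReal_fwd hs x
  have hs0 := hs.1
  have hs1 : 0 < 1 - s := sub_pos.2 hs.2
  rcases le_total t s with h | h
  · refine (min_le_left _ _).trans ?_
    have e : t / s = 1 + 2 * (t - s) * (1 / (2 * s)) := by field_simp; ring
    rw [e]
    have := mul_le_mul_of_nonpos_left h1 (by linarith : 2 * (t - s) ≤ 0)
    linarith
  · refine (min_le_right _ _).trans ?_
    have e : (1 - t) / (1 - s) = 1 + 2 * (t - s) * (-1 / (2 * (1 - s))) := by field_simp; ring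
    rw [e]
    have := mul_le_mul_of_nonneg_left h2 (by linarith : 0 ≤ 2 * (t - s))
    linarith

lemma weight_nonneg (H : OrderedPair a b ξ₀ η₁) (hs : s ∈ Ioo (0 : ℝ) 1)
    (ht : t ∈ Icc (0 : ℝ) 1) (x : EuclideanSpace ℝ (Fin d)) :
    0 ≤ 1 + 2 * (t - s) * (fwd ξ₀ s x).toReal :=
  (le_min (div_nonneg ht.1 hs.1.le) (div_nonneg (sub_nonneg.2 ht.2)
    (sub_nonneg.2 hs.2.le))).trans (H.min_le_weight hs t x)

lemma min_pos (hs : s ∈ Ioo (0 : ℝ) 1) (ht : t ∈ Ioo (0 : ℝ) 1) :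
    0 < min (t / s) ((1 - t) / (1 - s)) :=
  lt_min (div_pos ht.1 hs.1) (div_pos (sub_pos.2 ht.2) (sub_pos.2 hs.2))

lemma weight_pos (H : OrderedPair a b ξ₀ η₁) (hs : s ∈ Ioo (0 : ℝ) 1)
    (ht : t ∈ Ioo (0 : ℝ) 1) (x : EuclideanSpace ℝ (Fin d)) :
    0 < 1 + 2 * (t - s) * (fwd ξ₀ s x).toReal :=
  (min_pos hs ht).trans_le (H.min_le_weight hs t x)

/-- The weights vanish only at stationary points and at the end points of the time interval. -/
lemma weight_eq_zero (H : OrderedPair a b ξ₀ η₁) (hs : s ∈ Ioo (0 : ℝ) 1)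
    (ht : t ∈ Icc (0 : ℝ) 1) (hx : x ∈ contactSet ξ₀ η₁ s)
    (h : 1 + 2 * (t - s) * (fwd ξ₀ s x).toReal ≤ 0) :
    (t = 0 ∧ η₁ x = ((1 / 2 : ℝ) : EReal)) ∨ (t = 1 ∧ ξ₀ x = ((-1 / 2 : ℝ) : EReal)) := by
  rcases ht.1.eq_or_lt with rfl | h0
  · exact Or.inl ⟨rfl, H.half_of_fwd_eq hs hx (by linarith)⟩
  rcases ht.2.eq_or_lt with rfl | h1
  · refine Or.inr ⟨rfl, ?_⟩
    refine half_swap_iff.1 (H.swap.half_of_fwd_eq (x := x) (one_sub_mem_Ioo hs)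
      (by rwa [contactSet_swap, sub_sub_cancel]) ?_)
    rw [toReal_fwd_neg, sub_sub_cancel, (H.mem_contactSet_iff hs).1 hx]
    linarith
  · exact absurd (H.weight_pos hs ⟨h0, h1⟩ x) (not_lt.2 h)

lemma weight_pos_of_gradient_ne_zero (H : OrderedPair a b ξ₀ η₁) (hs : s ∈ Ioo (0 : ℝ) 1)
    (ht : t ∈ Icc (0 : ℝ) 1) (hx : x ∈ contactSet ξ₀ η₁ s) (hg : fwdGradient ξ₀ s x ≠ 0) :
    0 < 1 + 2 * (t - s) * (fwd ξ₀ s x).toReal := by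
  by_contra! h
  refine hg (H.fwdGradient_of_stationary hs ?_)
  rcases H.weight_eq_zero hs ht hx h with h | h
  · exact Or.inr h.2
  · exact Or.inl h.2

/-! ### Concatenation -/

lemma transport_mem (H : OrderedPair a b ξ₀ η₁) (hs : s ∈ Ioo (0 : ℝ) 1)
    (ht : t ∈ Ioo (0 : ℝ) 1) (hx : x ∈ contactSet ξ₀ η₁ s) :
    transport ξ₀ s t x ∈ contactSet ξ₀ η₁ t := by
  rcases eq_or_ne t s with rfl | hts
  · rwa [transport_self]
  · exact (H.transport_spec hs ⟨ht.1.le, ht.2.le⟩ hts hx (H.weight_pos hs ht x)).2.1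

lemma cosTrunc_transport_sq (h : 1 + 2 * (t - s) * (fwd ξ₀ s x).toReal ≠ 0) :
    cosTrunc ‖x - transport ξ₀ s t x‖ ^ 2 =
      (1 + 2 * (t - s) * (fwd ξ₀ s x).toReal) ^ 2 / growthSq ξ₀ s t x := by
  rw [transport, sub_add_cancel_left, norm_neg, norm_arctanVec, cosTrunc_arctan_sq, norm_smul,
    mul_pow, Real.norm_eq_abs, sq_abs, growthSq, div_pow, inv_eq_one_div]
  have h1 : 0 < (1 + 2 * (t - s) * (fwd ξ₀ s x).toReal) ^ 2 := by positivity
  have h2 : 1 + (t - s) ^ 2 / (1 + 2 * (t - s) * (fwd ξ₀ s x).toReal) ^ 2 *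
      ‖fwdGradient ξ₀ s x‖ ^ 2 = ((1 + 2 * (t - s) * (fwd ξ₀ s x).toReal) ^ 2 +
      (t - s) ^ 2 * ‖fwdGradient ξ₀ s x‖ ^ 2) / (1 + 2 * (t - s) * (fwd ξ₀ s x).toReal) ^ 2 := by
    rw [eq_div_iff h1.ne']
    linear_combination ‖fwdGradient ξ₀ s x‖ ^ 2 * div_mul_cancel₀ ((t - s) ^ 2) h1.ne'
  rw [h2, one_div_div]

lemma growthSq_pos (h : 1 + 2 * (t - s) * (fwd ξ₀ s x).toReal ≠ 0) : 0 < growthSq ξ₀ s t x := by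
  have h1 : 0 < (1 + 2 * (t - s) * (fwd ξ₀ s x).toReal) ^ 2 := by positivity
  have h2 : 0 ≤ (t - s) ^ 2 * ‖fwdGradient ξ₀ s x‖ ^ 2 := by positivity
  rw [growthSq]
  linarith

/-- Values and gradients along the transport. -/
lemma fwd_transport (H : OrderedPair a b ξ₀ η₁) (hs : s ∈ Ioo (0 : ℝ) 1)
    (ht : t ∈ Ioo (0 : ℝ) 1) (hx : x ∈ contactSet ξ₀ η₁ s) :
    (fwd ξ₀ t (transport ξ₀ s t x)).toReal = (2 * (fwd ξ₀ s x).toReal + (t - s) *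
      (4 * (fwd ξ₀ s x).toReal ^ 2 + ‖fwdGradient ξ₀ s x‖ ^ 2)) / (2 * growthSq ξ₀ s t x) ∧
    fwdGradient ξ₀ t (transport ξ₀ s t x) = (growthSq ξ₀ s t x)⁻¹ • fwdGradient ξ₀ s x := by
  rcases eq_or_ne t s with rfl | hts
  · rw [transport_self]
    simp [growthSq]
  have hpos := H.weight_pos hs ht x
  obtain ⟨-, hT, hback, -, -, hprod⟩ := H.transport_spec hs ⟨ht.1.le, ht.2.le⟩ hts hx hpos
  have hpos' := H.weight_pos ht hs (transport ξ₀ s t x)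
  have hopt := (H.transport_spec ht ⟨hs.1.le, hs.2.le⟩ hts.symm hT hpos').1
  -- Since x is optimal for its image and optimal points are unique, transporting back returns x.
  -- The two displacements are opposite, and injectivity of `arctanVec` identifies the new gradient.
  rw [hopt, mem_singleton_iff, transport] at hback
  rw [cosTrunc_transport_sq hpos.ne'] at hprod
  have hQ := growthSq_pos hpos.ne'
  have hτ : t - s ≠ 0 := sub_ne_zero.2 hts
  have hv : 1 - 2 * (t - s) * (fwd ξ₀ t (transport ξ₀ s t x)).toReal =
      (1 + 2 * (t - s) * (fwd ξ₀ s x).toReal) / growthSq ξ₀ s t x := by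
    rw [eq_div_iff hQ.ne']
    rw [eq_div_iff hQ.ne'] at hprod
    refine mul_right_cancel₀ hpos.ne' ?_
    rw [mul_right_comm, hprod]
    ring
  constructor
  · rw [eq_div_iff (by positivity)]
    rw [eq_div_iff hQ.ne'] at hv
    refine mul_left_cancel₀ hτ ?_
    have hdef : growthSq ξ₀ s t x = (1 + 2 * (t - s) * (fwd ξ₀ s x).toReal) ^ 2 +
      (t - s) ^ 2 * ‖fwdGradient ξ₀ s x‖ ^ 2 := rfl
    linear_combination -hv + hdef
  · have h1 : arctanVec (((s - t) / (1 + 2 * (s - t) *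
        (fwd ξ₀ t (transport ξ₀ s t x)).toReal)) • fwdGradient ξ₀ t (transport ξ₀ s t x)) =
        arctanVec (-(((t - s) / (1 + 2 * (t - s) * (fwd ξ₀ s x).toReal)) •
          fwdGradient ξ₀ s x)) := by
      rw [arctanVec_neg]
      have h2 : transport ξ₀ s t x - x = arctanVec (((t - s) / (1 + 2 * (t - s) *
        (fwd ξ₀ s x).toReal)) • fwdGradient ξ₀ s x) := by
        rw [transport, add_sub_cancel_left]
      rw [← h2, neg_sub, ← sub_eq_iff_eq_add'.2 hback]
    have h3 := arctanVec_injective h1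
    have h4 : 1 + 2 * (s - t) * (fwd ξ₀ t (transport ξ₀ s t x)).toReal =
        (1 + 2 * (t - s) * (fwd ξ₀ s x).toReal) / growthSq ξ₀ s t x := by
      rw [← hv]; ring
    rw [h4, ← neg_smul] at h3
    have h5 : (s - t) / ((1 + 2 * (t - s) * (fwd ξ₀ s x).toReal) / growthSq ξ₀ s t x) ≠ 0 :=
      div_ne_zero (sub_ne_zero.2 hts.symm) (div_pos hpos hQ).ne'
    refine smul_right_injective _ h5 ?_
    simp only
    rw [h3, smul_smul]
    congr 1
    field_simp
    ring

/-- Multiplicativity of the squared modulus in 1+(r-s)ζ_s = (1+(r-t)ζ_t)(1+(t-s)ζ_s). -/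
lemma growthSq_mul (H : OrderedPair a b ξ₀ η₁) {r : ℝ} (hs : s ∈ Ioo (0 : ℝ) 1)
    (ht : t ∈ Ioo (0 : ℝ) 1) (hx : x ∈ contactSet ξ₀ η₁ s) :
    growthSq ξ₀ t r (transport ξ₀ s t x) * growthSq ξ₀ s t x = growthSq ξ₀ s r x := by
  obtain ⟨h1, h2⟩ := H.fwd_transport hs ht hx
  have hQ := growthSq_pos (H.weight_pos hs ht x).ne'
  have hdef' : growthSq ξ₀ t r (transport ξ₀ s t x) =
      (1 + 2 * (r - t) * (fwd ξ₀ t (transport ξ₀ s t x)).toReal) ^ 2 +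
      (r - t) ^ 2 * ‖fwdGradient ξ₀ t (transport ξ₀ s t x)‖ ^ 2 := rfl
  have hdef'' : growthSq ξ₀ s r x = (1 + 2 * (r - s) * (fwd ξ₀ s x).toReal) ^ 2 +
      (r - s) ^ 2 * ‖fwdGradient ξ₀ s x‖ ^ 2 := rfl
  rw [hdef', hdef'', h1, h2, norm_smul, Real.norm_eq_abs, abs_of_pos (inv_pos.2 hQ)]
  have hdef : growthSq ξ₀ s t x = (1 + 2 * (t - s) * (fwd ξ₀ s x).toReal) ^ 2 +
      (t - s) ^ 2 * ‖fwdGradient ξ₀ s x‖ ^ 2 := rfl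
  set Q := growthSq ξ₀ s t x
  set h := (fwd ξ₀ s x).toReal
  set G := ‖fwdGradient ξ₀ s x‖
  have e1 : (1 + 2 * (r - t) * ((2 * h + (t - s) * (4 * h ^ 2 + G ^ 2)) / (2 * Q))) =
      (Q + (r - t) * (2 * h + (t - s) * (4 * h ^ 2 + G ^ 2))) / Q := by
    field_simp
  rw [e1]
  have e2 : (((Q + (r - t) * (2 * h + (t - s) * (4 * h ^ 2 + G ^ 2))) / Q) ^ 2 +
      (r - t) ^ 2 * (Q⁻¹ * G) ^ 2) * Q =
      ((Q + (r - t) * (2 * h + (t - s) * (4 * h ^ 2 + G ^ 2))) ^ 2 + (r - t) ^ 2 * G ^ 2) / Q := by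
    field_simp
  rw [e2, div_eq_iff hQ.ne', hdef]
  ring

lemma transport_transport (H : OrderedPair a b ξ₀ η₁) {r : ℝ} (hs : s ∈ Ioo (0 : ℝ) 1)
    (ht : t ∈ Ioo (0 : ℝ) 1) (hr : r ∈ Icc (0 : ℝ) 1) (hx : x ∈ contactSet ξ₀ η₁ s) :
    transport ξ₀ t r (transport ξ₀ s t x) = transport ξ₀ s r x := by
  obtain ⟨h1, h2⟩ := H.fwd_transport hs ht hx
  -- Stationary points are set aside because only there can the weights towards r vanish.
  rcases eq_or_ne (fwdGradient ξ₀ s x) 0 with hg | hg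
  · have h3 := transport_of_gradient_eq_zero t hg
    rw [h3, hg, smul_zero] at h2
    rw [h3, transport_of_gradient_eq_zero r h2, transport_of_gradient_eq_zero r hg]
  have hpos := H.weight_pos hs ht x
  have hQ := growthSq_pos hpos.ne'
  have hG : 0 < ‖fwdGradient ξ₀ s x‖ := norm_pos_iff.2 hg
  have hposr := H.weight_pos_of_gradient_ne_zero hs hr hx hg
  have hpost := H.weight_pos_of_gradient_ne_zero ht hr (H.transport_mem hs ht hx)
    (by rw [h2]; exact smul_ne_zero (inv_pos.2 hQ).ne' hg)
  have hdef : growthSq ξ₀ s t x = (1 + 2 * (t - s) * (fwd ξ₀ s x).toReal) ^ 2 +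
      (t - s) ^ 2 * ‖fwdGradient ξ₀ s x‖ ^ 2 := rfl
  have eT : transport ξ₀ t r (transport ξ₀ s t x) = transport ξ₀ s t x +
      arctanVec (((r - t) / (1 + 2 * (r - t) * (fwd ξ₀ t (transport ξ₀ s t x)).toReal)) •
        fwdGradient ξ₀ t (transport ξ₀ s t x)) := rfl
  rw [eT, h1, h2, transport, transport, smul_smul, arctanVec_smul, arctanVec_smul,
    arctanVec_smul, add_assoc, ← add_smul, ← add_div]
  rw [h1] at hpost
  set Q := growthSq ξ₀ s t x
  set h := (fwd ξ₀ s x).toReal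
  set G := ‖fwdGradient ξ₀ s x‖
  have e1 : (1 + 2 * (r - t) * ((2 * h + (t - s) * (4 * h ^ 2 + G ^ 2)) / (2 * Q))) =
      (Q + (r - t) * (2 * h + (t - s) * (4 * h ^ 2 + G ^ 2))) / Q := by
    field_simp
  rw [e1] at hpost ⊢
  have hD2 := (div_pos_iff_of_pos_right hQ).1 hpost
  set D1 := 1 + 2 * (t - s) * h with hD1
  set D2 := Q + (r - t) * (2 * h + (t - s) * (4 * h ^ 2 + G ^ 2)) with hD2def
  set D3 := 1 + 2 * (r - s) * h with hD3
  -- `i1` is the real part of the product identity for 1+(r-s)ζ_s, multiplied by Q; `i2` is its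
  -- imaginary part, multiplied by Q and divided by G.
  have i1 : D1 * D2 - (t - s) * (r - t) * G ^ 2 = Q * D3 := by
    rw [hD2def, hdef, hD1, hD3]; ring
  have i2 : (t - s) * D2 + (r - t) * D1 = Q * (r - s) := by
    rw [hD2def, hdef, hD1]; ring
  have e2 : (r - t) / (D2 / Q) * Q⁻¹ * G = (r - t) * G / D2 := by field_simp
  have i3 : 1 - (t - s) / D1 * G * ((r - t) * G / D2) = Q * D3 / (D1 * D2) := by
    rw [← i1]; field_simp
  -- All three factors have positive real part, so the arctangents add without a correction by π.
  have hlt : (t - s) / D1 * G * ((r - t) * G / D2) < 1 := by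
    have : 0 < Q * D3 / (D1 * D2) := by positivity
    linarith
  rw [e2, Real.arctan_add hlt, i3]
  congr 4
  have i4 : (t - s) / D1 * G + (r - t) * G / D2 = Q * (r - s) * G / (D1 * D2) := by
    rw [← i2]; field_simp
  rw [i4]
  field_simp

end OrderedPair

/-- The growth factor along the transport. -/
noncomputable def growth {d : ℕ} (ξ₀ : EuclideanSpace ℝ (Fin d) → EReal) (s t : ℝ)
    (x : EuclideanSpace ℝ (Fin d)) : ℝ := √(growthSq ξ₀ s t x)

/-- Triangle inequality in the Euclidean plane, with the norm of the difference bounded by its ℓ¹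
norm. -/
lemma sqrt_add_sq_le (w w' g g' : ℝ) :
    √(w ^ 2 + g ^ 2) ≤ √(w' ^ 2 + g' ^ 2) + (|w - w'| + |g - g'|) := by
  rw [Real.sqrt_le_left (by positivity)]
  have h0 : 0 ≤ w' ^ 2 + g' ^ 2 := by positivity
  have h1 : |w'| ≤ √(w' ^ 2 + g' ^ 2) := Real.abs_le_sqrt (by linarith [sq_nonneg g'])
  have h2 : |g'| ≤ √(w' ^ 2 + g' ^ 2) := Real.abs_le_sqrt (by linarith [sq_nonneg w'])
  have h3 := Real.sq_sqrt h0
  have h4 : w ^ 2 ≤ (|w'| + |w - w'|) ^ 2 := by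
    rw [← sq_abs w]
    refine pow_le_pow_left₀ (abs_nonneg _) ?_ 2
    have := abs_add_le w' (w - w')
    rwa [add_sub_cancel] at this
  have h5 : g ^ 2 ≤ (|g'| + |g - g'|) ^ 2 := by
    rw [← sq_abs g]
    refine pow_le_pow_left₀ (abs_nonneg _) ?_ 2
    have := abs_add_le g' (g - g')
    rwa [add_sub_cancel] at this
  have h6 := sq_abs w'
  have h7 := sq_abs g'
  have h8 := mul_le_mul_of_nonneg_right h1 (abs_nonneg (w - w'))
  have h9 := mul_le_mul_of_nonneg_right h2 (abs_nonneg (g - g'))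
  have h10 := mul_nonneg (abs_nonneg (w - w')) (abs_nonneg (g - g'))
  nlinarith

/-- The order `⊤` is the analytic one, strictly above C^∞. -/
lemma analyticAt_arctan (x : ℝ) : AnalyticAt ℝ Real.arctan x :=
  (Real.contDiff_arctan (n := ⊤)).contDiffAt.analyticAt

lemma analyticAt_sqrt {x : ℝ} (hx : x ≠ 0) : AnalyticAt ℝ Real.sqrt x :=
  (Real.contDiffAt_sqrt (n := ⊤) hx).analyticAt

namespace OrderedPair

variable {d : ℕ} {a b : ℝ} {ξ₀ η₁ : EuclideanSpace ℝ (Fin d) → EReal} {s t : ℝ}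
  {x y : EuclideanSpace ℝ (Fin d)}

/-! ### Analyticity in time -/

/-- If the gradient vanishes the curve is constant. Otherwise the weight is positive on all of
[0,1], end points included, and the formula is a composition of analytic functions. -/
lemma analyticOn_transport (H : OrderedPair a b ξ₀ η₁) (hs : s ∈ Ioo (0 : ℝ) 1)
    (hx : x ∈ contactSet ξ₀ η₁ s) : AnalyticOn ℝ (fun t => transport ξ₀ s t x) (Icc 0 1) := by
  rcases eq_or_ne (fwdGradient ξ₀ s x) 0 with hg | hg
  · simp only [transport_of_gradient_eq_zero _ hg]
    exact analyticOn_const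
  · intro t ht
    refine AnalyticAt.analyticWithinAt ?_
    have hpos := H.weight_pos_of_gradient_ne_zero hs ht hx hg
    simp only [transport, arctanVec_smul]
    have h1 : AnalyticAt ℝ (fun t => (t - s) / (1 + 2 * (t - s) * (fwd ξ₀ s x).toReal) *
        ‖fwdGradient ξ₀ s x‖) t := by
      refine AnalyticAt.mul (AnalyticAt.div (by fun_prop) (by fun_prop) hpos.ne') analyticAt_const
    have h2 := (analyticAt_arctan _).comp h1
    have h3 := (h2.div analyticAt_const (norm_pos_iff.2 hg).ne').smul
      (analyticAt_const (v := fwdGradient ξ₀ s x))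
    exact analyticAt_const.add h3

lemma growth_of_gradient_eq_zero (H : OrderedPair a b ξ₀ η₁) (hs : s ∈ Ioo (0 : ℝ) 1)
    (ht : t ∈ Icc (0 : ℝ) 1) (hg : fwdGradient ξ₀ s x = 0) :
    growth ξ₀ s t x = 1 + 2 * (t - s) * (fwd ξ₀ s x).toReal := by
  rw [growth, growthSq, hg, norm_zero, zero_pow two_ne_zero, mul_zero, add_zero,
    Real.sqrt_sq (H.weight_nonneg hs ht x)]

lemma analyticOn_growth (H : OrderedPair a b ξ₀ η₁) (hs : s ∈ Ioo (0 : ℝ) 1)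
    (hx : x ∈ contactSet ξ₀ η₁ s) : AnalyticOn ℝ (fun t => growth ξ₀ s t x) (Icc 0 1) := by
  rcases eq_or_ne (fwdGradient ξ₀ s x) 0 with hg | hg
  · refine AnalyticOn.congr (f := fun t => 1 + 2 * (t - s) * (fwd ξ₀ s x).toReal) ?_
      fun t ht => H.growth_of_gradient_eq_zero hs ht hg
    exact fun t _ => AnalyticAt.analyticWithinAt (by fun_prop)
  · intro t ht
    have hpos := H.weight_pos_of_gradient_ne_zero hs ht hx hg
    refine AnalyticAt.analyticWithinAt ?_
    have h1 : AnalyticAt ℝ (fun t => growthSq ξ₀ s t x) t := by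
      unfold growthSq
      fun_prop
    exact AnalyticAt.comp (f := fun t => growthSq ξ₀ s t x)
      (analyticAt_sqrt (growthSq_pos hpos.ne').ne') h1

/-! ### Lipschitz continuity in space -/

lemma abs_toReal_fwd_sub_le (H : OrderedPair a b ξ₀ η₁) (hs : s ∈ Ioo (0 : ℝ) 1)
    (x y : EuclideanSpace ℝ (Fin d)) :
    |(fwd ξ₀ s x).toReal - (fwd ξ₀ s y).toReal| ≤ Lam a s * ‖x - y‖ := by
  have h := (H.regular hs).abs_toReal_sub_le x y
  rw [dist_eq_norm] at h
  rw [Lam, show 2 * a * s = 2 * s * a by ring]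
  exact h

lemma exists_lipschitzOnWith_transport (H : OrderedPair a b ξ₀ η₁) (hs : s ∈ Ioo (0 : ℝ) 1)
    (t : ℝ) {S : Set (EuclideanSpace ℝ (Fin d))} {δ : ℝ} (hδ : 0 < δ)
    (hS : S ⊆ contactSet ξ₀ η₁ s)
    (hw : ∀ x ∈ S, δ ≤ 1 + 2 * (t - s) * (fwd ξ₀ s x).toReal) :
    ∃ K, LipschitzOnWith K (transport ξ₀ s t) S := by
  have hA := Lam_nonneg hs H.neg_half_le
  have hB := Lam_nonneg (one_sub_mem_Ioo hs) H.neg_half_le'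
  set A := Lam a s
  set B := Lam b (1 - s)
  set C := 1 + 3 * (|t - s| / δ * (2 * (A + B)) +
    |t - s| * (2 * |t - s| * A) / δ ^ 2 * A) with hC
  have hC0 : 0 ≤ C := by positivity
  refine ⟨C.toNNReal, LipschitzOnWith.of_dist_le_mul fun x hx y hy => ?_⟩
  rw [Real.coe_toNNReal _ hC0, dist_eq_norm, dist_eq_norm]
  obtain ⟨-, -, hgy, -⟩ := H.fwdGradient_spec hs (hS hy)
  have hg := H.norm_fwdGradient_sub_le hs (hS hx) (hS hy)
  have hf := H.abs_toReal_fwd_sub_le hs x y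
  have hwx := hw x hx
  have hwy := hw y hy
  unfold transport
  set g := fwdGradient ξ₀ s x
  set g' := fwdGradient ξ₀ s y
  set w := 1 + 2 * (t - s) * (fwd ξ₀ s x).toReal with hwdef
  set w' := 1 + 2 * (t - s) * (fwd ξ₀ s y).toReal with hwdef'
  have hw0 : 0 < w := hδ.trans_le hwx
  have hw0' : 0 < w' := hδ.trans_le hwy
  have hww : |w' - w| ≤ 2 * |t - s| * A * ‖x - y‖ := by
    have e : w' - w = -(2 * (t - s)) * ((fwd ξ₀ s x).toReal - (fwd ξ₀ s y).toReal) := by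
      rw [hwdef, hwdef']; ring
    rw [e, abs_mul, abs_neg, abs_mul, abs_two, mul_assoc _ A]
    gcongr
  -- Separates the variation of the gradient from that of the weight. The lower bound δ controls
  -- both denominators.
  have e1 : ((t - s) / w) • g - ((t - s) / w') • g' =
      ((t - s) / w) • (g - g') + ((t - s) * (w' - w) / (w * w')) • g' := by
    match_scalars
    · field_simp
    · field_simp; ring
  have b1 : ‖((t - s) / w) • (g - g')‖ ≤ |t - s| / δ * (2 * (A + B) * ‖x - y‖) := by
    rw [norm_smul, Real.norm_eq_abs, abs_div, abs_of_pos hw0]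
    gcongr
  have b2 : ‖((t - s) * (w' - w) / (w * w')) • g'‖ ≤
      |t - s| * (2 * |t - s| * A * ‖x - y‖) / δ ^ 2 * A := by
    rw [norm_smul, Real.norm_eq_abs, abs_div, abs_mul, abs_of_pos (mul_pos hw0 hw0'), sq]
    gcongr
  have b3 := norm_arctanVec_sub_le (((t - s) / w) • g) (((t - s) / w') • g')
  have b4 := norm_add_le (((t - s) / w) • (g - g')) (((t - s) * (w' - w) / (w * w')) • g')
  rw [← e1] at b4
  rw [add_sub_add_comm]
  refine (norm_add_le _ _).trans ?_
  have e2 : C * ‖x - y‖ = ‖x - y‖ + 3 * (|t - s| / δ * (2 * (A + B) * ‖x - y‖) +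
      |t - s| * (2 * |t - s| * A * ‖x - y‖) / δ ^ 2 * A) := by
    rw [hC]; ring
  rw [e2]
  linarith

lemma lipschitzOnWith_transport (H : OrderedPair a b ξ₀ η₁) (hs : s ∈ Ioo (0 : ℝ) 1)
    (ht : t ∈ Ioo (0 : ℝ) 1) :
    ∃ K, LipschitzOnWith K (transport ξ₀ s t) (contactSet ξ₀ η₁ s) :=
  H.exists_lipschitzOnWith_transport hs t (min_pos hs ht) Subset.rfl
    fun x _ => H.min_le_weight hs t x

lemma locallyLipschitzOn_transport (H : OrderedPair a b ξ₀ η₁) (hs : s ∈ Ioo (0 : ℝ) 1) (t : ℝ)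
    {S : Set (EuclideanSpace ℝ (Fin d))} (hS : S ⊆ contactSet ξ₀ η₁ s)
    (hw : ∀ x ∈ S, 0 < 1 + 2 * (t - s) * (fwd ξ₀ s x).toReal) :
    LocallyLipschitzOn S (transport ξ₀ s t) := by
  intro x hx
  have hcont : Continuous fun y => 1 + 2 * (t - s) * (fwd ξ₀ s y).toReal :=
    continuous_const.add (continuous_const.mul (H.continuous_toReal_fwd hs))
  have hpos := hw x hx
  obtain ⟨K, hK⟩ := H.exists_lipschitzOnWith_transport hs t (half_pos hpos)
    (S := S ∩ {y | (1 + 2 * (t - s) * (fwd ξ₀ s x).toReal) / 2 <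
      1 + 2 * (t - s) * (fwd ξ₀ s y).toReal}) (fun y hy => hS hy.1) (fun y hy => hy.2.le)
  exact ⟨K, _, Filter.inter_mem self_mem_nhdsWithin (mem_nhdsWithin_of_mem_nhds
    (hcont.continuousAt.eventually_const_lt (half_lt_self hpos))), hK⟩

lemma growth_sub_le (H : OrderedPair a b ξ₀ η₁) (hs : s ∈ Ioo (0 : ℝ) 1) (t : ℝ)
    (hx : x ∈ contactSet ξ₀ η₁ s) (hy : y ∈ contactSet ξ₀ η₁ s) :
    growth ξ₀ s t x - growth ξ₀ s t y ≤
      |t - s| * (4 * Lam a s + 2 * Lam b (1 - s)) * ‖x - y‖ := by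
  have hg := H.norm_fwdGradient_sub_le hs hx hy
  have hf := H.abs_toReal_fwd_sub_le hs x y
  have h := sqrt_add_sq_le (1 + 2 * (t - s) * (fwd ξ₀ s x).toReal)
    (1 + 2 * (t - s) * (fwd ξ₀ s y).toReal) ((t - s) * ‖fwdGradient ξ₀ s x‖)
    ((t - s) * ‖fwdGradient ξ₀ s y‖)
  have e1 : 1 + 2 * (t - s) * (fwd ξ₀ s x).toReal - (1 + 2 * (t - s) * (fwd ξ₀ s y).toReal) =
      (t - s) * (2 * ((fwd ξ₀ s x).toReal - (fwd ξ₀ s y).toReal)) := by ring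
  rw [mul_pow, mul_pow, e1, ← mul_sub, abs_mul, abs_mul, abs_mul, abs_two, ← mul_add] at h
  rw [growth, growth, growthSq, growthSq]
  have h2 := (abs_norm_sub_norm_le (fwdGradient ξ₀ s x) (fwdGradient ξ₀ s y)).trans hg
  have h3 := mul_le_mul_of_nonneg_left (by linarith :
    2 * |(fwd ξ₀ s x).toReal - (fwd ξ₀ s y).toReal| +
      |‖fwdGradient ξ₀ s x‖ - ‖fwdGradient ξ₀ s y‖| ≤
      (4 * Lam a s + 2 * Lam b (1 - s)) * ‖x - y‖) (abs_nonneg (t - s))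
  rw [← mul_assoc] at h3
  linarith

lemma lipschitzOnWith_growth (H : OrderedPair a b ξ₀ η₁) (hs : s ∈ Ioo (0 : ℝ) 1) (t : ℝ) :
    ∃ K, LipschitzOnWith K (growth ξ₀ s t) (contactSet ξ₀ η₁ s) := by
  have hA := Lam_nonneg hs H.neg_half_le
  have hB := Lam_nonneg (one_sub_mem_Ioo hs) H.neg_half_le'
  refine ⟨(|t - s| * (4 * Lam a s + 2 * Lam b (1 - s))).toNNReal,
    LipschitzOnWith.of_dist_le_mul fun x hx y hy => ?_⟩
  rw [Real.coe_toNNReal _ (by positivity), Real.dist_eq, dist_eq_norm, abs_le]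
  have h1 := H.growth_sub_le hs t hx hy
  have h2 := H.growth_sub_le hs t hy hx
  rw [norm_sub_rev y x] at h2
  constructor <;> linarith

lemma exists_abs_growth_le (H : OrderedPair a b ξ₀ η₁) (hs : s ∈ Ioo (0 : ℝ) 1) (t : ℝ) :
    ∃ B : ℝ, ∀ x ∈ contactSet ξ₀ η₁ s, |growth ξ₀ s t x| ≤ B := by
  have hs0 := hs.1
  have hs1 : 0 < 1 - s := sub_pos.2 hs.2
  refine ⟨|t - s| * (2 * (1 / (2 * s) + 1 / (2 * (1 - s))) + Lam a s) + 1, fun x hx => ?_⟩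
  obtain ⟨-, -, hg, -⟩ := H.fwdGradient_spec hs hx
  have hf : |(fwd ξ₀ s x).toReal| ≤ 1 / (2 * s) + 1 / (2 * (1 - s)) := by
    have h1 := H.toReal_fwd_le hs x
    have h2 := H.le_toReal_fwd hs x
    have h3 : 0 < 1 / (2 * s) := by positivity
    have h4 : 0 < 1 / (2 * (1 - s)) := by positivity
    rw [neg_div] at h2
    rw [abs_le]
    constructor <;> linarith
  have h := sqrt_add_sq_le (1 + 2 * (t - s) * (fwd ξ₀ s x).toReal) 1
    ((t - s) * ‖fwdGradient ξ₀ s x‖) 0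
  have e1 : 1 + 2 * (t - s) * (fwd ξ₀ s x).toReal - 1 = (t - s) * (2 * (fwd ξ₀ s x).toReal) := by
    ring
  have e2 : √((1 : ℝ) ^ 2 + 0 ^ 2) = 1 := by norm_num
  rw [mul_pow, e1, e2, sub_zero, abs_mul, abs_mul, abs_mul, abs_two, abs_norm, ← mul_add] at h
  rw [abs_of_nonneg (by rw [growth]; positivity), growth, growthSq]
  refine h.trans ?_
  rw [add_comm]
  gcongr

/-! ### Growth factors as quotients -/

lemma eq_top_of_half (H : OrderedPair a b ξ₀ η₁) (hx : η₁ x = ((1 / 2 : ℝ) : EReal)) :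
    ξ₀ x = ⊤ := by
  have h := H.bwd_le_fwd (t := 0) ⟨le_rfl, zero_le_one⟩ x
  rw [bwd_eq_neg, sub_zero, fwd_one_of_neg_half (neg_half_swap_iff.2 hx), fwd_zero,
    EReal.neg_bot] at h
  exact top_le_iff.1 h

lemma growth_quotient (H : OrderedPair a b ξ₀ η₁) (hs : s ∈ Ioo (0 : ℝ) 1)
    (ht : t ∈ Icc (0 : ℝ) 1) (hx : x ∈ contactSet ξ₀ η₁ s) :
    0 < 1 - ((2 * (t - s) : ℝ) : EReal) * fwd ξ₀ t (transport ξ₀ s t x) ∧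
    ((growthSq ξ₀ s t x : ℝ) : EReal) = (1 + ((2 * (t - s) : ℝ) : EReal) * fwd ξ₀ s x) /
      (1 - ((2 * (t - s) : ℝ) : EReal) * fwd ξ₀ t (transport ξ₀ s t x)) := by
  have hnum : 1 + ((2 * (t - s) : ℝ) : EReal) * fwd ξ₀ s x =
      ((1 + 2 * (t - s) * (fwd ξ₀ s x).toReal : ℝ) : EReal) := by
    rw [← one_add_mul_coe, H.coe_fwd hs]
  rw [hnum]
  rcases le_or_gt (1 + 2 * (t - s) * (fwd ξ₀ s x).toReal) 0 with hw | hw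
  · have hw0 : 1 + 2 * (t - s) * (fwd ξ₀ s x).toReal = 0 :=
      le_antisymm hw (H.weight_nonneg hs ht x)
    have hst := H.weight_eq_zero hs ht hx hw
    have hg : fwdGradient ξ₀ s x = 0 := by
      refine H.fwdGradient_of_stationary hs ?_
      rcases hst with h | h
      · exact Or.inr h.2
      · exact Or.inl h.2
    -- The degenerate case 0/∞: x is fixed, and ξ₀ = +∞ on Ξ⁺ or ξ₁ = -∞ on Ξ⁻ makes the denominator
    -- +∞.
    have hden : 1 - ((2 * (t - s) : ℝ) : EReal) * fwd ξ₀ t (transport ξ₀ s t x) = ⊤ := by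
      rw [transport_of_gradient_eq_zero t hg]
      rcases hst with ⟨rfl, h⟩ | ⟨rfl, h⟩
      · rw [fwd_zero, H.eq_top_of_half h, EReal.coe_mul_top_of_neg (by linarith [hs.1]),
          sub_eq_add_neg, EReal.neg_bot]
        exact EReal.coe_add_top 1
      · rw [fwd_one_of_neg_half h, EReal.coe_mul_bot_of_pos (by linarith [hs.2]),
          sub_eq_add_neg, EReal.neg_bot]
        exact EReal.coe_add_top 1
    rw [hden, growthSq, hw0, hg]
    simp
  · have hQ := growthSq_pos hw.ne'
    have hval : ∃ u : ℝ, fwd ξ₀ t (transport ξ₀ s t x) = (u : EReal) ∧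
        1 - 2 * (t - s) * u = (1 + 2 * (t - s) * (fwd ξ₀ s x).toReal) / growthSq ξ₀ s t x := by
      rcases eq_or_ne t s with rfl | hts
      · refine ⟨(fwd ξ₀ t x).toReal, ?_, ?_⟩
        · rw [transport_self, H.coe_fwd hs]
        · simp [growthSq]
      · obtain ⟨-, -, -, hbot, htop, hprod⟩ := H.transport_spec hs ht hts hx hw
        refine ⟨(fwd ξ₀ t (transport ξ₀ s t x)).toReal, (EReal.coe_toReal htop hbot).symm, ?_⟩
        rw [cosTrunc_transport_sq hw.ne'] at hprod
        refine mul_right_cancel₀ hw.ne' ?_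
        rw [hprod]
        ring
    obtain ⟨u, hu, hu'⟩ := hval
    have hden : 1 - ((2 * (t - s) : ℝ) : EReal) * (u : EReal) =
        (((1 + 2 * (t - s) * (fwd ξ₀ s x).toReal) / growthSq ξ₀ s t x : ℝ) : EReal) := by
      rw [← hu']
      push_cast
      rfl
    rw [hu, hden, ← EReal.coe_div]
    refine ⟨by exact_mod_cast div_pos hw hQ, ?_⟩
    congr 1
    field_simp

/-! ### Closedness of the contact sets at the end points -/

/-- Joint lower semicontinuity of the cost in both points, wherever the weight stays away from zero.
-/
lemma eventually_le_cost {x y : EuclideanSpace ℝ (Fin d)} {ξ : EuclideanSpace ℝ (Fin d) → EReal}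
    (hξ : LowerSemicontinuous ξ) {τ c r : ℝ} (hτ : 0 < τ) (hc : 0 < 1 + 2 * τ * c)
    (hcy : (c : EReal) ≤ ξ y)
    (hr : r < (1 - cosTrunc (dist x y) ^ 2 * invWeight τ ξ y) / (2 * τ)) :
    ∀ᶠ z : EuclideanSpace ℝ (Fin d) × EuclideanSpace ℝ (Fin d) in nhds (x, y),
      (r : EReal) ≤ hopfLaxCost τ ξ z.1 z.2 := by
  rw [lt_div_iff₀ (by positivity)] at hr
  set k := invWeight τ ξ y with hk
  have hk0 : 0 ≤ k := invWeight_nonneg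
  -- Half of the slack in `hr`: enlarging the inverse weight by ε uses at most ε because cos² ≤ 1.
  set ε := (1 - cosTrunc (dist x y) ^ 2 * k - r * (2 * τ)) / 2 with hε
  have hε0 : 0 < ε := by rw [hε]; linarith
  set m := ((k + ε)⁻¹ - 1) / (2 * τ) with hm
  have hm1 : 1 + 2 * τ * m = (k + ε)⁻¹ := by rw [hm]; field_simp; ring
  have hm0 : 0 < 1 + 2 * τ * m := by rw [hm1]; positivity
  have hlt : (m : EReal) < ξ y := by
    rcases eq_top_or_eq_coe hcy with ht | ⟨u, hu, hcu⟩
    · rw [ht]; exact EReal.coe_lt_top _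
    · rw [hu, EReal.coe_lt_coe_iff, hm, div_lt_iff₀ (by positivity)]
      have h1 : 0 < 1 + 2 * τ * u := by nlinarith
      have h2 : k = (1 + 2 * τ * u)⁻¹ := invWeight_of_coe hu h1.le
      have h3 : (k + ε)⁻¹ < 1 + 2 * τ * u := by
        rw [inv_lt_comm₀ (by positivity) h1, ← h2]
        linarith
      linarith
  have hlim : r < (1 - cosTrunc (dist x y) ^ 2 * (k + ε)) / (2 * τ) := by
    rw [lt_div_iff₀ (by positivity)]
    have := mul_le_mul_of_nonneg_right (cosTrunc_sq_le_one (dist x y)) hε0.le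
    have h2 : 2 * ε = 1 - cosTrunc (dist x y) ^ 2 * k - r * (2 * τ) := by rw [hε]; ring
    linarith
  have hcont : Continuous fun z : EuclideanSpace ℝ (Fin d) × EuclideanSpace ℝ (Fin d) =>
      (1 - cosTrunc (dist z.1 z.2) ^ 2 * (k + ε)) / (2 * τ) := by fun_prop
  have h1 : ∀ᶠ z : EuclideanSpace ℝ (Fin d) × EuclideanSpace ℝ (Fin d) in nhds (x, y),
      r < (1 - cosTrunc (dist z.1 z.2) ^ 2 * (k + ε)) / (2 * τ) :=
    (hcont.tendsto (x, y)).eventually (lt_mem_nhds hlim)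
  have hev : ∀ᶠ z in nhds y, (m : EReal) < ξ z := hξ y _ hlt
  have h2 : ∀ᶠ z : EuclideanSpace ℝ (Fin d) × EuclideanSpace ℝ (Fin d) in nhds (x, y),
      (m : EReal) < ξ z.2 := (continuous_snd.tendsto (x, y)).eventually hev
  filter_upwards [h1, h2] with z hz1 hz2
  rw [hopfLaxCost_eq hτ hm0 hz2.le, EReal.coe_le_coe_iff]
  refine hz1.le.trans ?_
  have := invWeight_le hτ hm0 hz2.le
  rw [hm1, inv_inv] at this
  gcongr

/-- At time 1 the infimum may be -∞ or not attained, so lower bounds on the cost are found near each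
pair (x,y) and made uniform by compactness. The only obstruction is a zero weight at distance
exactly π/2. -/
lemma lowerSemicontinuousAt_fwd_one (H : OrderedPair a b ξ₀ η₁)
    (hx : ∀ y, ξ₀ y = ((-1 / 2 : ℝ) : EReal) → dist x y ≠ Real.pi / 2) :
    LowerSemicontinuousAt (fwd ξ₀ 1) x := by
  intro w hw
  obtain ⟨r, hwr, hr⟩ := EReal.lt_iff_exists_real_btwn.1 hw
  have key : ∀ y ∈ closedBall x (Real.pi / 2 + 1),
      ∀ᶠ z : EuclideanSpace ℝ (Fin d) × EuclideanSpace ℝ (Fin d) in nhds (x, y),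
        dist z.1 z.2 < Real.pi / 2 → (r : EReal) ≤ hopfLaxCost 1 ξ₀ z.1 z.2 := by
    intro y _
    rcases lt_or_ge (Real.pi / 2) (dist x y) with hd | hd
    · have hcont : Continuous fun z : EuclideanSpace ℝ (Fin d) × EuclideanSpace ℝ (Fin d) =>
        dist z.1 z.2 := by fun_prop
      exact ((hcont.tendsto (x, y)).eventually (lt_mem_nhds hd)).mono
        fun z hz hz' => absurd hz' (not_lt.2 (le_of_lt hz))
    have hne : ξ₀ y ≠ ((-1 / 2 : ℝ) : EReal) := by
      intro h
      have hlt : dist x y < Real.pi / 2 := lt_of_le_of_ne hd (hx y h)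
      have := hr.trans_le (hopfLax_le_cost one_pos hlt)
      rw [hopfLaxCost_of_eq_zero one_pos h (by norm_num) hlt] at this
      exact not_lt_bot this
    have hge : ((-1 / 2 : ℝ) : EReal) ≤ ξ₀ y :=
      (EReal.coe_le_coe_iff.2 H.neg_half_le).trans (H.le_fwd y)
    obtain ⟨c, hc1, hc2⟩ := EReal.lt_iff_exists_real_btwn.1 (lt_of_le_of_ne hge hne.symm)
    rw [EReal.coe_lt_coe_iff] at hc1
    have hc : 0 < 1 + 2 * 1 * c := by linarith
    have hlt : r < (1 - cosTrunc (dist x y) ^ 2 * invWeight 1 ξ₀ y) / (2 * 1) := by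
      rcases hd.lt_or_eq with hd | hd
      · have := hr.trans_le (hopfLax_le_cost one_pos hd)
        rw [hopfLaxCost_eq one_pos hc hc2.le] at this
        exact_mod_cast this
      -- On the boundary sphere the cosine vanishes, so the limiting cost is the universal upper
      -- bound 1/2 of ξ₁.
      · have := hr.trans_le (hopfLax_le one_pos x)
        rw [EReal.coe_lt_coe_iff] at this
        rw [hd, cosTrunc_of_ge le_rfl]
        linarith
    exact (eventually_le_cost H.lsc one_pos hc hc2.le hlt).mono fun z hz _ => hz
  have hall := (isCompact_closedBall x (Real.pi / 2 + 1)).eventually_forall_of_forall_eventually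
    (P := fun x' y => dist x' y < Real.pi / 2 → (r : EReal) ≤ hopfLaxCost 1 ξ₀ x' y) key
  filter_upwards [hall, ball_mem_nhds x one_pos] with x' hx' hb
  refine hwr.trans_le (HKFlow.le_hopfLax one_pos fun y hy => hx' y ?_ hy)
  rw [mem_closedBall]
  have h1 := dist_triangle y x' x
  rw [mem_ball] at hb
  rw [dist_comm y x'] at h1
  linarith

/-- A gap at x persists nearby, by upper semicontinuity of η₁ and lower semicontinuity of ξ₁ at x,
so x cannot be a limit of contact points. -/
lemma mem_contactSet_one (H : OrderedPair a b ξ₀ η₁) (hcl : x ∈ closure (contactSet ξ₀ η₁ 1))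
    (hx : ∀ y, ξ₀ y = ((-1 / 2 : ℝ) : EReal) → dist x y ≠ Real.pi / 2) :
    x ∈ contactSet ξ₀ η₁ 1 := by
  refine le_antisymm (H.bwd_le_fwd ⟨zero_le_one, le_rfl⟩ x) (not_lt.1 fun hlt => ?_)
  obtain ⟨w, hw1, hw2⟩ := exists_between hlt
  rw [bwd_one] at hw1
  obtain ⟨y, hy, h1, h2⟩ := ((mem_closure_iff_frequently.1 hcl).and_eventually
    ((H.usc x w hw1).and (H.lowerSemicontinuousAt_fwd_one hx w hw2))).exists
  have h3 : bwd η₁ 1 y = fwd ξ₀ 1 y := hy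
  rw [bwd_one] at h3
  rw [← h3] at h2
  exact lt_asymm h1 h2

lemma mem_contactSet_zero (H : OrderedPair a b ξ₀ η₁) (hcl : x ∈ closure (contactSet ξ₀ η₁ 0))
    (hx : ∀ y, η₁ y = ((1 / 2 : ℝ) : EReal) → dist x y ≠ Real.pi / 2) :
    x ∈ contactSet ξ₀ η₁ 0 := by
  have h := H.swap.mem_contactSet_one (x := x)
  rw [contactSet_swap, sub_self] at h
  exact h hcl fun y hy => hx y (neg_half_swap_iff.1 hy)

end OrderedPair

end HKFlow

theorem theorem4p3 (d : ℕ) (a b : ℝ) (ha : -1 / 2 ≤ a) (hb : -1 / 2 ≤ b)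
    (ξ₀ η₁ : EuclideanSpace ℝ (Fin d) → EReal)
    (hξ₀ : LowerSemicontinuous ξ₀) (hξ₀a : ∀ x, (a : EReal) ≤ ξ₀ x)
    (hη₁ : UpperSemicontinuous η₁) (hη₁b : ∀ x, η₁ x ≤ ((-b : ℝ) : EReal))
    (hle : ∀ x, η₁ x ≤ HKFlow.hopfLax 1 ξ₀ x) :
    -- comparison of the two solutions
    (∀ t ∈ Icc (0 : ℝ) 1, ∀ x, HKFlow.bwd η₁ t x ≤ HKFlow.fwd ξ₀ t x) ∧
    -- closedness of the contact sets
    (∀ t ∈ Ioo (0 : ℝ) 1, IsClosed (HKFlow.contactSet ξ₀ η₁ t)) ∧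
    (∀ x ∈ closure (HKFlow.contactSet ξ₀ η₁ 1),
      (∀ y, ξ₀ y = ((-1 / 2 : ℝ) : EReal) → dist x y ≠ Real.pi / 2) →
        x ∈ HKFlow.contactSet ξ₀ η₁ 1) ∧
    (∀ x ∈ closure (HKFlow.contactSet ξ₀ η₁ 0),
      (∀ y, η₁ y = ((1 / 2 : ℝ) : EReal) → dist x y ≠ Real.pi / 2) →
        x ∈ HKFlow.contactSet ξ₀ η₁ 0) ∧
    -- finiteness of the solutions at intermediate times
    (∀ t ∈ Ioo (0 : ℝ) 1, ∀ x, HKFlow.fwd ξ₀ t x ≠ ⊥ ∧ HKFlow.fwd ξ₀ t x ≠ ⊤ ∧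
      HKFlow.bwd η₁ t x ≠ ⊥ ∧ HKFlow.bwd η₁ t x ≠ ⊤) ∧
    -- the sets `Ξ⁻` and `Ξ⁺`
    (∀ t ∈ Ico (0 : ℝ) 1, {x | ξ₀ x = ((-1 / 2 : ℝ) : EReal)} =
      {x ∈ HKFlow.contactSet ξ₀ η₁ t |
        HKFlow.fwd ξ₀ t x = ((-1 / (2 * (1 - t)) : ℝ) : EReal)}) ∧
    (∀ t ∈ Ioc (0 : ℝ) 1, {x | η₁ x = ((1 / 2 : ℝ) : EReal)} =
      {x ∈ HKFlow.contactSet ξ₀ η₁ t |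
        HKFlow.bwd η₁ t x = ((1 / (2 * t) : ℝ) : EReal)}) ∧
    (∀ t ∈ Icc (0 : ℝ) 1,
      {x | ξ₀ x = ((-1 / 2 : ℝ) : EReal)} ⊆ HKFlow.contactSet ξ₀ η₁ t ∧
      {x | η₁ x = ((1 / 2 : ℝ) : EReal)} ⊆ HKFlow.contactSet ξ₀ η₁ t) ∧
    ∃ (g : ℝ → EuclideanSpace ℝ (Fin d) → EuclideanSpace ℝ (Fin d))
      (T : ℝ → ℝ → EuclideanSpace ℝ (Fin d) → EuclideanSpace ℝ (Fin d))
      (q : ℝ → ℝ → EuclideanSpace ℝ (Fin d) → ℝ),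
      -- `g t x` is the unique vector `p` with the two-sided quadratic estimate
      (∀ t ∈ Ioo (0 : ℝ) 1, ∀ x ∈ HKFlow.contactSet ξ₀ η₁ t,
        ∀ p : EuclideanSpace ℝ (Fin d), p = g t x ↔ ∀ y,
          (HKFlow.fwd ξ₀ t y).toReal - (HKFlow.fwd ξ₀ t x).toReal
              - 1 / 2 * HKFlow.Lam a t * ‖x - y‖ ^ 2 ≤ inner ℝ p (y - x) ∧
          inner ℝ p (y - x) ≤ (HKFlow.bwd η₁ t y).toReal - (HKFlow.fwd ξ₀ t x).toReal
              + 1 / 2 * HKFlow.Lam b (1 - t) * ‖x - y‖ ^ 2) ∧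
      -- `g t x` is the common gradient
      (∀ t ∈ Ioo (0 : ℝ) 1, ∀ x ∈ HKFlow.contactSet ξ₀ η₁ t,
        HasGradientAt (fun y => (HKFlow.fwd ξ₀ t y).toReal) (g t x) x ∧
        HasGradientAt (fun y => (HKFlow.bwd η₁ t y).toReal) (g t x) x) ∧
      -- bounds on the gradient
      (∀ t ∈ Ioo (0 : ℝ) 1,
        (∃ B : ℝ, ∀ x ∈ HKFlow.contactSet ξ₀ η₁ t, ‖g t x‖ ≤ B) ∧
        (∀ x ∈ HKFlow.contactSet ξ₀ η₁ t, ∀ y ∈ HKFlow.contactSet ξ₀ η₁ t,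
          ‖g t x - g t y‖ ≤ 2 * (HKFlow.Lam a t + HKFlow.Lam b (1 - t)) * ‖x - y‖) ∧
        2 * (HKFlow.Lam a t + HKFlow.Lam b (1 - t)) ≤ 4 / (t * (1 - t)) ∧
        (∀ x, ξ₀ x = ((-1 / 2 : ℝ) : EReal) ∨ η₁ x = ((1 / 2 : ℝ) : EReal) → g t x = 0)) ∧
      -- unique optimal points
      (∀ s ∈ Ioo (0 : ℝ) 1, ∀ t ∈ Icc (0 : ℝ) 1, t ≠ s → ∀ x ∈ HKFlow.contactSet ξ₀ η₁ s,
        0 < 1 + 2 * (t - s) * (HKFlow.fwd ξ₀ s x).toReal →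
          HKFlow.optPoints ξ₀ η₁ s t x = {T s t x} ∧
          T s t x ∈ HKFlow.contactSet ξ₀ η₁ t ∧
          x ∈ HKFlow.optPoints ξ₀ η₁ t s (T s t x) ∧
          T s t x = x + HKFlow.arctanVec
            (((t - s) / (1 + 2 * (t - s) * (HKFlow.fwd ξ₀ s x).toReal)) • g s x) ∧
          HKFlow.fwd ξ₀ t (T s t x) ≠ ⊥ ∧ HKFlow.fwd ξ₀ t (T s t x) ≠ ⊤ ∧
          (1 - 2 * (t - s) * (HKFlow.fwd ξ₀ t (T s t x)).toReal) *
              (1 + 2 * (t - s) * (HKFlow.fwd ξ₀ s x).toReal) =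
            HKFlow.cosTrunc ‖x - T s t x‖ ^ 2) ∧
      -- stationary points, and the convention for `t = s`
      (∀ s ∈ Ioo (0 : ℝ) 1, ∀ t ∈ Icc (0 : ℝ) 1, ∀ x,
        ξ₀ x = ((-1 / 2 : ℝ) : EReal) ∨ η₁ x = ((1 / 2 : ℝ) : EReal) → T s t x = x) ∧
      (∀ s ∈ Ioo (0 : ℝ) 1, ∀ x, T s s x = x) ∧
      -- regularity of `T`
      (∀ s ∈ Ioo (0 : ℝ) 1, ∀ x ∈ HKFlow.contactSet ξ₀ η₁ s,
        AnalyticOn ℝ (fun t => T s t x) (Icc 0 1)) ∧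
      (∀ s ∈ Ioo (0 : ℝ) 1, ∀ t ∈ Ioo (0 : ℝ) 1,
        ∃ K, LipschitzOnWith K (T s t) (HKFlow.contactSet ξ₀ η₁ s)) ∧
      (∀ s ∈ Ioo (0 : ℝ) 1, LocallyLipschitzOn
        (HKFlow.contactSet ξ₀ η₁ s \ {x | η₁ x = ((1 / 2 : ℝ) : EReal)}) (T s 0)) ∧
      (∀ s ∈ Ioo (0 : ℝ) 1, LocallyLipschitzOn
        (HKFlow.contactSet ξ₀ η₁ s \ {x | ξ₀ x = ((-1 / 2 : ℝ) : EReal)}) (T s 1)) ∧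
      -- the two expressions for `q²`; the quotient is the extended real one, `0 / ∞ = 0`
      (∀ s ∈ Ioo (0 : ℝ) 1, ∀ t ∈ Icc (0 : ℝ) 1, ∀ x ∈ HKFlow.contactSet ξ₀ η₁ s,
        0 ≤ q s t x ∧
        0 < 1 - ((2 * (t - s) : ℝ) : EReal) * HKFlow.fwd ξ₀ t (T s t x) ∧
        ((q s t x ^ 2 : ℝ) : EReal) =
          (1 + ((2 * (t - s) : ℝ) : EReal) * HKFlow.fwd ξ₀ s x) /
            (1 - ((2 * (t - s) : ℝ) : EReal) * HKFlow.fwd ξ₀ t (T s t x)) ∧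
        q s t x ^ 2 =
          (1 + 2 * (t - s) * (HKFlow.fwd ξ₀ s x).toReal) ^ 2 + (t - s) ^ 2 * ‖g s x‖ ^ 2) ∧
      -- regularity and positivity of `q`
      (∀ s ∈ Ioo (0 : ℝ) 1, ∀ x ∈ HKFlow.contactSet ξ₀ η₁ s,
        AnalyticOn ℝ (fun t => q s t x) (Icc 0 1)) ∧
      (∀ s ∈ Ioo (0 : ℝ) 1, ∀ t ∈ Icc (0 : ℝ) 1,
        (∃ B : ℝ, ∀ x ∈ HKFlow.contactSet ξ₀ η₁ s, |q s t x| ≤ B) ∧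
        ∃ K, LipschitzOnWith K (q s t) (HKFlow.contactSet ξ₀ η₁ s)) ∧
      (∀ s ∈ Ioo (0 : ℝ) 1, ∀ t ∈ Icc (0 : ℝ) 1, ∀ x ∈ HKFlow.contactSet ξ₀ η₁ s,
        (t = 0 → η₁ x ≠ ((1 / 2 : ℝ) : EReal)) → (t = 1 → ξ₀ x ≠ ((-1 / 2 : ℝ) : EReal)) →
          0 < q s t x) ∧
      (∀ s ∈ Ioo (0 : ℝ) 1, ∀ t ∈ Icc (0 : ℝ) 1, ∀ x,
        ξ₀ x = ((-1 / 2 : ℝ) : EReal) ∨ η₁ x = ((1 / 2 : ℝ) : EReal) →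
          q s t x = 1 + 2 * (t - s) * (HKFlow.fwd ξ₀ s x).toReal) ∧
      -- concatenation
      (∀ t₀ ∈ Ioo (0 : ℝ) 1, ∀ t₁ ∈ Ioo (0 : ℝ) 1, ∀ t₂ ∈ Icc (0 : ℝ) 1,
        ∀ x ∈ HKFlow.contactSet ξ₀ η₁ t₀,
          T t₀ t₁ x ∈ HKFlow.contactSet ξ₀ η₁ t₁ ∧
          T t₁ t₂ (T t₀ t₁ x) = T t₀ t₂ x ∧
          q t₁ t₂ (T t₀ t₁ x) * q t₀ t₁ x = q t₀ t₂ x) := by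
  have H : HKFlow.OrderedPair a b ξ₀ η₁ := ⟨ha, hb, hξ₀, hξ₀a, hη₁, hη₁b, hle⟩
  refine ⟨fun t ht x => H.bwd_le_fwd ht x, fun t ht => H.isClosed_contactSet ht,
    fun x hx h => H.mem_contactSet_one hx h, fun x hx h => H.mem_contactSet_zero hx h,
    fun t ht x => ?_, fun t ht => H.setOf_neg_half_eq ht, fun t ht => H.setOf_half_eq ht,
    fun t ht => ⟨fun x hx => H.mem_contactSet_of_neg_half ht hx,
      fun x hx => H.mem_contactSet_of_half ht hx⟩,
    HKFlow.fwdGradient ξ₀, HKFlow.transport ξ₀, HKFlow.growth ξ₀,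
    fun t ht x hx p => H.eq_fwdGradient_iff ht hx p,
    fun t ht x hx => ⟨(H.fwdGradient_spec ht hx).1, (H.fwdGradient_spec ht hx).2.1⟩,
    fun t ht => ⟨⟨_, fun x hx => (H.fwdGradient_spec ht hx).2.2.1⟩,
      fun x hx y hy => H.norm_fwdGradient_sub_le ht hx hy, H.Lam_add_Lam_le ht,
      fun x hx => H.fwdGradient_of_stationary ht hx⟩,
    fun s hs t ht hts x hx hpos => ?_,
    fun s hs t ht x hx =>
      HKFlow.OrderedPair.transport_of_gradient_eq_zero t (H.fwdGradient_of_stationary hs hx),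
    fun s hs x => HKFlow.OrderedPair.transport_self ξ₀ s x,
    fun s hs x hx => H.analyticOn_transport hs hx,
    fun s hs t ht => H.lipschitzOnWith_transport hs ht,
    fun s hs => H.locallyLipschitzOn_transport hs 0 sdiff_subset fun x hx => ?_,
    fun s hs => H.locallyLipschitzOn_transport hs 1 sdiff_subset fun x hx => ?_,
    fun s hs t ht x hx => ?_,
    fun s hs x hx => H.analyticOn_growth hs hx,
    fun s hs t ht => ⟨H.exists_abs_growth_le hs t, H.lipschitzOnWith_growth hs t⟩,
    fun s hs t ht x hx h0 h1 => ?_,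
    fun s hs t ht x hx => H.growth_of_gradient_eq_zero hs ht (H.fwdGradient_of_stationary hs hx),
    fun r hr s hs t ht x hx => ⟨H.transport_mem hr hs hx, H.transport_transport hr hs ht hx, ?_⟩⟩
  · rw [← H.coe_fwd ht, ← H.coe_bwd ht]
    exact ⟨EReal.coe_ne_bot _, EReal.coe_ne_top _, EReal.coe_ne_bot _, EReal.coe_ne_top _⟩
  · obtain ⟨h1, h2, h3, h4, h5, h6⟩ := H.transport_spec hs ht hts hx hpos
    exact ⟨h1, h2, h3, rfl, h4, h5, h6⟩
  -- Off Ξ⁺ the weight towards time 0 cannot vanish; the next case is its mirror image at time 1.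
  · by_contra! h
    rcases H.weight_eq_zero hs ⟨le_rfl, zero_le_one⟩ hx.1 h with h' | h'
    · exact hx.2 h'.2
    · exact zero_ne_one h'.1
  · by_contra! h
    rcases H.weight_eq_zero hs ⟨zero_le_one, le_rfl⟩ hx.1 h with h' | h'
    · exact one_ne_zero h'.1
    · exact hx.2 h'.2
  · have hsq : HKFlow.growth ξ₀ s t x ^ 2 = HKFlow.growthSq ξ₀ s t x := by
      refine Real.sq_sqrt ?_
      rw [HKFlow.growthSq]
      positivity
    obtain ⟨h1, h2⟩ := H.growth_quotient hs ht hx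
    rw [hsq]
    exact ⟨Real.sqrt_nonneg _, h1, h2, rfl⟩
  · refine Real.sqrt_pos.2 (HKFlow.OrderedPair.growthSq_pos (ne_of_gt ?_))
    by_contra! h
    rcases H.weight_eq_zero hs ht hx h with h' | h'
    · exact h0 h'.1 h'.2
    · exact h1 h'.1 h'.2
  · rw [HKFlow.growth, HKFlow.growth, HKFlow.growth, ← H.growthSq_mul (r := t) hr hs hx,
      Real.sqrt_mul (by rw [HKFlow.growthSq]; positivity)]
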